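/- Throughout, $\mathbb K\in\{\mathbb R,\mathbb C\}$, all Banach spaces are over $\mathbb K$, $B_X$ is the closed unit ball of $X$, and operators are bounded and linear. **Trees.** For an ordinal $a$ and a finite sequence of ordinals put $a+(\zeta_1,\dots,\zeta_k)=(a+\zeta_1,\dots,a+\zeta_k)$. Sets of finite sequences are ordered by $s\le t$ iff $s$ is an initial segment of $t$, and $MAX(T)$ is the set of maximal elements of $T$. Let $\Gamma_{0,1}=\{(0)\}$. Given $\Gamma_{\xi,1}$, let for $1\le i\le n$ $$\Lambda_{\xi,n,i}=\{(\omega^\xi(n-1)+t_1)^\frown\cdots^\frown(\omega^\xi(n-i)+t_i): t_1,\dots,t_{i-1}\in MAX(\Gamma_{\xi,1}),\ t_i\in\Gamma_{\xi,1}\},$$ $\Gamma_{\xi,n}=\bigcup_{i=1}^n\Lambda_{\xi,n,i}$ and $\Gamma_{\xi+1,1}=\bigcup_{n\ge1}\Gamma_{\xi,n}$; for a limit ordinal $\xi$ let $\Gamma_{\xi,1}=\bigcup_{\zeta<\xi}(\omega^\zeta+\Gamma_{\zeta+1,1})$. The weights $\mathbb P_{\xi,n}:\Gamma_{\xi,n}\to[0,1]$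 are given by $\mathbb P_{0,1}((0))=1$; $\mathbb P_{\xi,n}((\omega^\xi(n-1)+t_1)^\frown\cdots^\frown(\omega^\xi(n-i)+t_i))=\mathbb P_{\xi,1}(t_i)$; $\mathbb P_{\xi+1,1}(t)=\frac1n\mathbb P_{\xi,n}(t)$ for $t\in\Gamma_{\xi,n}$; and $\mathbb P_{\xi,1}(\omega^\zeta+t)=\mathbb P_{\zeta+1,1}(t)$ for $\xi$ a limit ordinal, $\zeta<\xi$ and $t\in\Gamma_{\zeta+1,1}$. For a (nonempty) directed set $D$ and $T$ one of the sets $\Gamma_{\xi,n}$, $\Lambda_{\xi,n,i}$, let $T.D=\{(\zeta_j,u_j)_{j=1}^k:(\zeta_j)_{j=1}^k\in T,\ u_j\in D\}$, with weights $\mathbb P_{\xi,n}((\zeta_j,u_j)_{j=1}^k)=\mathbb P_{\xi,n}((\zeta_j)_{j=1}^k)$. A collection $(x_t)_{t\in\Gamma_{\xi,n}.D}$ in $X$ is *weakly null* if for every (possibly empty) sequence $t$ and every ordinal $\zeta$ with $\{t^\frown(\zeta,u):u\in D\}\subset\Gamma_{\xi,n}.D$ the net $(x_{t^\frown(\zeta,u)})_{u\in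 D}$ is weakly null. For $t\in MAX(\Gamma_{\xi,n}.D)$ put $z^t_i=\sum\{\mathbb P_{\xi,n}(s)x_s: s\le t,\ s\in\Lambda_{\xi,n,i}.D\}$. **The quantity $\alpha_{\xi,p}$.** Let $1\le p\le\infty$ and let $K\subset X^*$ be weak$^*$-compact; let $r_K(x)=\max_{x^*\in K}\operatorname{Re}x^*(x)$ ($=0$ if $K=\varnothing$). Let $\alpha_{\xi,p,n}(K)$ be the infimum of all $\alpha>0$ such that $$\inf_{t\in MAX(\Gamma_{\xi,n}.D)}r_K\Bigl(\sum_{i=1}^na_iz^t_i\Bigr)\le\alpha\|(a_i)_{i=1}^n\|_{\ell_p^n}$$ for all directed sets $D$, all $(a_i)_{i=1}^n\in\mathbb K^n$ and all weakly null $(x_t)_{t\in\Gamma_{\xi,n}.D}\subset B_X$, and let $\alpha_{\xi,p}(K)=\sup_{n\ge1}\alpha_{\xi,p,n}(K)\in[0,\infty]$. For an operator $A:X\to Y$ let $\alpha_{\xi,p}(A)=\alpha_{\xi,p}(A^*B_{Y^*})$. **Summable Szlenk index.** For $K\subset X^*$ weak$^*$-compact and $\varepsilon>0$ let $s_\varepsilon(K)$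 be the set of all $x^*\in K$ such that $\operatorname{diam}(V\cap K)>\varepsilon$ (norm diameter) for every weak$^*$-neighborhood $V$ of $x^*$. Let $s^0_\varepsilon(K)=K$, $s^{\zeta+1}_\varepsilon(K)=s_\varepsilon(s^\zeta_\varepsilon(K))$, $s^\zeta_\varepsilon(K)=\bigcap_{\eta<\zeta}s^\eta_\varepsilon(K)$ for $\zeta$ a limit ordinal, and $s^\zeta_0(K)=K$. For $1\le q<\infty$, $K$ has *$\xi$-$q$-summable Szlenk index* if there is $M\ge0$ such that $\sum_{i=1}^n\varepsilon_i^q\le M^q$ whenever $\varepsilon_1,\dots,\varepsilon_n\ge0$ and $s^{\omega^\xi}_{\varepsilon_1}\cdots s^{\omega^\xi}_{\varepsilon_n}(K)\neq\varnothing$. An operator $A:X\to Y$ has $\xi$-$q$-summable Szlenk index if $A^*B_{Y^*}$ does. **Banach ideals.** A class $\mathfrak I$ of operators between Banach spaces, with $\mathfrak I(X,Y)$ the set of its members from $X$ to $Y$, is an *ideal* if $ABC\in\mathfrak I$ whenever $B\in\mathfrak I$ and $A,C$ are operators for which $ABC$ is defined, $I_{\mathbb K}\in\mathfrak I$, and each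 $\mathfrak I(X,Y)$ is a vector subspace of the space of all operators from $X$ to $Y$. A map $\iota:\mathfrak I\to[0,\infty)$ is an *ideal norm* if it is a norm on each $\mathfrak I(X,Y)$, $\iota(ABC)\le\|A\|\,\iota(B)\,\|C\|$ for all $B\in\mathfrak I$ and all such operators $A,C$, and $\iota(x^*\otimes y)=\|x^*\|\|y\|$ for all $x^*\in X^*$, $y\in Y$, where $(x^*\otimes y)(x)=x^*(x)y$. Then $(\mathfrak I,\iota)$ is a *Banach ideal* if each $(\mathfrak I(X,Y),\iota)$ is complete. **Theorem.** Let $\xi$ be an ordinal, $1<p\le\infty$ and $1/p+1/q=1$. Let $\mathfrak A_{\xi,p}$ be the class of all operators between Banach spaces with $\xi$-$q$-summable Szlenk index, and $\mathfrak a_{\xi,p}(A)=\|A\|+\alpha_{\xi,p}(A)$. Then $(\mathfrak A_{\xi,p},\mathfrak a_{\xi,p})$ is a Banach ideal. (In particular $\alpha_{\xi,p}(A)<\infty$ for $A\in\mathfrak A_{\xi,p}$.) -/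

import Mathlib

open Filter Topology
open scoped ENNReal Ordinal

universe u v

noncomputable section

namespace Szlenk

/-! ### Trees of ordinals -/

/-- The nodes of `T` without proper extension in `T`, for the initial segment order. -/
def maxNodes {α : Type*} (T : Set (List α)) : Set (List α) :=
  {t | t ∈ T ∧ ∀ s ∈ T, t <+: s → s = t}

/-- `a + (ζ₁, …, ζₖ) = (a + ζ₁, …, a + ζₖ)`. -/
def shift (a : Ordinal.{u}) (t : List Ordinal.{u}) : List Ordinal.{u} :=
  t.map (a + ·)

/-- For `b = ω ^ ξ` and `G = Γ_{ξ,1}`, `level b G n i` is the level `Λ_{ξ,n,i+1}` (levels are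
counted from `0` here). It consists of the sequences
`(b (n - 1) + t₁) ⌢ ⋯ ⌢ (b (n - i - 1) + tᵢ₊₁)` with `t₁, …, tᵢ` maximal in `G` and `tᵢ₊₁` in `G`;
it is empty unless `i < n`. -/
def level (b : Ordinal.{u}) (G : Set (List Ordinal.{u})) : ℕ → ℕ → Set (List Ordinal.{u})
  | 0, _ => ∅
  | n + 1, 0 => shift (b * n) '' G
  | n + 1, i + 1 => {t | ∃ s ∈ maxNodes G, ∃ r ∈ level b G n i, t = shift (b * n) s ++ r}

/-- The tree `Γ_{ξ,1}`: it is `{(0)}` for `ξ = 0`, the union of all `Γ_{η,n}` for `ξ = η + 1`, and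
the union of all `ω ^ ζ + Γ_{ζ+1,1}` with `ζ < ξ` for a limit ordinal `ξ`. -/
def Gamma₁ (ξ : Ordinal.{u}) : Set (List Ordinal.{u}) :=
  Ordinal.limitRecOn (motive := fun _ => Set (List Ordinal.{u})) ξ {[0]}
    (fun η G => {t | ∃ n i : ℕ, t ∈ level (ω ^ η) G n i})
    (fun _ hξ G => {t | ∃ ζ, ∃ h : ζ < _, t ∈ shift (ω ^ ζ) '' G (ζ + 1) (hξ.add_one_lt h)})

/-- The level `Λ_{ξ,n,i+1}` of `Γ_{ξ,n}`. -/
def Lambda (ξ : Ordinal.{u}) (n i : ℕ) : Set (List Ordinal.{u}) :=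
  level (ω ^ ξ) (Gamma₁ ξ) n i

/-- The tree `Γ_{ξ,n}`, the union of its levels. -/
def Gamma (ξ : Ordinal.{u}) (n : ℕ) : Set (List Ordinal.{u}) :=
  {t | ∃ i, t ∈ Lambda ξ n i}

open Classical in
/-- If `t = (ω ^ ξ (n - 1) + t₁) ⌢ ⋯ ⌢ (ω ^ ξ (n - i) + tᵢ)` with nonempty sequences `tⱼ` of
ordinals below `ω ^ ξ`, then `lastBlock ξ t = tᵢ`: one keeps the entries with the same quotient by
`ω ^ ξ` as the last entry, and replaces them by their remainders. -/
def lastBlock (ξ : Ordinal.{u}) (t : List Ordinal.{u}) : List Ordinal.{u} :=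
  (t.filter (fun a => a / ω ^ ξ = t.getLastD 0 / ω ^ ξ)).map (· % ω ^ ξ)

/-- For `t ∈ Γ_{ξ,n}` this is `n`, as the first entry of `t` is in `[ω ^ ξ (n - 1), ω ^ ξ n)`. -/
def treeIndex (ξ : Ordinal.{u}) (t : List Ordinal.{u}) : ℕ :=
  sInf {n : ℕ | t.headD 0 < ω ^ ξ * n}

/-- The weights `ℙ_{ξ,1}` on `Γ_{ξ,1}`: `ℙ_{0,1}(t) = 1`; `ℙ_{ξ+1,1}(t) = ℙ_{ξ,n}(t) / n` for
`t ∈ Γ_{ξ,n}`, where `ℙ_{ξ,n}(t) = ℙ_{ξ,1}(lastBlock ξ t)`; and, for a limit ordinal `ξ`,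
`ℙ_{ξ,1}(ω ^ ζ + t) = ℙ_{ζ+1,1}(t)` for `ζ < ξ` and `t ∈ Γ_{ζ+1,1}` (here `ζ` is recovered as the
logarithm to the base `ω` of the first entry). -/
def weight₁ (ξ : Ordinal.{u}) : List Ordinal.{u} → ℝ :=
  Ordinal.limitRecOn (motive := fun _ => List Ordinal.{u} → ℝ) ξ (fun _ => 1)
    (fun η P t => P (lastBlock η t) / treeIndex η t)
    (fun lam hξ P t =>
      let ζ := Ordinal.log ω (t.headD 0)
      open Classical in
      if h : ζ < lam then P (ζ + 1) (hξ.add_one_lt h) (t.map (· - ω ^ ζ)) else 0)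

/-- The weights `ℙ_{ξ,n}` on `Γ_{ξ,n}` (the formula is the same for all `n`):
`ℙ_{ξ,n}((ω ^ ξ (n - 1) + t₁) ⌢ ⋯ ⌢ (ω ^ ξ (n - i) + tᵢ)) = ℙ_{ξ,1}(tᵢ)`. -/
def weight (ξ : Ordinal.{u}) (t : List Ordinal.{u}) : ℝ :=
  weight₁ ξ (lastBlock ξ t)

/-! The recursions that characterize the trees and the weights. -/

theorem Gamma₁_zero : Gamma₁ (0 : Ordinal.{u}) = {[0]} := by
  simp [Gamma₁]

theorem Gamma_one (ξ : Ordinal.{u}) : Gamma ξ 1 = Gamma₁ ξ := by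
  ext t
  constructor
  · rintro ⟨_ | i, h⟩
    · simpa [Lambda, level, shift] using h
    · simp [Lambda, level] at h
  · intro h
    exact ⟨0, by simpa [Lambda, level, shift] using h⟩

theorem Gamma₁_add_one (ξ : Ordinal.{u}) : Gamma₁ (ξ + 1) = {t | ∃ n, t ∈ Gamma ξ n} := by
  simp [Gamma₁, Gamma, Lambda]

theorem Gamma₁_limit {ξ : Ordinal.{u}} (hξ : Order.IsSuccLimit ξ) :
    Gamma₁ ξ = {t | ∃ ζ < ξ, t ∈ shift (ω ^ ζ) '' Gamma₁ (ζ + 1)} := by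
  unfold Gamma₁
  rw [Ordinal.limitRecOn_limit _ _ _ _ hξ]
  simp only [exists_prop]

theorem ne_nil_lt_of_level {b : Ordinal.{u}} {G : Set (List Ordinal.{u})}
    (hG : ∀ t ∈ G, t ≠ [] ∧ ∀ a ∈ t, a < b) :
    ∀ n i, ∀ t ∈ level b G n i, t ≠ [] ∧ (∀ a ∈ t, a < b * n) ∧ b * (n - 1 : ℕ) ≤ t.headD 0
  | 0, _, t, h => by simp [level] at h
  | n + 1, 0, t, h => by
      obtain ⟨s, hs, rfl⟩ := h
      obtain ⟨h1, h2⟩ := hG s hs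
      refine ⟨by simpa [shift] using h1, fun a ha => ?_, ?_⟩
      · simp only [shift, List.mem_map] at ha
        obtain ⟨c, hc, rfl⟩ := ha
        push_cast
        rw [mul_add, mul_one]
        exact (add_lt_add_iff_left _).2 (h2 c hc)
      · cases s with
        | nil => exact absurd rfl h1
        | cons c s => simp [shift]
  | n + 1, i + 1, t, h => by
      obtain ⟨s, hs, r, hr, rfl⟩ := h
      obtain ⟨h1, h2⟩ := hG s hs.1
      obtain ⟨h3, h4, -⟩ := ne_nil_lt_of_level hG n i r hr
      refine ⟨by simp [h3], fun a ha => ?_, ?_⟩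
      · have key : b * (n + 1 : ℕ) = b * n + b := by push_cast; rw [mul_add, mul_one]
        rw [key]
        rcases List.mem_append.1 ha with ha | ha
        · simp only [shift, List.mem_map] at ha
          obtain ⟨c, hc, rfl⟩ := ha
          exact (add_lt_add_iff_left _).2 (h2 c hc)
        · exact (h4 a ha).trans_le le_self_add
      · cases s with
        | nil => exact absurd rfl h1
        | cons c s => simp [shift]

theorem ne_nil_lt_of_Gamma₁ (ξ : Ordinal.{u}) :
    ∀ t ∈ Gamma₁ ξ, t ≠ [] ∧ ∀ a ∈ t, a < ω ^ ξ := by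
  induction ξ using Ordinal.limitRecOn with
  | zero => simp [Gamma₁_zero]
  | add_one ξ ih =>
      intro t ht
      rw [Gamma₁_add_one] at ht
      obtain ⟨n, i, h⟩ := ht
      obtain ⟨h1, h2, -⟩ := ne_nil_lt_of_level ih n i t h
      refine ⟨h1, fun a ha => (h2 a ha).trans ?_⟩
      rw [Ordinal.opow_add, Ordinal.opow_one]
      exact (mul_lt_mul_iff_right₀ (Ordinal.opow_pos _ Ordinal.omega0_pos)).2 (Ordinal.natCast_lt_omega0 n)
  | limit ξ hξ ih =>
      intro t ht
      rw [Gamma₁_limit hξ] at ht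
      obtain ⟨ζ, hζ, s, hs, rfl⟩ := ht
      have hζ1 := hξ.add_one_lt hζ
      obtain ⟨h1, h2⟩ := ih _ hζ1 s hs
      refine ⟨by simpa [shift] using h1, fun a ha => ?_⟩
      simp only [shift, List.mem_map] at ha
      obtain ⟨c, hc, rfl⟩ := ha
      have hlt : ω ^ (ζ + 1) < ω ^ ξ := (Ordinal.opow_lt_opow_iff_right Ordinal.one_lt_omega0).2 hζ1
      exact (Ordinal.isPrincipal_add_omega0_opow ξ) ((Ordinal.opow_lt_opow_iff_right Ordinal.one_lt_omega0).2 hζ) ((h2 c hc).trans hlt)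

theorem lastBlock_shift {ξ : Ordinal.{u}} (n : ℕ) {t : List Ordinal.{u}}
    (ht : ∀ a ∈ t, a < ω ^ ξ) : lastBlock ξ (shift (ω ^ ξ * n) t) = t := by
  have hpos : (ω ^ ξ : Ordinal.{u}) ≠ 0 := (Ordinal.opow_pos _ Ordinal.omega0_pos).ne'
  rcases List.eq_nil_or_concat' t with rfl | ⟨l, c, rfl⟩
  · simp [lastBlock, shift]
  have hq : ∀ a ∈ l ++ [c], (ω ^ ξ * n + a) / ω ^ ξ = n := fun a ha => by
    rw [Ordinal.mul_add_div _ hpos, Ordinal.div_eq_zero_of_lt (ht a ha), add_zero]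
  have hm : ∀ a ∈ l ++ [c], (ω ^ ξ * n + a) % ω ^ ξ = a := fun a ha => by
    rw [Ordinal.mul_add_mod_self, Ordinal.mod_eq_of_lt (ht a ha)]
  have hlast : (shift (ω ^ ξ * n) (l ++ [c])).getLastD 0 = ω ^ ξ * n + c := by
    simp [shift]
  unfold lastBlock
  rw [hlast, hq c (by simp), List.filter_eq_self.2]
  · rw [shift, List.map_map]
    conv_rhs => rw [← List.map_id (l ++ [c])]
    exact List.map_congr_left fun a ha => by simp only [Function.comp, id]; exact hm a ha
  · intro a ha
    simp only [shift, List.mem_map] at ha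
    obtain ⟨d, hd, rfl⟩ := ha
    simpa using hq d hd

theorem lastBlock_append {ξ : Ordinal.{u}} (n : ℕ) {s r : List Ordinal.{u}}
    (hr : r ≠ []) (hr' : ∀ a ∈ r, a < ω ^ ξ * n) :
    lastBlock ξ (shift (ω ^ ξ * n) s ++ r) = lastBlock ξ r := by
  have hpos : (ω ^ ξ : Ordinal.{u}) ≠ 0 := (Ordinal.opow_pos _ Ordinal.omega0_pos).ne'
  rcases List.eq_nil_or_concat' r with rfl | ⟨l, c, rfl⟩
  · exact absurd rfl hr
  have hc : c / ω ^ ξ < n := (Ordinal.lt_mul_iff_div_lt hpos).1 (hr' c (by simp))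
  have h1 : (shift (ω ^ ξ * n) s ++ (l ++ [c])).getLastD 0 = c := by
    rw [← List.append_assoc]; simp
  unfold lastBlock
  rw [h1, List.filter_append, List.filter_eq_nil_iff.2]
  · simp
  · intro a ha
    simp only [shift, List.mem_map] at ha
    obtain ⟨d, hd, rfl⟩ := ha
    simp only [decide_eq_true_eq]
    rw [Ordinal.mul_add_div _ hpos]
    exact (hc.trans_le le_self_add).ne'

theorem weight_zero (t : List Ordinal.{u}) : weight₁ 0 t = 1 := by simp [weight₁]

theorem weight_level_zero (ξ : Ordinal.{u}) (n : ℕ) {t : List Ordinal.{u}} (ht : t ∈ Gamma₁ ξ) :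
    weight ξ (shift (ω ^ ξ * n) t) = weight₁ ξ t := by
  rw [weight, lastBlock_shift n (ne_nil_lt_of_Gamma₁ ξ t ht).2]

theorem weight_level_succ (ξ : Ordinal.{u}) (n : ℕ) (s : List Ordinal.{u}) {r : List Ordinal.{u}}
    (hr : r ∈ Gamma ξ n) : weight ξ (shift (ω ^ ξ * n) s ++ r) = weight ξ r := by
  obtain ⟨i, hi⟩ := hr
  obtain ⟨h1, h2, -⟩ := ne_nil_lt_of_level (ne_nil_lt_of_Gamma₁ ξ) n i r hi
  rw [weight, lastBlock_append n h1 h2, weight]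

theorem weight_add_one (ξ : Ordinal.{u}) (n : ℕ) {t : List Ordinal.{u}} (ht : t ∈ Gamma ξ n) :
    weight₁ (ξ + 1) t = weight ξ t / n := by
  have hpos : 0 < (ω ^ ξ : Ordinal.{u}) := Ordinal.opow_pos _ Ordinal.omega0_pos
  obtain ⟨i, hi⟩ := ht
  obtain ⟨h1, h2, h3⟩ := ne_nil_lt_of_level (ne_nil_lt_of_Gamma₁ ξ) n i t hi
  have hn : treeIndex ξ t = n := by
    have hmem : t.headD 0 < ω ^ ξ * n := by
      cases t with
      | nil => exact absurd rfl h1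
      | cons c s => exact h2 c (by simp)
    refine le_antisymm (Nat.sInf_le hmem) (le_csInf ⟨n, hmem⟩ fun m hm => ?_)
    have := (mul_lt_mul_iff_right₀ hpos).1 (h3.trans_lt hm)
    have : n - 1 < m := by exact_mod_cast this
    omega
  rw [weight₁, Ordinal.limitRecOn_add_one, hn]
  rfl

theorem weight_limit {ξ ζ : Ordinal.{u}} (hξ : Order.IsSuccLimit ξ) (hζ : ζ < ξ)
    {t : List Ordinal.{u}} (ht : t ∈ Gamma₁ (ζ + 1)) :
    weight₁ ξ (shift (ω ^ ζ) t) = weight₁ (ζ + 1) t := by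
  obtain ⟨h1, h2⟩ := ne_nil_lt_of_Gamma₁ _ t ht
  have hlog : Ordinal.log ω ((shift (ω ^ ζ) t).headD 0) = ζ := by
    cases t with
    | nil => exact absurd rfl h1
    | cons c s =>
      have hc : c < ω ^ (ζ + 1) := h2 c (by simp)
      simp only [shift, List.map_cons, List.headD_cons]
      refine (Ordinal.log_eq_iff Ordinal.one_lt_omega0 ?_ _).2 ⟨le_self_add, ?_⟩
      · exact (lt_of_lt_of_le (Ordinal.opow_pos _ Ordinal.omega0_pos) le_self_add).ne'
      · exact (Ordinal.isPrincipal_add_omega0_opow (ζ+1)) ((Ordinal.opow_lt_opow_iff_right Ordinal.one_lt_omega0).2 (by simp)) hc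
  have hmap : (shift (ω ^ ζ) t).map (· - ω ^ ζ) = t := by
    rw [shift, List.map_map]
    conv_rhs => rw [← List.map_id t]
    exact List.map_congr_left fun a _ => by simp
  rw [weight₁, Ordinal.limitRecOn_limit _ _ _ _ hξ]
  simp only [hlog, hζ, dif_pos, hmap]
  rfl

/-- The tree `T.D` of all `(ζ₁, u₁), …, (ζₖ, uₖ)` with `(ζ₁, …, ζₖ) ∈ T` and `u₁, …, uₖ ∈ D`. -/
def decorate (T : Set (List Ordinal.{u})) (D : Type v) : Set (List (Ordinal.{u} × D)) :=
  {t | t.map Prod.fst ∈ T}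

section Banach

variable (𝕜 : Type) [RCLike 𝕜]

/-- The collection `(x_t)_{t ∈ T}` is weakly null: for every sequence `t` (possibly empty) and every
ordinal `ζ` such that the `t ⌢ (ζ, u)` lie in `T`, the net `(x_{t ⌢ (ζ, u)})_{u ∈ D}` is weakly
null. -/
def WeaklyNull {X : Type v} [NormedAddCommGroup X] [NormedSpace 𝕜 X] {D : Type v} [Preorder D]
    (T : Set (List (Ordinal.{u} × D))) (x : List (Ordinal.{u} × D) → X) : Prop :=
  ∀ (t : List (Ordinal.{u} × D)) (ζ : Ordinal.{u}), (∀ u : D, t ++ [(ζ, u)] ∈ T) →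
    ∀ f : StrongDual 𝕜 X, Tendsto (fun u : D => f (x (t ++ [(ζ, u)]))) atTop (𝓝 0)

open Classical in
/-- `z^t_{i+1}`, the sum of `ℙ_{ξ,n}(s) x_s` over the initial segments `s` of `t` in the level
`Λ_{ξ,n,i+1}.D`. -/
def blockSum {X : Type v} [NormedAddCommGroup X] [NormedSpace 𝕜 X] {D : Type v}
    (ξ : Ordinal.{u}) (n i : ℕ) (x : List (Ordinal.{u} × D) → X)
    (t : List (Ordinal.{u} × D)) : X :=
  ∑ k ∈ (Finset.range (t.length + 1)).filter (fun k => t.take k ∈ decorate (Lambda ξ n i) D),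
    ((weight ξ ((t.take k).map Prod.fst) : ℝ) : 𝕜) • x (t.take k)

variable {𝕜}

/-- `r_K(x)`, the maximum of `Re f(x)` over `f ∈ K` (and `0` if `K` is empty). -/
def support {X : Type v} [NormedAddCommGroup X] [NormedSpace 𝕜 X] (K : Set (StrongDual 𝕜 X))
    (x : X) : ℝ :=
  sSup ((fun f : StrongDual 𝕜 X => RCLike.re (f x)) '' K)

/-- `α` satisfies the upper estimate that defines `α_{ξ,p,n}(K)`. -/
def UpperEstimate {X : Type v} [NormedAddCommGroup X] [NormedSpace 𝕜 X]
    (ξ : Ordinal.{u}) (p : ℝ≥0∞) (n : ℕ) (K : Set (StrongDual 𝕜 X)) (α : ℝ) : Prop :=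
  ∀ (D : Type v) [Preorder D] [IsDirectedOrder D] [Nonempty D]
    (a : Fin n → 𝕜) (x : List (Ordinal.{u} × D) → X),
    (∀ t ∈ decorate (Gamma ξ n) D, ‖x t‖ ≤ 1) →
    WeaklyNull 𝕜 (decorate (Gamma ξ n) D) x →
    ⨅ t : maxNodes (decorate (Gamma ξ n) D),
        support K (∑ i : Fin n, a i • blockSum 𝕜 ξ n i x t)
      ≤ α * ‖(WithLp.toLp p a : PiLp p fun _ : Fin n => 𝕜)‖

/-- The quantity `α_{ξ,p,n}(K)`. -/
def alphaN {X : Type v} [NormedAddCommGroup X] [NormedSpace 𝕜 X]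
    (ξ : Ordinal.{u}) (p : ℝ≥0∞) (n : ℕ) (K : Set (StrongDual 𝕜 X)) : ℝ≥0∞ :=
  ⨅ (α : ℝ) (_ : 0 < α ∧ UpperEstimate ξ p n K α), ENNReal.ofReal α

/-- The quantity `α_{ξ,p}(K) = sup_{n ≥ 1} α_{ξ,p,n}(K)`. -/
def alpha {X : Type v} [NormedAddCommGroup X] [NormedSpace 𝕜 X]
    (ξ : Ordinal.{u}) (p : ℝ≥0∞) (K : Set (StrongDual 𝕜 X)) : ℝ≥0∞ :=
  ⨆ (n : ℕ) (_ : 1 ≤ n), alphaN ξ p n K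

/-! ### Szlenk derivations -/

/-- `s_ε(K)`: for `ε > 0`, the `f ∈ K` such that `V ∩ K` has norm diameter `> ε` for every
weak-star neighbourhood `V` of `f`; and `K` itself for `ε ≤ 0`. -/
def derive {X : Type v} [NormedAddCommGroup X] [NormedSpace 𝕜 X] (ε : ℝ)
    (K : Set (StrongDual 𝕜 X)) : Set (StrongDual 𝕜 X) :=
  {f | f ∈ K ∧ (0 < ε → ∀ V ∈ 𝓝 (StrongDual.toWeakDual f),
    ENNReal.ofReal ε < Metric.ediam (StrongDual.toWeakDual ⁻¹' V ∩ K))}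

/-- The transfinite iterate `s_ε^ξ(K)`. -/
def deriveIter {X : Type v} [NormedAddCommGroup X] [NormedSpace 𝕜 X] (ε : ℝ) (ξ : Ordinal.{u})
    (K : Set (StrongDual 𝕜 X)) : Set (StrongDual 𝕜 X) :=
  Ordinal.limitRecOn (motive := fun _ => Set (StrongDual 𝕜 X)) ξ K
    (fun _ L => derive ε L)
    (fun _ _ L => {f | ∀ ζ, ∀ h : ζ < _, f ∈ L ζ h})

/-- `K` has `ξ`-`q`-summable Szlenk index: there is `M ≥ 0` with `∑ εᵢ ^ q ≤ M ^ q` whenever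
`ε₁, …, εₙ ≥ 0` and `s_{ε₁}^{ω ^ ξ} ⋯ s_{εₙ}^{ω ^ ξ}(K)` is nonempty. -/
def HasSummableSzlenkIndex {X : Type v} [NormedAddCommGroup X] [NormedSpace 𝕜 X]
    (ξ : Ordinal.{u}) (q : ℝ) (K : Set (StrongDual 𝕜 X)) : Prop :=
  ∃ M : ℝ, 0 ≤ M ∧ ∀ l : List ℝ, (∀ ε ∈ l, 0 ≤ ε) →
    (l.foldr (fun ε L => deriveIter ε (ω ^ ξ) L) K).Nonempty →
    (l.map (fun ε => ε ^ q)).sum ≤ M ^ q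

/-! ### Operators and ideals -/

/-- `A^* B_{Y^*}`, the image of the closed dual unit ball under the adjoint of `A`. -/
def adjointBall {X Y : Type v} [NormedAddCommGroup X] [NormedSpace 𝕜 X]
    [NormedAddCommGroup Y] [NormedSpace 𝕜 Y] (A : X →L[𝕜] Y) : Set (StrongDual 𝕜 X) :=
  (fun g : StrongDual 𝕜 Y => g.comp A) '' Metric.closedBall 0 1

variable (𝕜)

/-- A class of operators between Banach spaces over `𝕜`. -/
abbrev OperatorClass : Type (v + 1) :=
  ∀ (X Y : Type v) [NormedAddCommGroup X] [NormedSpace 𝕜 X] [CompleteSpace X]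
    [NormedAddCommGroup Y] [NormedSpace 𝕜 Y] [CompleteSpace Y], Set (X →L[𝕜] Y)

/-- An assignment of extended nonnegative numbers to the operators between Banach spaces. -/
abbrev OperatorGauge : Type (v + 1) :=
  ∀ (X Y : Type v) [NormedAddCommGroup X] [NormedSpace 𝕜 X] [CompleteSpace X]
    [NormedAddCommGroup Y] [NormedSpace 𝕜 Y] [CompleteSpace Y], (X →L[𝕜] Y) → ℝ≥0∞

/-- Operator ideals. -/
structure IsOperatorIdeal (I : OperatorClass.{v} 𝕜) : Prop where
  comp_mem : ∀ (W X Y Z : Type v)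
    [NormedAddCommGroup W] [NormedSpace 𝕜 W] [CompleteSpace W]
    [NormedAddCommGroup X] [NormedSpace 𝕜 X] [CompleteSpace X]
    [NormedAddCommGroup Y] [NormedSpace 𝕜 Y] [CompleteSpace Y]
    [NormedAddCommGroup Z] [NormedSpace 𝕜 Z] [CompleteSpace Z]
    (C : W →L[𝕜] X) (B : X →L[𝕜] Y) (A : Y →L[𝕜] Z), B ∈ I X Y → A.comp (B.comp C) ∈ I W Z
  /-- The identity of the scalar field (lifted to the universe at hand) is in the ideal. -/
  id_mem : ContinuousLinearMap.id 𝕜 (ULift.{v} 𝕜) ∈ I (ULift.{v} 𝕜) (ULift.{v} 𝕜)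
  isSubspace : ∀ (X Y : Type v)
    [NormedAddCommGroup X] [NormedSpace 𝕜 X] [CompleteSpace X]
    [NormedAddCommGroup Y] [NormedSpace 𝕜 Y] [CompleteSpace Y],
    ∃ S : Submodule 𝕜 (X →L[𝕜] Y), (S : Set (X →L[𝕜] Y)) = I X Y

/-- `ι` is an ideal norm on `I`: it is finite on `I`, a norm on each `I(X, Y)`, compatible with
composition, and `ι(f ⊗ y) = ‖f‖ ‖y‖` for the rank one operators `f ⊗ y = f(·) y`. -/
structure IsIdealNorm (I : OperatorClass.{v} 𝕜) (ι : OperatorGauge.{v} 𝕜) : Prop where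
  lt_top : ∀ (X Y : Type v)
    [NormedAddCommGroup X] [NormedSpace 𝕜 X] [CompleteSpace X]
    [NormedAddCommGroup Y] [NormedSpace 𝕜 Y] [CompleteSpace Y],
    ∀ A ∈ I X Y, ι X Y A < ∞
  eq_zero_iff : ∀ (X Y : Type v)
    [NormedAddCommGroup X] [NormedSpace 𝕜 X] [CompleteSpace X]
    [NormedAddCommGroup Y] [NormedSpace 𝕜 Y] [CompleteSpace Y],
    ∀ A ∈ I X Y, ι X Y A = 0 ↔ A = 0
  smul : ∀ (X Y : Type v)
    [NormedAddCommGroup X] [NormedSpace 𝕜 X] [CompleteSpace X]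
    [NormedAddCommGroup Y] [NormedSpace 𝕜 Y] [CompleteSpace Y],
    ∀ (c : 𝕜), ∀ A ∈ I X Y, ι X Y (c • A) = ‖c‖ₑ * ι X Y A
  add_le : ∀ (X Y : Type v)
    [NormedAddCommGroup X] [NormedSpace 𝕜 X] [CompleteSpace X]
    [NormedAddCommGroup Y] [NormedSpace 𝕜 Y] [CompleteSpace Y],
    ∀ A ∈ I X Y, ∀ B ∈ I X Y, ι X Y (A + B) ≤ ι X Y A + ι X Y B
  comp_le : ∀ (W X Y Z : Type v)
    [NormedAddCommGroup W] [NormedSpace 𝕜 W] [CompleteSpace W]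
    [NormedAddCommGroup X] [NormedSpace 𝕜 X] [CompleteSpace X]
    [NormedAddCommGroup Y] [NormedSpace 𝕜 Y] [CompleteSpace Y]
    [NormedAddCommGroup Z] [NormedSpace 𝕜 Z] [CompleteSpace Z]
    (C : W →L[𝕜] X) (B : X →L[𝕜] Y) (A : Y →L[𝕜] Z), B ∈ I X Y →
    ι W Z (A.comp (B.comp C)) ≤ ‖A‖ₑ * ι X Y B * ‖C‖ₑ
  rank_one : ∀ (X Y : Type v)
    [NormedAddCommGroup X] [NormedSpace 𝕜 X] [CompleteSpace X]
    [NormedAddCommGroup Y] [NormedSpace 𝕜 Y] [CompleteSpace Y]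
    (f : StrongDual 𝕜 X) (y : Y),
    ι X Y (ContinuousLinearMap.smulRight f y) = ‖f‖ₑ * ‖y‖ₑ

/-- `(I, ι)` is a Banach operator ideal: `I` is an ideal, `ι` is an ideal norm on it, and each
`(I(X, Y), ι)` is complete (every `ι`-Cauchy sequence in it `ι`-converges in it). -/
structure IsBanachIdeal (I : OperatorClass.{v} 𝕜) (ι : OperatorGauge.{v} 𝕜) : Prop where
  isOperatorIdeal : IsOperatorIdeal 𝕜 I
  isIdealNorm : IsIdealNorm 𝕜 I ι
  complete : ∀ (X Y : Type v)
    [NormedAddCommGroup X] [NormedSpace 𝕜 X] [CompleteSpace X]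
    [NormedAddCommGroup Y] [NormedSpace 𝕜 Y] [CompleteSpace Y] (A : ℕ → X →L[𝕜] Y),
    (∀ k, A k ∈ I X Y) →
    (∀ ε : ℝ≥0∞, 0 < ε → ∃ N, ∀ k ≥ N, ∀ l ≥ N, ι X Y (A k - A l) < ε) →
    ∃ B ∈ I X Y, Tendsto (fun k => ι X Y (A k - B)) atTop (𝓝 0)

/-- The class of operators `A` with `ξ`-`q`-summable Szlenk index, that is, such that
`A^* B_{Y^*}` has `ξ`-`q`-summable Szlenk index. -/
def summableSzlenkClass (ξ : Ordinal.{u}) (q : ℝ) : OperatorClass.{v} 𝕜 :=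
  fun _ _ _ _ _ _ _ _ => {A | HasSummableSzlenkIndex ξ q (adjointBall A)}

/-- `𝔞_{ξ,p}(A) = ‖A‖ + α_{ξ,p}(A)`, where `α_{ξ,p}(A) = α_{ξ,p}(A^* B_{Y^*})`. -/
def szlenkNorm (ξ : Ordinal.{u}) (p : ℝ≥0∞) : OperatorGauge.{v} 𝕜 :=
  fun _ _ _ _ _ _ _ _ A => ‖A‖ₑ + alpha ξ p (adjointBall A)

end Banach

end Szlenk

end

/-!
The idea is to replace trees by filters. Let `F₀` be the filter of the weak neighbourhoods of `0`
in the unit ball, let `F_{ξ+1}` be the infimum over `n ≥ 1` of the filters of the averages of `n`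
vectors chosen successively along `F_ξ`, and take infima at limit ordinals. A weakly null tree is a
strategy in a game in which one player picks the ordinals of a branch and the other one picks the
vectors, and playing the game on `Γ_{ξ,n}` shows that the blocks `z₁, …, zₙ` of a suitable maximal
branch of every weakly null tree satisfy a condition if and only if the condition holds for almost
all `z₁`, almost all `z₂`, …, along `F_ξ`. So `α_{ξ,p}(A) ≤ c` says that
`‖A(∑ aᵢ zᵢ)‖ < c‖a‖ₚ + ε` eventually along the iterated filter, for all `a` and
`ε > 0`. Since finitely many such conditions can be imposed simultaneously, `α_{ξ,p}` is
subadditive, although it is defined by an infimum over branches. It is also lower semicontinuous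
for the operator norm, which gives completeness.

The Szlenk derivations can be read off the same filters: up to a constant factor in the `εᵢ`, the
set `s_{ε₁}^{ω^ξ} ⋯ s_{εₙ}^{ω^ξ}(K)` is nonempty if and only if, frequently along the iterated
filter, some `f ∈ K` satisfies `|f(zᵢ)| ≥ εᵢ` for all `i`. By the duality of `ℓ_p` and `ℓ_q`, the
Szlenk index is therefore `ξ`-`q`-summable if and only if `α_{ξ,p}` is finite.
-/

noncomputable section

namespace Szlenk

open scoped NNReal

/-! ### Iterated filters -/

section Iterate

variable {X Y : Type*}

/-- The filter of the sets that contain `(z₁, …, zₙ)` for almost all `z₁`, almost all `z₂`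
(depending on `z₁`), and so on. -/
def iterFilter (F : Filter X) : (n : ℕ) → Filter (Fin n → X)
  | 0 => pure Fin.elim0
  | n + 1 => F.bind fun z => (iterFilter F n).map (Fin.cons (α := fun _ => X) z)

theorem eventually_iterFilter_zero {F : Filter X} {p : (Fin 0 → X) → Prop} :
    (∀ᶠ w in iterFilter F 0, p w) ↔ p Fin.elim0 := by
  simp [iterFilter]

theorem eventually_iterFilter_succ {F : Filter X} {n : ℕ} {p : (Fin (n + 1) → X) → Prop} :
    (∀ᶠ w in iterFilter F (n + 1), p w) ↔
      ∀ᶠ z in F, ∀ᶠ w in iterFilter F n, p (Fin.cons (α := fun _ => X) z w) := by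
  simp [iterFilter, eventually_bind]

theorem frequently_iterFilter_zero {F : Filter X} {p : (Fin 0 → X) → Prop} :
    (∃ᶠ w in iterFilter F 0, p w) ↔ p Fin.elim0 := by
  simp only [Filter.Frequently, eventually_iterFilter_zero, not_not]

theorem frequently_iterFilter_succ {F : Filter X} {n : ℕ} {p : (Fin (n + 1) → X) → Prop} :
    (∃ᶠ w in iterFilter F (n + 1), p w) ↔
      ∃ᶠ z in F, ∃ᶠ w in iterFilter F n, p (Fin.cons (α := fun _ => X) z w) := by
  simp only [Filter.Frequently, eventually_iterFilter_succ, not_not]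

theorem eventually_iterFilter_forall {F : Filter X} {p : X → Prop} (h : ∀ᶠ z in F, p z) :
    ∀ n, ∀ᶠ w in iterFilter F n, ∀ i, p (w i)
  | 0 => eventually_iterFilter_zero.2 fun i => i.elim0
  | n + 1 => eventually_iterFilter_succ.2 <| h.mono fun z hz =>
      (eventually_iterFilter_forall h n).mono fun w hw =>
        Fin.cases (by simpa using hz) (by simpa using hw)

theorem tendsto_iterFilter {F : Filter X} {G : Filter Y} {T : X → Y} (h : Tendsto T F G) :
    ∀ n, Tendsto (fun w : Fin n → X => T ∘ w) (iterFilter F n) (iterFilter G n)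
  | 0 => by
      simpa only [iterFilter, Subsingleton.elim (T ∘ Fin.elim0) Fin.elim0] using
        tendsto_pure_pure (fun w : Fin 0 → X => T ∘ w) Fin.elim0
  | n + 1 => fun S hS => by
      refine eventually_iterFilter_succ.2 ?_
      filter_upwards [h.eventually (eventually_iterFilter_succ.1 hS)] with z hz
      filter_upwards [(tendsto_iterFilter h n).eventually hz] with w hw
      rw [← Fin.comp_cons] at hw
      exact hw

end Iterate

section Sum

variable {X Y : Type*} [AddMonoid X] [AddMonoid Y]

/-- The filter of the sets that contain `z₁ + z₂` for almost all `z₁` in `F` and almost all `z₂`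
in `G` (depending on `z₁`). -/
def addFilter (F G : Filter X) : Filter X :=
  F.bind fun z => G.map (z + ·)

theorem mem_addFilter {F G : Filter X} {S : Set X} :
    S ∈ addFilter F G ↔ ∀ᶠ x in F, ∀ᶠ y in G, x + y ∈ S :=
  Iff.rfl

theorem pure_zero_addFilter (F : Filter X) : addFilter (pure 0) F = F := by
  ext S
  simp [mem_addFilter]

theorem addFilter_pure_zero (F : Filter X) : addFilter F (pure 0) = F := by
  ext S
  simp [mem_addFilter]

theorem addFilter_assoc (F G H : Filter X) :
    addFilter (addFilter F G) H = addFilter F (addFilter G H) := by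
  ext S
  change (∀ᶠ x in F, ∀ᶠ y in G, ∀ᶠ z in H, x + y + z ∈ S) ↔
    ∀ᶠ x in F, ∀ᶠ y in G, ∀ᶠ z in H, x + (y + z) ∈ S
  simp only [add_assoc]

theorem addFilter_mono {F F' G G' : Filter X} (h : F ≤ F') (h' : G ≤ G') :
    addFilter F G ≤ addFilter F' G' := fun _ hS =>
  ((mem_addFilter.1 hS).filter_mono h).mono fun _ hx => hx.filter_mono h'

theorem map_addFilter (T : X →+ Y) (F G : Filter X) :
    (addFilter F G).map T = addFilter (F.map T) (G.map T) := by
  ext S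
  simp only [mem_map, mem_addFilter, eventually_map, Set.mem_preimage, map_add]

/-- The filter of the sums `z₁ + ⋯ + zₙ` with `(z₁, …, zₙ)` along `iterFilter F n`. -/
def sumFilter (F : Filter X) : ℕ → Filter X
  | 0 => pure 0
  | n + 1 => addFilter F (sumFilter F n)

theorem sumFilter_mono {F G : Filter X} (h : F ≤ G) : ∀ n, sumFilter F n ≤ sumFilter G n
  | 0 => le_rfl
  | n + 1 => addFilter_mono h (sumFilter_mono h n)

theorem map_sumFilter (T : X →+ Y) (F : Filter X) :
    ∀ n, (sumFilter F n).map T = sumFilter (F.map T) n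
  | 0 => by simp [sumFilter]
  | n + 1 => by rw [sumFilter, map_addFilter, map_sumFilter T F n, sumFilter]

theorem sumFilter_add (F : Filter X) (m n : ℕ) :
    sumFilter F (m + n) = addFilter (sumFilter F m) (sumFilter F n) := by
  induction m with
  | zero => rw [zero_add, sumFilter, pure_zero_addFilter]
  | succ m ih => rw [Nat.succ_add, sumFilter, ih, ← addFilter_assoc, sumFilter]

theorem sumFilter_sumFilter (F : Filter X) (n : ℕ) :
    ∀ k, sumFilter (sumFilter F n) k = sumFilter F (n * k)
  | 0 => rfl
  | k + 1 => by
      rw [sumFilter, sumFilter_sumFilter F n k, Nat.mul_succ, Nat.add_comm, sumFilter_add]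

end Sum

theorem eventually_sumFilter {X : Type*} [AddCommMonoid X] {F : Filter X} :
    ∀ {n : ℕ} {p : X → Prop},
      (∀ᶠ z in sumFilter F n, p z) ↔ ∀ᶠ w in iterFilter F n, p (∑ i, w i)
  | 0, p => by simp [sumFilter, eventually_iterFilter_zero]
  | n + 1, p => by
      change (∀ᶠ z in F, ∀ᶠ y in sumFilter F n, p (z + y)) ↔ _
      simp only [eventually_iterFilter_succ, eventually_sumFilter, Fin.sum_univ_succ,
        Fin.cons_zero, Fin.cons_succ]

section Average

variable (𝕜 : Type*) [DivisionSemiring 𝕜] {X Y : Type*} [AddCommMonoid X] [Module 𝕜 X]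
  [AddCommMonoid Y] [Module 𝕜 Y]

/-- The filter of the averages `(z₁ + ⋯ + zₙ) / n` with `(z₁, …, zₙ)` along `iterFilter F n`. -/
def avgFilter (F : Filter X) (n : ℕ) : Filter X :=
  (sumFilter F n).map ((n : 𝕜)⁻¹ • ·)

theorem eventually_avgFilter {F : Filter X} {n : ℕ} {p : X → Prop} :
    (∀ᶠ z in avgFilter 𝕜 F n, p z) ↔ ∀ᶠ w in iterFilter F n, p ((n : 𝕜)⁻¹ • ∑ i, w i) := by
  rw [avgFilter, eventually_map, eventually_sumFilter]

theorem frequently_avgFilter {F : Filter X} {n : ℕ} {p : X → Prop} :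
    (∃ᶠ z in avgFilter 𝕜 F n, p z) ↔ ∃ᶠ w in iterFilter F n, p ((n : 𝕜)⁻¹ • ∑ i, w i) := by
  simp only [Filter.Frequently, eventually_avgFilter]

theorem avgFilter_mono {F G : Filter X} (h : F ≤ G) (n : ℕ) : avgFilter 𝕜 F n ≤ avgFilter 𝕜 G n :=
  map_mono (sumFilter_mono h n)

theorem avgFilter_one (F : Filter X) : avgFilter 𝕜 F 1 = F := by
  rw [avgFilter, sumFilter, sumFilter, addFilter_pure_zero]
  simp

theorem avgFilter_avgFilter (F : Filter X) (n k : ℕ) :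
    avgFilter 𝕜 (avgFilter 𝕜 F n) k = avgFilter 𝕜 F (n * k) := by
  have hsum : sumFilter (avgFilter 𝕜 F n) k = (sumFilter F (n * k)).map ((n : 𝕜)⁻¹ • ·) := by
    rw [← sumFilter_sumFilter]
    exact (map_sumFilter (DistribSMul.toAddMonoidHom X (n : 𝕜)⁻¹) (sumFilter F n) k).symm
  rw [avgFilter, hsum, map_map, avgFilter]
  congr 1
  funext z
  simp [smul_smul]

theorem map_avgFilter (T : X →ₗ[𝕜] Y) (F : Filter X) (n : ℕ) :
    (avgFilter 𝕜 F n).map T = avgFilter 𝕜 (F.map T) n := by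
  have hsum : (sumFilter F n).map T = sumFilter (F.map T) n := map_sumFilter T.toAddMonoidHom F n
  rw [avgFilter, avgFilter, ← hsum, map_map, map_map]
  congr 1
  funext z
  simp

end Average

section NormAverage

variable (𝕜 : Type*) [RCLike 𝕜] {E : Type*} [NormedAddCommGroup E] [NormedSpace 𝕜 E]

theorem norm_inv_smul_sum_lt {n : ℕ} (hn : n ≠ 0) {w : Fin n → E} {r : ℝ} (h : ∀ i, ‖w i‖ < r) :
    ‖(n : 𝕜)⁻¹ • ∑ i, w i‖ < r := by
  have hn' : (0 : ℝ) < n := by exact_mod_cast Nat.pos_of_ne_zero hn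
  rw [norm_smul, norm_inv, RCLike.norm_natCast, inv_mul_lt_iff₀ hn']
  calc ‖∑ i, w i‖ ≤ ∑ i, ‖w i‖ := norm_sum_le _ _
    _ < ∑ _i : Fin n, r := Finset.sum_lt_sum_of_nonempty
        ⟨⟨0, Nat.pos_of_ne_zero hn⟩, Finset.mem_univ _⟩ fun i _ => h i
    _ = n * r := by simp

theorem norm_inv_smul_sum_le {n : ℕ} (hn : n ≠ 0) {w : Fin n → E} {r : ℝ} (h : ∀ i, ‖w i‖ ≤ r) :
    ‖(n : 𝕜)⁻¹ • ∑ i, w i‖ ≤ r :=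
  le_of_forall_gt fun _ hs => norm_inv_smul_sum_lt 𝕜 hn fun i => (h i).trans_lt hs

end NormAverage

/-! ### Block filters -/

section Block

variable (𝕜 : Type*) [RCLike 𝕜] {X Y : Type*} [NormedAddCommGroup X] [NormedSpace 𝕜 X]
  [NormedAddCommGroup Y] [NormedSpace 𝕜 Y]

variable (X) in
/-- The filter of the weak neighbourhoods of `0` in the closed unit ball. -/
def nullFilter : Filter X :=
  (⨅ f : StrongDual 𝕜 X, comap f (𝓝 0)) ⊓ 𝓟 (Metric.closedBall 0 1)

theorem tendsto_nullFilter {α : Type*} {l : Filter α} {x : α → X} :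
    Tendsto x l (nullFilter 𝕜 X) ↔
      (∀ f : StrongDual 𝕜 X, Tendsto (fun u => f (x u)) l (𝓝 0)) ∧ ∀ᶠ u in l, ‖x u‖ ≤ 1 := by
  simp [nullFilter, tendsto_inf, tendsto_iInf, tendsto_comap_iff, Function.comp_def]

theorem eventually_norm_le_nullFilter : ∀ᶠ z in nullFilter 𝕜 X, ‖z‖ ≤ 1 :=
  ((tendsto_nullFilter 𝕜).1 tendsto_id).2

theorem tendsto_apply_nullFilter (f : StrongDual 𝕜 X) : Tendsto f (nullFilter 𝕜 X) (𝓝 0) :=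
  ((tendsto_nullFilter 𝕜).1 tendsto_id).1 f

theorem eventually_norm_apply_lt_nullFilter (f : StrongDual 𝕜 X) {ε : ℝ} (hε : 0 < ε) :
    ∀ᶠ z in nullFilter 𝕜 X, ‖f z‖ < ε := by
  simpa using Metric.tendsto_nhds.1 (tendsto_apply_nullFilter 𝕜 f) ε hε

theorem avgFilter_nullFilter_le {n : ℕ} (hn : n ≠ 0) :
    avgFilter 𝕜 (nullFilter 𝕜 X) n ≤ nullFilter 𝕜 X := by
  rw [← tendsto_id', tendsto_nullFilter]
  refine ⟨fun f => Metric.tendsto_nhds.2 fun ε hε => ?_, ?_⟩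
  · filter_upwards [(eventually_avgFilter 𝕜 (p := fun z => ‖f z‖ < ε)).2 <|
      (eventually_iterFilter_forall (eventually_norm_apply_lt_nullFilter 𝕜 f hε) n).mono
        fun w hw => by simpa using norm_inv_smul_sum_lt 𝕜 hn hw] with z hz
    simpa using hz
  · exact (eventually_avgFilter 𝕜).2 <|
      (eventually_iterFilter_forall (eventually_norm_le_nullFilter 𝕜) n).mono fun w hw =>
        norm_inv_smul_sum_le 𝕜 hn hw

variable (X)

/-- The filter that describes the convex blocks of weakly null trees of order `ω ^ ξ`: for `ξ = 0`
it is `nullFilter`, at `ξ + 1` it is the infimum over `n` of the filters of averages of `n + 1`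
terms along the filter for `ξ`, and at limit ordinals it is the infimum of the previous filters. -/
def blockFilter (ξ : Ordinal.{u}) : Filter X :=
  Ordinal.limitRecOn (motive := fun _ => Filter X) ξ (nullFilter 𝕜 X)
    (fun _ F => ⨅ n : ℕ, avgFilter 𝕜 F (n + 1))
    (fun ξ _ G => ⨅ ζ : Set.Iio ξ, G ζ ζ.2)

theorem blockFilter_zero : blockFilter 𝕜 X (0 : Ordinal.{u}) = nullFilter 𝕜 X := by
  simp [blockFilter]

theorem blockFilter_add_one (ξ : Ordinal.{u}) :
    blockFilter 𝕜 X (ξ + 1) = ⨅ n : ℕ, avgFilter 𝕜 (blockFilter 𝕜 X ξ) (n + 1) := by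
  simp [blockFilter]

theorem blockFilter_limit {ξ : Ordinal.{u}} (hξ : Order.IsSuccLimit ξ) :
    blockFilter 𝕜 X ξ = ⨅ ζ : Set.Iio ξ, blockFilter 𝕜 X ζ.1 := by
  unfold blockFilter
  rw [Ordinal.limitRecOn_limit _ _ _ _ hξ]

theorem blockFilter_anti : Antitone fun ξ : Ordinal.{u} => blockFilter 𝕜 X ξ := by
  intro η ξ
  induction ξ using Ordinal.limitRecOn with
  | zero => intro h; rw [nonpos_iff_eq_zero.1 h]
  | add_one ξ ih =>
      intro h
      rcases h.eq_or_lt with rfl | h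
      · exact le_rfl
      · calc blockFilter 𝕜 X (ξ + 1) ≤ avgFilter 𝕜 (blockFilter 𝕜 X ξ) 1 := by
              rw [blockFilter_add_one]
              exact iInf_le _ 0
          _ = blockFilter 𝕜 X ξ := avgFilter_one 𝕜 _
          _ ≤ blockFilter 𝕜 X η := ih (Order.lt_add_one_iff.1 h)
  | limit ξ hξ ih =>
      intro h
      rcases h.eq_or_lt with rfl | h
      · exact le_rfl
      · simp only [blockFilter_limit 𝕜 X hξ]
        exact iInf_le (fun ζ : Set.Iio ξ => blockFilter 𝕜 X ζ.1) ⟨η, h⟩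

theorem avgFilter_blockFilter_le (ξ : Ordinal.{u}) {k : ℕ} (hk : k ≠ 0) :
    avgFilter 𝕜 (blockFilter 𝕜 X ξ) k ≤ blockFilter 𝕜 X ξ := by
  induction ξ using Ordinal.limitRecOn with
  | zero => rw [blockFilter_zero]; exact avgFilter_nullFilter_le 𝕜 hk
  | add_one ξ ih =>
      conv_rhs => rw [blockFilter_add_one]
      refine le_iInf fun n => ?_
      calc avgFilter 𝕜 (blockFilter 𝕜 X (ξ + 1)) k
          ≤ avgFilter 𝕜 (avgFilter 𝕜 (blockFilter 𝕜 X ξ) (n + 1)) k :=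
            avgFilter_mono 𝕜 (by rw [blockFilter_add_one]; exact iInf_le _ n) k
        _ = avgFilter 𝕜 (avgFilter 𝕜 (blockFilter 𝕜 X ξ) k) (n + 1) := by
            rw [avgFilter_avgFilter, mul_comm, ← avgFilter_avgFilter]
        _ ≤ avgFilter 𝕜 (blockFilter 𝕜 X ξ) (n + 1) := avgFilter_mono 𝕜 ih _
  | limit ξ hξ ih =>
      conv_rhs => rw [blockFilter_limit 𝕜 X hξ]
      exact le_iInf fun ζ =>
        (avgFilter_mono 𝕜 (blockFilter_anti 𝕜 X (le_of_lt ζ.2)) k).trans (ih ζ.1 ζ.2)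

variable {X}

theorem mem_blockFilter_add_one {ξ : Ordinal.{u}} {S : Set X} :
    S ∈ blockFilter 𝕜 X (ξ + 1) ↔ ∃ n : ℕ, S ∈ avgFilter 𝕜 (blockFilter 𝕜 X ξ) (n + 1) := by
  have hmul : ∀ m n : ℕ, m ≠ 0 → avgFilter 𝕜 (blockFilter 𝕜 X ξ) (m * n) ≤
      avgFilter 𝕜 (blockFilter 𝕜 X ξ) n := fun m n hm => by
    rw [← avgFilter_avgFilter]
    exact avgFilter_mono 𝕜 (avgFilter_blockFilter_le 𝕜 X ξ hm) n
  rw [blockFilter_add_one]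
  refine mem_iInf_of_directed (fun m n => ⟨(m + 1) * (n + 1) - 1, ?_⟩) S
  simp only [Nat.sub_add_cancel (Nat.mul_pos m.succ_pos n.succ_pos), ge_iff_le]
  exact ⟨mul_comm (m + 1) (n + 1) ▸ hmul _ _ n.succ_ne_zero, hmul _ _ m.succ_ne_zero⟩

theorem mem_blockFilter_limit {ξ : Ordinal.{u}} (hξ : Order.IsSuccLimit ξ) {S : Set X} :
    S ∈ blockFilter 𝕜 X ξ ↔ ∃ ζ < ξ, S ∈ blockFilter 𝕜 X ζ := by
  rw [blockFilter_limit 𝕜 X hξ]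
  have : Nonempty (Set.Iio ξ) := ⟨⟨0, hξ.bot_lt⟩⟩
  rw [mem_iInf_of_directed]
  · simp
  · exact fun a b => ⟨max a b, blockFilter_anti 𝕜 X (le_max_left a.1 b.1),
      blockFilter_anti 𝕜 X (le_max_right a.1 b.1)⟩

theorem blockFilter_le_nullFilter (ξ : Ordinal.{u}) : blockFilter 𝕜 X ξ ≤ nullFilter 𝕜 X := by
  rw [← blockFilter_zero.{u}]
  exact blockFilter_anti 𝕜 X bot_le

theorem eventually_iter_blockFilter_norm_le (ξ : Ordinal.{u}) (n : ℕ) :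
    ∀ᶠ w in iterFilter (blockFilter 𝕜 X ξ) n, ∀ i, ‖w i‖ ≤ 1 :=
  eventually_iterFilter_forall
    ((eventually_norm_le_nullFilter 𝕜).filter_mono (blockFilter_le_nullFilter 𝕜 ξ)) n

theorem tendsto_blockFilter {T : X →L[𝕜] Y} (hT : ‖T‖ ≤ 1) (ξ : Ordinal.{u}) :
    Tendsto T (blockFilter 𝕜 X ξ) (blockFilter 𝕜 Y ξ) := by
  induction ξ using Ordinal.limitRecOn with
  | zero =>
      simp only [blockFilter_zero]
      refine (tendsto_nullFilter 𝕜).2 ⟨fun f => tendsto_apply_nullFilter 𝕜 (f.comp T), ?_⟩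
      exact (eventually_norm_le_nullFilter 𝕜).mono fun z hz =>
        (T.le_of_opNorm_le hT z).trans (by simpa using hz)
  | add_one ξ ih =>
      simp only [blockFilter_add_one]
      refine tendsto_iInf.2 fun n => tendsto_iInf' n ?_
      exact (map_avgFilter 𝕜 T.toLinearMap _ _).le.trans (avgFilter_mono 𝕜 ih _)
  | limit ξ hξ ih =>
      rw [blockFilter_limit 𝕜 X hξ, blockFilter_limit 𝕜 Y hξ]
      exact tendsto_iInf.2 fun ζ => tendsto_iInf' ζ (ih ζ.1 ζ.2)

end Block

/-! ### Trees -/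

section Tree

variable {α β : Type*}

/-- The nonempty continuations of the one term sequence `ζ` in `T`. -/
def subtree (T : Set (List α)) (ζ : α) : Set (List α) :=
  {s | s ≠ [] ∧ ζ :: s ∈ T}

/-- The trees of nonempty sequences are the sets that contain, with a sequence, all its nonempty
initial segments. -/
def PrefixClosed (T : Set (List α)) : Prop :=
  ∀ t ∈ T, ∀ s, s ≠ [] → s <+: t → s ∈ T

/-- The sequences in `T` together with the maximal sequences of `T` continued by those in `G`. -/
def concat (T G : Set (List α)) : Set (List α) :=
  T ∪ {t | ∃ s ∈ maxNodes T, ∃ r ∈ G, t = s ++ r}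

theorem nil_notMem_subtree {T : Set (List α)} {ζ : α} : [] ∉ subtree T ζ := fun h => h.1 rfl

theorem mem_maxNodes_subtree {T : Set (List α)} {ζ : α} {s : List α} :
    s ∈ maxNodes (subtree T ζ) ↔ s ≠ [] ∧ ζ :: s ∈ maxNodes T := by
  constructor
  · rintro ⟨⟨hs, hsT⟩, hmax⟩
    refine ⟨hs, hsT, ?_⟩
    rintro _ ht ⟨r, rfl⟩
    rw [List.cons_append, hmax (s ++ r) ⟨by simp [hs], ht⟩ (List.prefix_append _ _)]
  · rintro ⟨hs, hsT, hmax⟩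
    refine ⟨⟨hs, hsT⟩, fun t ht hst => ?_⟩
    simpa using hmax _ ht.2 (by simpa using hst)

theorem singleton_mem_maxNodes {T : Set (List α)} {ζ : α} :
    [ζ] ∈ maxNodes T ↔ [ζ] ∈ T ∧ subtree T ζ = ∅ := by
  constructor
  · rintro ⟨hζ, hmax⟩
    refine ⟨hζ, Set.eq_empty_of_forall_notMem fun s hs => hs.1 ?_⟩
    simpa using hmax _ hs.2 (by simp)
  · rintro ⟨hζ, hempty⟩
    refine ⟨hζ, ?_⟩
    rintro _ hs ⟨r, rfl⟩
    by_contra hr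
    have : r ∈ subtree T ζ := ⟨by rintro rfl; simp at hr, by simpa using hs⟩
    simp [hempty] at this

theorem singleton_mem_concat {T G : Set (List α)} (hT : [] ∉ T) (hG : [] ∉ G) {ζ : α} :
    [ζ] ∈ concat T G ↔ [ζ] ∈ T := by
  refine ⟨?_, Or.inl⟩
  rintro (h | ⟨s, hs, r, hr, h⟩)
  · exact h
  · rcases List.singleton_eq_append_iff.1 h with ⟨rfl, -⟩ | ⟨-, rfl⟩
    · exact absurd hs.1 hT
    · exact absurd hr hG

theorem subtree_concat_of_empty {T G : Set (List α)} (hT : [] ∉ T) (hG : [] ∉ G) {ζ : α}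
    (hζ : [ζ] ∈ T) (hempty : subtree T ζ = ∅) : subtree (concat T G) ζ = G := by
  have hmax := singleton_mem_maxNodes.2 ⟨hζ, hempty⟩
  ext t
  constructor
  · rintro ⟨ht, htT | ⟨_ | ⟨a, s⟩, hs, r, hr, htsr⟩⟩
    · exact absurd ⟨ht, htT⟩ (Set.eq_empty_iff_forall_notMem.1 hempty t)
    · exact absurd hs.1 hT
    · rw [List.cons_append, List.cons.injEq] at htsr
      obtain ⟨rfl, rfl⟩ := htsr
      obtain rfl : s = [] := by simpa using hmax.2 _ hs.1 (by simp)
      exact hr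
  · exact fun ht => ⟨ne_of_mem_of_not_mem ht hG, Or.inr ⟨[ζ], hmax, t, ht, rfl⟩⟩

theorem subtree_concat_of_nonempty {T G : Set (List α)} (hT : [] ∉ T) {ζ : α}
    (hne : (subtree T ζ).Nonempty) : subtree (concat T G) ζ = concat (subtree T ζ) G := by
  ext t
  constructor
  · rintro ⟨ht, htT | ⟨_ | ⟨a, s⟩, hs, r, hr, htsr⟩⟩
    · exact Or.inl ⟨ht, htT⟩
    · exact absurd hs.1 hT
    · rw [List.cons_append, List.cons.injEq] at htsr
      obtain ⟨rfl, rfl⟩ := htsr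
      refine Or.inr ⟨s, mem_maxNodes_subtree.2 ⟨?_, hs⟩, r, hr, rfl⟩
      rintro rfl
      exact hne.ne_empty (singleton_mem_maxNodes.1 hs).2
  · rintro (⟨ht, htT⟩ | ⟨s, hs, r, hr, rfl⟩)
    · exact ⟨ht, Or.inl htT⟩
    · obtain ⟨hs, hsT⟩ := mem_maxNodes_subtree.1 hs
      exact ⟨by simp [hs], Or.inr ⟨ζ :: s, hsT, r, hr, rfl⟩⟩

theorem subtree_concat_nonempty {T G : Set (List α)} (hT : [] ∉ T) (hG : [] ∉ G)
    (hG' : G.Nonempty) {ζ : α} (hζ : [ζ] ∈ T) : (subtree (concat T G) ζ).Nonempty := by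
  rcases (subtree T ζ).eq_empty_or_nonempty with hempty | hne
  · rwa [subtree_concat_of_empty hT hG hζ hempty]
  · rw [subtree_concat_of_nonempty hT hne]
    exact hne.mono Set.subset_union_left

theorem subtree_image {f : α → β} (hf : f.Injective) (T : Set (List α)) (ζ : α) :
    subtree (List.map f '' T) (f ζ) = List.map f '' subtree T ζ := by
  ext t
  constructor
  · rintro ⟨ht, _ | ⟨a, s⟩, hs, hst⟩
    · simp at hst
    · rw [List.map_cons, List.cons.injEq] at hst
      obtain ⟨haζ, rfl⟩ := hst
      obtain rfl := hf haζ
      exact ⟨s, ⟨by rintro rfl; exact ht rfl, hs⟩, rfl⟩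
  · rintro ⟨s, hs, rfl⟩
    exact ⟨by simpa using hs.1, ζ :: s, hs.2, rfl⟩

theorem exists_of_singleton_mem_image {f : α → β} {T : Set (List α)} {η : β}
    (h : [η] ∈ List.map f '' T) : ∃ ζ, [ζ] ∈ T ∧ f ζ = η := by
  obtain ⟨s, hs, h⟩ := h
  obtain ⟨ζ, rfl, hζ⟩ := List.map_eq_singleton_iff.1 h
  exact ⟨ζ, hs, hζ⟩

theorem maxNodes_image {f : α → β} (hf : f.Injective) (T : Set (List α)) :
    maxNodes (List.map f '' T) = List.map f '' maxNodes T := by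
  ext t
  constructor
  · rintro ⟨⟨s, hs, rfl⟩, hmax⟩
    exact ⟨s, ⟨hs, fun r hr hsr =>
      List.map_injective_iff.2 hf (hmax _ ⟨r, hr, rfl⟩ (hsr.map f))⟩, rfl⟩
  · rintro ⟨s, hs, rfl⟩
    refine ⟨⟨s, hs.1, rfl⟩, ?_⟩
    rintro _ ⟨r, hr, rfl⟩ hsr
    rw [hs.2 r hr ((List.prefix_map_iff_of_injective hf).1 hsr)]

theorem PrefixClosed.subtree {T : Set (List α)} (hT : PrefixClosed T) (ζ : α) :
    PrefixClosed (subtree T ζ) := fun _ ht _ hs hst =>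
  ⟨hs, hT _ ht.2 _ (by simp) (by simpa using hst)⟩

theorem PrefixClosed.image {T : Set (List α)} (hT : PrefixClosed T) (f : α → β) :
    PrefixClosed (List.map f '' T) := by
  rintro _ ⟨t, ht, rfl⟩ s hs hst
  have hs_eq : (t.take s.length).map f = s := by
    rw [List.map_take]
    exact (List.prefix_iff_eq_take.1 hst).symm
  refine ⟨t.take s.length, hT t ht _ ?_ (List.take_prefix _ _), hs_eq⟩
  intro h
  rw [h] at hs_eq
  exact hs hs_eq.symm

theorem prefix_append_cases {s t r : List α} (h : s <+: t ++ r) :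
    s <+: t ∨ ∃ r', s = t ++ r' ∧ r' <+: r := by
  rcases List.prefix_or_prefix_of_prefix h (List.prefix_append t r) with h' | ⟨r', rfl⟩
  · exact Or.inl h'
  · exact Or.inr ⟨r', rfl, (List.prefix_append_right_inj t).1 h⟩

theorem PrefixClosed.concat {T G : Set (List α)} (hT : PrefixClosed T) (hG : PrefixClosed G) :
    PrefixClosed (concat T G) := by
  rintro t (ht | ⟨t, ht, r, hr, rfl⟩) s hs hst
  · exact Or.inl (hT t ht s hs hst)
  · rcases prefix_append_cases hst with hst | ⟨r', rfl, hr'⟩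
    · exact Or.inl (hT t ht.1 s hs hst)
    · rcases eq_or_ne r' [] with rfl | hne
      · exact Or.inl (by simpa using ht.1)
      · exact Or.inr ⟨t, ht, r', hG r hr r' hne hr', rfl⟩

end Tree

/-! ### Games on trees -/

section Game

variable {α β X : Type*}

/-- In the game on `T`, the first player chooses a root `ζ` of the tree, the second player a vector
`z`, and the play goes on in the subtree above `ζ`. `Forces F T P` says that the first player can
ensure that the record of a play along a maximal branch satisfies `P` when each `z` has to be taken
from a set of `F` chosen by the first player. These sets `U` stand for `∀ᶠ z in F`, which is not
allowed around the recursive occurrence in an inductive predicate. -/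
inductive Forces (F : Filter X) : Set (List α) → (List (α × X) → Prop) → Prop
  | leaf {T : Set (List α)} {P : List (α × X) → Prop} (ζ : α) (U : Set X) (hζ : [ζ] ∈ T)
      (hT : subtree T ζ = ∅) (hU : U ∈ F) (hP : ∀ z ∈ U, P [(ζ, z)]) : Forces F T P
  | node {T : Set (List α)} {P : List (α × X) → Prop} (ζ : α) (U : Set X) (hζ : [ζ] ∈ T)
      (hT : (subtree T ζ).Nonempty) (hU : U ∈ F)
      (hP : ∀ z ∈ U, Forces F (subtree T ζ) fun l => P ((ζ, z) :: l)) : Forces F T P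

variable {F : Filter X}

theorem Forces.mono {T : Set (List α)} {P Q : List (α × X) → Prop}
    (h : Forces F T P) (hPQ : ∀ l, l.map Prod.fst ∈ maxNodes T → P l → Q l) : Forces F T Q := by
  induction h generalizing Q with
  | leaf ζ U hζ hT hU hP =>
      exact .leaf ζ U hζ hT hU fun z hz =>
        hPQ _ (by simpa using singleton_mem_maxNodes.2 ⟨hζ, hT⟩) (hP z hz)
  | node ζ U hζ hT hU _ ih =>
      exact .node ζ U hζ hT hU fun z hz => ih z hz fun l hl =>
        hPQ _ (by simpa using (mem_maxNodes_subtree.1 hl).2)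

theorem forces_congr {T : Set (List α)} {P Q : List (α × X) → Prop}
    (hPQ : ∀ l, l.map Prod.fst ∈ maxNodes T → (P l ↔ Q l)) : Forces F T P ↔ Forces F T Q :=
  ⟨fun h => h.mono fun l hl => (hPQ l hl).1, fun h => h.mono fun l hl => (hPQ l hl).2⟩

theorem not_forces_empty {P : List (α × X) → Prop} : ¬ Forces F (∅ : Set (List α)) P := by
  rintro (⟨_, _, h⟩ | ⟨_, _, h⟩) <;> exact h

theorem forces_singleton {ζ : α} {P : List (α × X) → Prop} :
    Forces F {[ζ]} P ↔ ∀ᶠ z in F, P [(ζ, z)] := by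
  have hempty : ∀ η, subtree {[ζ]} η = ∅ := fun η =>
    Set.eq_empty_of_forall_notMem fun s hs => hs.1 (List.cons_eq_cons.1 hs.2).2
  constructor
  · rintro (⟨η, _, hη, _, hU, hP⟩ | ⟨η, _, _, hT, _, _⟩)
    · obtain rfl : η = ζ := by simpa using hη
      exact mem_of_superset hU hP
    · simp [hempty] at hT
  · exact fun h => .leaf ζ _ rfl (hempty ζ) h fun z hz => hz

theorem Forces.of_concat {T G : Set (List α)} (hT : [] ∉ T) (hG : [] ∉ G) (hG' : G.Nonempty)
    {P : List (α × X) → Prop} (h : Forces F (concat T G) P) :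
    Forces F T fun l => Forces F G fun m => P (l ++ m) := by
  generalize hS : concat T G = S at h
  induction h generalizing T with
  | leaf ζ _ hζ h0 _ _ =>
      subst hS
      rw [singleton_mem_concat hT hG] at hζ
      exact absurd h0 (subtree_concat_nonempty hT hG hG' hζ).ne_empty
  | node ζ U hζ h0 hU hP ih =>
      subst hS
      rw [singleton_mem_concat hT hG] at hζ
      rcases (subtree T ζ).eq_empty_or_nonempty with hempty | hne
      · rw [subtree_concat_of_empty hT hG hζ hempty] at hP
        exact .leaf ζ U hζ hempty hU hP
      · exact .node ζ U hζ hne hU fun z hz =>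
          ih z hz nil_notMem_subtree (subtree_concat_of_nonempty hT hne).symm

theorem Forces.concat {T G : Set (List α)} (hT : [] ∉ T) (hG : [] ∉ G) (hG' : G.Nonempty)
    {P : List (α × X) → Prop} (h : Forces F T fun l => Forces F G fun m => P (l ++ m)) :
    Forces F (concat T G) P := by
  generalize hQ : (fun l => Forces F G fun m => P (l ++ m)) = Q at h
  induction h generalizing P with
  | leaf ζ U hζ h0 hU hP =>
      subst hQ
      refine .node ζ U (Or.inl hζ) (subtree_concat_nonempty hT hG hG' hζ) hU ?_
      rw [subtree_concat_of_empty hT hG hζ h0]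
      exact hP
  | node ζ U hζ h0 hU hP ih =>
      subst hQ
      refine .node ζ U (Or.inl hζ) (subtree_concat_nonempty hT hG hG' hζ) hU ?_
      rw [subtree_concat_of_nonempty hT h0]
      exact fun z hz => ih z hz nil_notMem_subtree rfl

theorem forces_concat {T G : Set (List α)} (hT : [] ∉ T) (hG : [] ∉ G) (hG' : G.Nonempty)
    {P : List (α × X) → Prop} :
    Forces F (concat T G) P ↔ Forces F T fun l => Forces F G fun m => P (l ++ m) :=
  ⟨.of_concat hT hG hG', .concat hT hG hG'⟩

theorem forces_image {f : α → β} (hf : f.Injective) {T : Set (List α)}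
    {P : List (β × X) → Prop} :
    Forces F (List.map f '' T) P ↔ Forces F T fun l => P (l.map (Prod.map f id)) := by
  constructor
  · intro h
    generalize hS : List.map f '' T = S at h
    induction h generalizing T with
    | leaf η U hη h0 hU hP =>
        subst hS
        obtain ⟨ζ, hζ, rfl⟩ := exists_of_singleton_mem_image hη
        rw [subtree_image hf, Set.image_eq_empty] at h0
        exact .leaf ζ U hζ h0 hU fun z hz => by simpa using hP z hz
    | node η U hη h0 hU hP ih =>
        subst hS
        obtain ⟨ζ, hζ, rfl⟩ := exists_of_singleton_mem_image hη
        have hsub := subtree_image hf T ζ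
        rw [hsub, Set.image_nonempty] at h0
        exact .node ζ U hζ h0 hU fun z hz => by simpa using ih z hz hsub.symm
  · intro h
    generalize hQ : (fun l : List (α × X) => P (l.map (Prod.map f id))) = Q at h
    induction h generalizing P with
    | leaf ζ U hζ h0 hU hP =>
        subst hQ
        exact .leaf (f ζ) U ⟨_, hζ, rfl⟩ (by rw [subtree_image hf, h0, Set.image_empty]) hU
          fun z hz => by simpa using hP z hz
    | node ζ U hζ h0 hU hP ih =>
        subst hQ
        refine .node (f ζ) U ⟨_, hζ, rfl⟩ (by rw [subtree_image hf]; exact h0.image _) hU ?_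
        rw [subtree_image hf]
        exact fun z hz => ih z hz (by funext l; simp)

theorem forces_union {ι : Type*} {T : ι → Set (List α)}
    (hT : ∀ i j ζ s r, ζ :: s ∈ T i → ζ :: r ∈ T j → i = j) {P : List (α × X) → Prop} :
    Forces F {t | ∃ i, t ∈ T i} P ↔ ∃ i, Forces F (T i) P := by
  have hsub : ∀ i ζ, [ζ] ∈ T i → subtree {t | ∃ i, t ∈ T i} ζ = subtree (T i) ζ := by
    intro i ζ hζ
    ext s
    constructor
    · rintro ⟨hs, j, hj⟩
      obtain rfl := hT i j ζ _ _ hζ hj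
      exact ⟨hs, hj⟩
    · exact fun h => ⟨h.1, i, h.2⟩
  constructor
  · rintro (⟨ζ, U, ⟨i, hζ⟩, h0, hU, hP⟩ | ⟨ζ, U, ⟨i, hζ⟩, h0, hU, hP⟩)
    · exact ⟨i, .leaf ζ U hζ (by rwa [hsub i ζ hζ] at h0) hU hP⟩
    · rw [hsub i ζ hζ] at h0 hP
      exact ⟨i, .node ζ U hζ h0 hU hP⟩
  · rintro ⟨i, ⟨ζ, U, hζ, h0, hU, hP⟩ | ⟨ζ, U, hζ, h0, hU, hP⟩⟩
    · exact .leaf ζ U ⟨i, hζ⟩ (by rwa [hsub i ζ hζ]) hU hP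
    · rw [← hsub i ζ hζ] at h0 hP
      exact .node ζ U ⟨i, hζ⟩ h0 hU hP

end Game

/-! ### Weakly null trees as strategies of the second player -/

section Record

variable {α X D : Type*}

/-- The list of the pairs `(ζⱼ, x_{t|j})` for a sequence `t = (ζⱼ, uⱼ)ⱼ`. -/
def record : (List (α × D) → X) → List (α × D) → List (α × X)
  | _, [] => []
  | x, (ζ, u) :: s => (ζ, x [(ζ, u)]) :: record (fun r => x ((ζ, u) :: r)) s

theorem record_congr {x y : List (α × D) → X} (h : ∀ s, s ≠ [] → x s = y s)
    (t : List (α × D)) : record x t = record y t := by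
  induction t generalizing x y with
  | nil => rfl
  | cons a s ih =>
      obtain ⟨ζ, u⟩ := a
      rw [record, record, h _ (by simp), ih fun r _ => h _ (by simp)]

end Record

theorem mem_maxNodes_decorate_iff {D : Type v} [Nonempty D] {T : Set (List Ordinal.{u})}
    {t : List (Ordinal.{u} × D)} :
    t ∈ maxNodes (decorate T D) ↔ t.map Prod.fst ∈ maxNodes T := by
  constructor
  · rintro ⟨ht, hmax⟩
    refine ⟨ht, ?_⟩
    rintro _ hs ⟨r, rfl⟩
    obtain ⟨d⟩ := ‹Nonempty D›
    have hext : t ++ r.map (fun ζ => (ζ, d)) ∈ decorate T D := by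
      simpa [decorate, Function.comp_def] using hs
    obtain rfl : r = [] := by simpa using hmax _ hext (List.prefix_append _ _)
    simp
  · rintro ⟨ht, hmax⟩
    refine ⟨ht, fun s hs hts => (hts.eq_of_length ?_).symm⟩
    simpa using (congrArg List.length (hmax _ hs (hts.map Prod.fst))).symm

section Strategy

variable {𝕜 : Type} [RCLike 𝕜] {X : Type v} [NormedAddCommGroup X] [NormedSpace 𝕜 X]

theorem exists_mem_of_weaklyNull {D : Type v} [Preorder D] [IsDirectedOrder D] [Nonempty D]
    {T : Set (List Ordinal.{u})} {x : List (Ordinal.{u} × D) → X}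
    (hx : ∀ t ∈ decorate T D, ‖x t‖ ≤ 1) (hw : WeaklyNull 𝕜 (decorate T D) x) {ζ : Ordinal.{u}}
    (hζ : [ζ] ∈ T) {U : Set X} (hU : U ∈ nullFilter 𝕜 X) : ∃ u, x [(ζ, u)] ∈ U := by
  have hmem : ∀ u : D, [(ζ, u)] ∈ decorate T D := fun _ => hζ
  have hlim : Tendsto (fun u : D => x [(ζ, u)]) atTop (nullFilter 𝕜 X) :=
    (tendsto_nullFilter 𝕜).2
      ⟨fun f => by simpa using hw [] ζ hmem f, .of_forall fun u => hx _ (hmem u)⟩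
  exact (hlim.eventually hU).exists

theorem Forces.exists_maxNodes {T : Set (List Ordinal.{u})} {P : List (Ordinal.{u} × X) → Prop}
    (h : Forces (nullFilter 𝕜 X) T P) {D : Type v} [Preorder D] [IsDirectedOrder D] [Nonempty D]
    {x : List (Ordinal.{u} × D) → X} (hx : ∀ t ∈ decorate T D, ‖x t‖ ≤ 1)
    (hw : WeaklyNull 𝕜 (decorate T D) x) :
    ∃ t : List (Ordinal.{u} × D), t.map Prod.fst ∈ maxNodes T ∧ P (record x t) := by
  induction h generalizing x with
  | leaf ζ U hζ h0 hU hP =>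
      obtain ⟨u, hu⟩ := exists_mem_of_weaklyNull hx hw hζ hU
      exact ⟨[(ζ, u)], singleton_mem_maxNodes.2 ⟨hζ, h0⟩, hP _ hu⟩
  | node ζ U hζ _ hU _ ih =>
      obtain ⟨u, hu⟩ := exists_mem_of_weaklyNull hx hw hζ hU
      obtain ⟨t, ht, hPt⟩ := ih _ hu (x := fun r => x ((ζ, u) :: r)) (fun t ht => hx _ ht.2)
        fun t η ht f => by simpa using hw ((ζ, u) :: t) η (fun v => (ht v).2) f
      exact ⟨(ζ, u) :: t, (mem_maxNodes_subtree.1 ht).2, hPt⟩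

/-- After the first move `ζ` of the first player and the answer `z`, the first player cannot force
`P` any more. -/
def Refutes {α X : Type*} (F : Filter X) (T : Set (List α)) (P : List (α × X) → Prop) (ζ : α)
    (z : X) : Prop :=
  (subtree T ζ = ∅ → ¬ P [(ζ, z)]) ∧
    ((subtree T ζ).Nonempty → ¬ Forces F (subtree T ζ) fun l => P ((ζ, z) :: l))

theorem frequently_refutes {α X : Type*} {F : Filter X} {T : Set (List α)}
    {P : List (α × X) → Prop} (h : ¬ Forces F T P) {ζ : α} (hζ : [ζ] ∈ T) :
    ∃ᶠ z in F, Refutes F T P ζ z := by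
  intro hU
  rcases (subtree T ζ).eq_empty_or_nonempty with h0 | h0
  · exact h <| .leaf ζ _ hζ h0 hU fun z hz => by_contra fun hP =>
      hz ⟨fun _ => hP, fun hne => absurd h0 hne.ne_empty⟩
  · exact h <| .node ζ _ hζ h0 hU fun z hz => by_contra fun hP =>
      hz ⟨fun hempty => absurd hempty h0.ne_empty, fun _ => hP⟩

variable (𝕜 X) in
/-- The sets in `nullFilter 𝕜 X`, directed by reverse inclusion. -/
abbrev NullSets : Type v := ({U : Set X // U ∈ nullFilter 𝕜 X})ᵒᵈ

instance : IsDirectedOrder (NullSets 𝕜 X) :=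
  ⟨fun U V => ⟨OrderDual.toDual ⟨_, inter_mem (OrderDual.ofDual U).2 (OrderDual.ofDual V).2⟩,
    Set.inter_subset_left, Set.inter_subset_right⟩⟩

instance : Nonempty (NullSets 𝕜 X) := ⟨OrderDual.toDual ⟨Set.univ, univ_mem⟩⟩

variable {α : Type*}

open Classical in
/-- An answer in `U` to the move `ζ` of the first player that refutes `P` (and `0` if there is
none). -/
def answer (T : Set (List α)) (P : List (α × X) → Prop) (ζ : α) (U : NullSets 𝕜 X) : X :=
  if h : ∃ z ∈ (OrderDual.ofDual U).1, ‖z‖ ≤ 1 ∧ Refutes (nullFilter 𝕜 X) T P ζ z then h.choose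
  else 0

/-- The tree of the answers of the second player. -/
def strategy : Set (List α) → (List (α × X) → Prop) → List (α × NullSets 𝕜 X) → X
  | _, _, [] => 0
  | T, P, [(ζ, U)] => answer T P ζ U
  | T, P, (ζ, U) :: a :: s =>
      strategy (subtree T ζ) (fun l => P ((ζ, answer T P ζ U) :: l)) (a :: s)

theorem norm_answer_le (T : Set (List α)) (P : List (α × X) → Prop) (ζ : α)
    (U : NullSets 𝕜 X) : ‖answer T P ζ U‖ ≤ 1 := by
  unfold answer
  split_ifs with h
  · exact h.choose_spec.2.1
  · simp

theorem refutes_answer {T : Set (List α)} {P : List (α × X) → Prop}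
    (h : ¬ Forces (nullFilter 𝕜 X) T P) {ζ : α} (hζ : [ζ] ∈ T) (U : NullSets 𝕜 X) :
    Refutes (nullFilter 𝕜 X) T P ζ (answer T P ζ U) := by
  have hex : ∃ z ∈ (OrderDual.ofDual U).1, ‖z‖ ≤ 1 ∧ Refutes (nullFilter 𝕜 X) T P ζ z := by
    have hU := inter_mem (OrderDual.ofDual U).2 (eventually_norm_le_nullFilter 𝕜 (X := X))
    obtain ⟨z, hz, hzU⟩ := ((frequently_refutes h hζ).and_eventually hU).exists
    exact ⟨z, hzU.1, hzU.2, hz⟩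
  unfold answer
  rw [dif_pos hex]
  exact hex.choose_spec.2.2

theorem tendsto_answer (T : Set (List α)) (P : List (α × X) → Prop) (ζ : α)
    (f : StrongDual 𝕜 X) :
    Tendsto (fun U : NullSets 𝕜 X => f (answer T P ζ U)) atTop (𝓝 0) := by
  intro S hS
  refine mem_map.2 (mem_atTop_sets.2
    ⟨OrderDual.toDual ⟨f ⁻¹' S, tendsto_apply_nullFilter 𝕜 f hS⟩, fun U hU => ?_⟩)
  change f (answer T P ζ U) ∈ S
  unfold answer
  split_ifs with h
  · exact hU h.choose_spec.1
  · simpa using mem_of_mem_nhds hS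

theorem norm_strategy_le (T : Set (List α)) (P : List (α × X) → Prop)
    (t : List (α × NullSets 𝕜 X)) : ‖strategy T P t‖ ≤ 1 := by
  fun_induction strategy T P t with
  | case1 => simp
  | case2 T P ζ U => exact norm_answer_le T P ζ U
  | case3 _ _ _ _ _ _ ih => exact ih

theorem tendsto_strategy (T : Set (List α)) (P : List (α × X) → Prop)
    (t : List (α × NullSets 𝕜 X)) (ζ : α) (f : StrongDual 𝕜 X) :
    Tendsto (fun U : NullSets 𝕜 X => f (strategy T P (t ++ [(ζ, U)]))) atTop (𝓝 0) := by
  induction t generalizing T P with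
  | nil => simpa [strategy] using tendsto_answer T P ζ f
  | cons a t ih =>
      obtain ⟨η, V⟩ := a
      refine (ih (subtree T η) fun l => P ((η, answer T P η V) :: l)).congr fun U => ?_
      cases t <;> simp [strategy]

theorem not_record_strategy {T : Set (List α)} (hT : PrefixClosed T) (hT' : [] ∉ T)
    {P : List (α × X) → Prop} (h : ¬ Forces (nullFilter 𝕜 X) T P)
    {t : List (α × NullSets 𝕜 X)} (ht : t.map Prod.fst ∈ maxNodes T) :
    ¬ P (record (strategy T P) t) := by
  induction t generalizing T P with
  | nil => exact absurd ht.1 hT'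
  | cons a t ih =>
      obtain ⟨ζ, U⟩ := a
      have hζ : [ζ] ∈ T := hT _ ht.1 [ζ] (by simp) (by simp)
      obtain ⟨hleaf, hnode⟩ := refutes_answer h hζ U
      rcases eq_or_ne t [] with rfl | hne
      · exact hleaf (singleton_mem_maxNodes.1 ht).2
      · have hmax : t.map Prod.fst ∈ maxNodes (subtree T ζ) :=
          mem_maxNodes_subtree.2 ⟨by simpa using hne, ht⟩
        have hrest := ih (hT.subtree ζ) nil_notMem_subtree (hnode ⟨_, hmax.1⟩) hmax
        have hcons : record (strategy T P) ((ζ, U) :: t) = (ζ, answer T P ζ U) ::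
            record (strategy (subtree T ζ) fun l => P ((ζ, answer T P ζ U) :: l)) t := by
          rw [record]
          refine congrArg _ (record_congr (fun s hs => ?_) t)
          obtain ⟨b, s, rfl⟩ := List.exists_cons_of_ne_nil hs
          rfl
        rwa [hcons]

theorem exists_weaklyNull_of_not_forces {T : Set (List Ordinal.{u})} (hT : PrefixClosed T)
    (hT' : [] ∉ T) {P : List (Ordinal.{u} × X) → Prop} (h : ¬ Forces (nullFilter 𝕜 X) T P) :
    ∃ x : List (Ordinal.{u} × NullSets 𝕜 X) → X, (∀ t, ‖x t‖ ≤ 1) ∧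
      WeaklyNull 𝕜 (decorate T (NullSets 𝕜 X)) x ∧
      ∀ t, t.map Prod.fst ∈ maxNodes T → ¬ P (record x t) :=
  ⟨strategy T P, norm_strategy_le T P, fun t ζ _ f => tendsto_strategy T P t ζ f,
    fun _ ht => not_record_strategy hT hT' h ht⟩

end Strategy

/-! ### Weighted sums along branches -/

section WeightedSum

variable (𝕜 : Type*) [RCLike 𝕜] {α β X : Type*} [NormedAddCommGroup X] [NormedSpace 𝕜 X]

/-- The sum of the `w(ζ₁, …, ζⱼ) zⱼ` for a list of pairs `(ζⱼ, zⱼ)`. -/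
def weightedSum : (List α → ℝ) → List (α × X) → X
  | _, [] => 0
  | w, (ζ, z) :: l => ((w [ζ] : ℝ) : 𝕜) • z + weightedSum (fun s => w (ζ :: s)) l

variable {𝕜}

theorem weightedSum_append (w : List α → ℝ) (l m : List (α × X)) :
    weightedSum 𝕜 w (l ++ m) =
      weightedSum 𝕜 w l + weightedSum 𝕜 (fun s => w (l.map Prod.fst ++ s)) m := by
  induction l generalizing w with
  | nil => simp [weightedSum]
  | cons a l ih => simp [weightedSum, ih, add_assoc]

theorem weightedSum_congr {w w' : List α → ℝ} {l : List (α × X)}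
    (h : ∀ s, s ≠ [] → s <+: l.map Prod.fst → w s = w' s) :
    weightedSum 𝕜 w l = weightedSum 𝕜 w' l := by
  induction l generalizing w w' with
  | nil => rfl
  | cons a l ih =>
      obtain ⟨ζ, z⟩ := a
      rw [weightedSum, weightedSum, h [ζ] (by simp) (by simp),
        ih fun s _ hsl => h (ζ :: s) (by simp) (by simpa using hsl)]

theorem zero_weightedSum (l : List (α × X)) : weightedSum 𝕜 (fun _ => 0) l = 0 := by
  induction l with
  | nil => rfl
  | cons a l ih => simp [weightedSum, ih]

theorem weightedSum_map (f : α → β) (w : List β → ℝ) (l : List (α × X)) :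
    weightedSum 𝕜 w (l.map (Prod.map f id)) = weightedSum 𝕜 (fun s => w (s.map f)) l := by
  induction l generalizing w with
  | nil => rfl
  | cons a l ih => simp [weightedSum, ih]

theorem mul_weightedSum (c : ℝ) (w : List α → ℝ) (l : List (α × X)) :
    weightedSum 𝕜 (fun s => c * w s) l = (c : 𝕜) • weightedSum 𝕜 w l := by
  induction l generalizing w with
  | nil => simp [weightedSum]
  | cons a l ih => simp [weightedSum, ih, mul_smul]

theorem sum_weightedSum {ι : Type*} [Fintype ι] (w : ι → List α → ℝ) (l : List (α × X)) :
    weightedSum 𝕜 (fun s => ∑ i, w i s) l = ∑ i, weightedSum 𝕜 (w i) l := by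
  induction l generalizing w with
  | nil => simp [weightedSum]
  | cons a l ih => simp [weightedSum, ih, Finset.sum_add_distrib, Finset.sum_smul]

theorem weightedSum_record {D : Type*} (w : List α → ℝ) (x : List (α × D) → X)
    (t : List (α × D)) :
    weightedSum 𝕜 w (record x t) = ∑ k ∈ Finset.range t.length,
      ((w ((t.take (k + 1)).map Prod.fst) : ℝ) : 𝕜) • x (t.take (k + 1)) := by
  induction t generalizing w x with
  | nil => simp [weightedSum, record]
  | cons a t ih =>
      rw [record, weightedSum, ih, List.length_cons, Finset.sum_range_succ', add_comm]
      simp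

end WeightedSum

/-! ### The trees `Γ_{ξ,n}` as games -/

section Gamma

theorem le_of_mem_shift {a b : Ordinal.{u}} {t : List Ordinal.{u}} (h : a ∈ shift b t) :
    b ≤ a := by
  obtain ⟨c, -, rfl⟩ := List.mem_map.1 h
  exact le_self_add

theorem Gamma_zero (ξ : Ordinal.{u}) : Gamma ξ 0 = ∅ := by
  simp [Gamma, Lambda, level]

theorem Gamma_add_one (ξ : Ordinal.{u}) (n : ℕ) :
    Gamma ξ (n + 1) = concat (shift (ω ^ ξ * n) '' Gamma₁ ξ) (Gamma ξ n) := by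
  have hmax : maxNodes (shift (ω ^ ξ * n) '' Gamma₁ ξ) =
      shift (ω ^ ξ * n) '' maxNodes (Gamma₁ ξ) := maxNodes_image (add_right_injective _) _
  ext t
  constructor
  · rintro ⟨_ | i, h⟩
    · exact Or.inl h
    · obtain ⟨s, hs, r, hr, rfl⟩ := h
      exact Or.inr ⟨_, hmax ▸ ⟨s, hs, rfl⟩, r, ⟨i, hr⟩, rfl⟩
  · rintro (h | ⟨s, hs, r, ⟨i, hr⟩, rfl⟩)
    · exact ⟨0, h⟩
    · rw [hmax] at hs
      obtain ⟨s, hs, rfl⟩ := hs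
      exact ⟨i + 1, s, hs, r, hr, rfl⟩

theorem ne_nil_lt_of_Lambda {ξ : Ordinal.{u}} {n i : ℕ} {t : List Ordinal.{u}}
    (ht : t ∈ Lambda ξ n i) :
    t ≠ [] ∧ (∀ a ∈ t, a < ω ^ ξ * n) ∧ ω ^ ξ * (n - 1 : ℕ) ≤ t.headD 0 :=
  ne_nil_lt_of_level (ne_nil_lt_of_Gamma₁ ξ) n i t ht

theorem ne_nil_lt_of_Gamma {ξ : Ordinal.{u}} {n : ℕ} {t : List Ordinal.{u}} (ht : t ∈ Gamma ξ n) :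
    t ≠ [] ∧ (∀ a ∈ t, a < ω ^ ξ * n) ∧ ω ^ ξ * (n - 1 : ℕ) ≤ t.headD 0 :=
  ht.elim fun _ => ne_nil_lt_of_Lambda

theorem nil_notMem_Gamma (ξ : Ordinal.{u}) (n : ℕ) : [] ∉ Gamma ξ n := fun h =>
  (ne_nil_lt_of_Gamma h).1 rfl

theorem prefixClosed_Gamma_of_Gamma₁ {ξ : Ordinal.{u}} (h : PrefixClosed (Gamma₁ ξ)) :
    ∀ n, PrefixClosed (Gamma ξ n)
  | 0 => by rw [Gamma_zero]; exact fun t ht => ht.elim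
  | n + 1 => by
      rw [Gamma_add_one]
      exact (h.image _).concat (prefixClosed_Gamma_of_Gamma₁ h n)

theorem prefixClosed_Gamma₁ (ξ : Ordinal.{u}) : PrefixClosed (Gamma₁ ξ) := by
  induction ξ using Ordinal.limitRecOn with
  | zero =>
      rw [Gamma₁_zero]
      rintro t rfl s hs hst
      simpa [List.prefix_cons_iff, hs] using hst
  | add_one ξ ih =>
      rw [Gamma₁_add_one]
      rintro t ⟨n, hn⟩ s hs hst
      exact ⟨n, prefixClosed_Gamma_of_Gamma₁ ih n t hn s hs hst⟩
  | limit ξ hξ ih =>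
      rw [Gamma₁_limit hξ]
      rintro t ⟨ζ, hζ, ht⟩ s hs hst
      exact ⟨ζ, hζ, (ih _ (hξ.add_one_lt hζ)).image _ t ht s hs hst⟩

theorem prefixClosed_Gamma (ξ : Ordinal.{u}) (n : ℕ) : PrefixClosed (Gamma ξ n) :=
  prefixClosed_Gamma_of_Gamma₁ (prefixClosed_Gamma₁ ξ) n

theorem Gamma_add_one_nonempty {ξ : Ordinal.{u}} (h : (Gamma₁ ξ).Nonempty) (n : ℕ) :
    (Gamma ξ (n + 1)).Nonempty := by
  rw [Gamma_add_one]
  exact (h.image _).mono Set.subset_union_left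

theorem Gamma₁_nonempty (ξ : Ordinal.{u}) : (Gamma₁ ξ).Nonempty := by
  induction ξ using Ordinal.limitRecOn with
  | zero => rw [Gamma₁_zero]; exact Set.singleton_nonempty _
  | add_one ξ ih =>
      rw [Gamma₁_add_one]
      exact (Gamma_add_one_nonempty ih 0).mono fun t ht => ⟨1, ht⟩
  | limit ξ hξ ih =>
      rw [Gamma₁_limit hξ]
      obtain ⟨s, hs⟩ := ih _ (hξ.add_one_lt hξ.bot_lt)
      exact ⟨_, 0, hξ.bot_lt, s, hs, rfl⟩

theorem filter_shift_append {b : Ordinal.{u}} {s r : List Ordinal.{u}} (hr : ∀ a ∈ r, a < b) :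
    (shift b s ++ r).filter (· < b) = r := by
  rw [List.filter_append, List.filter_eq_nil_iff.2, List.filter_eq_self.2]
  · simp
  · simpa using hr
  · exact fun a ha => by simpa using le_of_mem_shift ha

theorem shift_append_mem_Lambda_succ {ξ : Ordinal.{u}} {n i : ℕ} {s r : List Ordinal.{u}}
    (hs : s ∈ maxNodes (Gamma₁ ξ)) (hr : ∀ a ∈ r, a < ω ^ ξ * n) :
    shift (ω ^ ξ * n) s ++ r ∈ Lambda ξ (n + 1) (i + 1) ↔ r ∈ Lambda ξ n i := by
  refine ⟨?_, fun h => ⟨s, hs, r, h, rfl⟩⟩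
  rintro ⟨s', -, r', hr', h⟩
  have hfilter := congrArg (List.filter (· < ω ^ ξ * (n : Ordinal.{u}))) h
  rw [filter_shift_append hr, filter_shift_append (ne_nil_lt_of_Lambda hr').2.1] at hfilter
  rwa [hfilter]

theorem shift_append_notMem_Lambda_zero {ξ : Ordinal.{u}} {n : ℕ} {s r : List Ordinal.{u}}
    (hr0 : r ≠ []) (hr : ∀ a ∈ r, a < ω ^ ξ * n) :
    shift (ω ^ ξ * n) s ++ r ∉ Lambda ξ (n + 1) 0 := by
  rintro ⟨t, -, h⟩
  obtain ⟨a, ha⟩ := List.exists_mem_of_ne_nil r hr0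
  have hat : a ∈ shift (ω ^ ξ * n) t := by rw [h]; simp [ha]
  exact (hr _ ha).not_ge (le_of_mem_shift hat)

theorem shift_notMem_Lambda_succ {ξ : Ordinal.{u}} {n i : ℕ} {s : List Ordinal.{u}} :
    shift (ω ^ ξ * n) s ∉ Lambda ξ (n + 1) (i + 1) := by
  rintro ⟨t, -, r, hr, h⟩
  obtain ⟨hr0, hr, -⟩ := ne_nil_lt_of_Lambda hr
  obtain ⟨a, ha⟩ := List.exists_mem_of_ne_nil r hr0
  have has : a ∈ shift (ω ^ ξ * n) s := by rw [h]; simp [ha]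
  exact (hr _ ha).not_ge (le_of_mem_shift has)

theorem existsUnique_mem_Lambda {ξ : Ordinal.{u}} :
    ∀ {n : ℕ} {t : List Ordinal.{u}}, t ∈ Gamma ξ n → ∃! i : Fin n, t ∈ Lambda ξ n i
  | 0, t, h => by simp [Gamma_zero] at h
  | n + 1, t, ⟨0, h⟩ => by
      refine ⟨0, h, fun j => Fin.cases (fun _ => rfl) (fun j hj => ?_) j⟩
      obtain ⟨s, -, rfl⟩ := h
      exact absurd hj shift_notMem_Lambda_succ
  | n + 1, t, ⟨i + 1, h⟩ => by
      obtain ⟨s, hs, r, hr, rfl⟩ := h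
      obtain ⟨hr0, hr_lt, -⟩ := ne_nil_lt_of_Lambda hr
      obtain ⟨j, hj, huniq⟩ := existsUnique_mem_Lambda ⟨i, hr⟩
      refine ⟨j.succ, ⟨s, hs, r, hj, rfl⟩, fun k => Fin.cases (fun hk => ?_) (fun k hk => ?_) k⟩
      · exact absurd hk (shift_append_notMem_Lambda_zero hr0 hr_lt)
      · rw [huniq k ((shift_append_mem_Lambda_succ hs hr_lt).1 hk)]

theorem index_unique_of_cons_mem_Gamma {ξ : Ordinal.{u}} (m n : ℕ) (ζ : Ordinal.{u})
    (s r : List Ordinal.{u}) (hm : ζ :: s ∈ Gamma ξ m) (hn : ζ :: r ∈ Gamma ξ n) : m = n := by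
  have hle : ∀ {m n s r}, ζ :: s ∈ Gamma ξ m → ζ :: r ∈ Gamma ξ n → m ≤ n := by
    intro m n s r hm hn
    have hge : ω ^ ξ * (m - 1 : ℕ) ≤ ζ := by simpa using (ne_nil_lt_of_Gamma hm).2.2
    have hlt := (ne_nil_lt_of_Gamma hn).2.1 ζ (by simp)
    have : m - 1 < n := by
      exact_mod_cast (mul_lt_mul_iff_right₀ (Ordinal.opow_pos _ Ordinal.omega0_pos)).1
        (hge.trans_lt hlt)
    omega
  exact le_antisymm (hle hm hn) (hle hn hm)

theorem log_eq_of_cons_mem_shift_Gamma₁ {ζ η : Ordinal.{u}} {s : List Ordinal.{u}}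
    (h : η :: s ∈ shift (ω ^ ζ) '' Gamma₁ (ζ + 1)) : Ordinal.log ω η = ζ := by
  obtain ⟨_ | ⟨c, t⟩, ht, h⟩ := h
  · simp [shift] at h
  · have hc := (ne_nil_lt_of_Gamma₁ _ _ ht).2 c (by simp)
    obtain ⟨rfl, -⟩ : ω ^ ζ + c = η ∧ _ := by simpa [shift] using h
    have hpos : 0 < ω ^ ζ + c := (Ordinal.opow_pos _ Ordinal.omega0_pos).trans_le le_self_add
    refine (Ordinal.log_eq_iff Ordinal.one_lt_omega0 hpos.ne' _).2 ⟨le_self_add, ?_⟩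
    exact Ordinal.isPrincipal_add_omega0_opow (ζ + 1)
      ((Ordinal.opow_lt_opow_iff_right Ordinal.one_lt_omega0).2 (by simp)) hc

open Classical in
/-- The weight on the level `Λ_{ξ,n,i+1}`, extended by `0`. -/
def levelWeight (ξ : Ordinal.{u}) (n i : ℕ) (s : List Ordinal.{u}) : ℝ :=
  if s ∈ Lambda ξ n i then weight ξ s else 0

theorem sum_levelWeight {ξ : Ordinal.{u}} {n : ℕ} {s : List Ordinal.{u}} (hs : s ∈ Gamma ξ n) :
    ∑ i : Fin n, levelWeight ξ n i s = weight ξ s := by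
  obtain ⟨i, hi, huniq⟩ := existsUnique_mem_Lambda hs
  rw [Finset.sum_eq_single i]
  · exact if_pos hi
  · exact fun j _ hj => if_neg fun h => hj (huniq j h)
  · simp

theorem levelWeight_zero_shift {ξ : Ordinal.{u}} {n : ℕ} {s : List Ordinal.{u}}
    (hs : s ∈ Gamma₁ ξ) : levelWeight ξ (n + 1) 0 (shift (ω ^ ξ * n) s) = weight₁ ξ s := by
  rw [levelWeight, if_pos ⟨s, hs, rfl⟩, weight_level_zero ξ n hs]

theorem levelWeight_succ_shift_append {ξ : Ordinal.{u}} {n i : ℕ} {s r : List Ordinal.{u}}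
    (hs : s ∈ maxNodes (Gamma₁ ξ)) (hr : r ∈ Gamma ξ n) :
    levelWeight ξ (n + 1) (i + 1) (shift (ω ^ ξ * n) s ++ r) = levelWeight ξ n i r := by
  classical
  simp only [levelWeight, shift_append_mem_Lambda_succ hs (ne_nil_lt_of_Gamma hr).2.1,
    weight_level_succ ξ n s hr]

section WeightedSum

variable {𝕜 : Type*} [RCLike 𝕜] {X : Type*} [NormedAddCommGroup X] [NormedSpace 𝕜 X]

theorem weightedSum_levelWeight_append {ξ : Ordinal.{u}} {n : ℕ} {l m : List (Ordinal.{u} × X)}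
    (hl : l.map Prod.fst ∈ maxNodes (Gamma₁ ξ)) (hm : m.map Prod.fst ∈ Gamma ξ n) :
    (fun i : Fin (n + 1) => weightedSum 𝕜 (levelWeight ξ (n + 1) i)
      (l.map (Prod.map (ω ^ ξ * n + ·) id) ++ m)) =
    Fin.cons (α := fun _ => X) (weightedSum 𝕜 (weight₁ ξ) l)
      (fun i => weightedSum 𝕜 (levelWeight ξ n i) m) := by
  have hfst : (l.map (Prod.map (ω ^ ξ * (n : Ordinal.{u}) + ·) id)).map Prod.fst =
      shift (ω ^ ξ * n) (l.map Prod.fst) := by simp [shift, Function.comp_def]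
  have hm_lt := (ne_nil_lt_of_Gamma hm).2.1
  funext i
  rw [weightedSum_append, weightedSum_map, hfst]
  refine Fin.cases ?_ (fun i => ?_) i
  · have hleft : weightedSum 𝕜 (fun s => levelWeight ξ (n + 1) 0 (shift (ω ^ ξ * n) s)) l =
        weightedSum 𝕜 (weight₁ ξ) l := weightedSum_congr fun s hs hsl =>
      levelWeight_zero_shift (prefixClosed_Gamma₁ ξ _ hl.1 s hs hsl)
    have hright : weightedSum 𝕜
        (fun s => levelWeight ξ (n + 1) 0 (shift (ω ^ ξ * n) (l.map Prod.fst) ++ s)) m = 0 :=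
      (weightedSum_congr fun s hs hsm => if_neg <| shift_append_notMem_Lambda_zero hs fun a ha =>
        hm_lt a (hsm.subset ha)).trans (zero_weightedSum m)
    exact (congrArg₂ (· + ·) hleft hright).trans (add_zero _)
  · have hleft : weightedSum 𝕜
        (fun s => levelWeight ξ (n + 1) (i + 1) (shift (ω ^ ξ * n) s)) l = 0 :=
      (weightedSum_congr fun s _ _ => if_neg shift_notMem_Lambda_succ).trans (zero_weightedSum l)
    have hright : weightedSum 𝕜
        (fun s => levelWeight ξ (n + 1) (i + 1) (shift (ω ^ ξ * n) (l.map Prod.fst) ++ s)) m =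
        weightedSum 𝕜 (levelWeight ξ n i) m := weightedSum_congr fun s hs hsm =>
      levelWeight_succ_shift_append hl (prefixClosed_Gamma ξ n _ hm s hs hsm)
    exact (congrArg₂ (· + ·) hleft hright).trans (zero_add _)

theorem weightedSum_levelWeight_one {ξ : Ordinal.{u}} {l : List (Ordinal.{u} × X)}
    (hl : l.map Prod.fst ∈ Gamma₁ ξ) :
    weightedSum 𝕜 (levelWeight ξ 1 0) l = weightedSum 𝕜 (weight₁ ξ) l :=
  weightedSum_congr fun s hs hsl => by
    simpa [shift] using levelWeight_zero_shift (n := 0) (prefixClosed_Gamma₁ ξ _ hl s hs hsl)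

theorem weightedSum_weight₁_add_one {ξ : Ordinal.{u}} {n : ℕ} {l : List (Ordinal.{u} × X)}
    (hl : l.map Prod.fst ∈ Gamma ξ n) :
    weightedSum 𝕜 (weight₁ (ξ + 1)) l =
      (n : 𝕜)⁻¹ • ∑ i : Fin n, weightedSum 𝕜 (levelWeight ξ n i) l := by
  calc weightedSum 𝕜 (weight₁ (ξ + 1)) l
      = weightedSum 𝕜 (fun s => (n : ℝ)⁻¹ * ∑ i : Fin n, levelWeight ξ n i s) l :=
        weightedSum_congr fun s hs hsl => by
          have hs' := prefixClosed_Gamma ξ n _ hl s hs hsl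
          rw [sum_levelWeight hs', weight_add_one ξ n hs', div_eq_inv_mul]
    _ = (n : 𝕜)⁻¹ • ∑ i : Fin n, weightedSum 𝕜 (levelWeight ξ n i) l := by
        rw [mul_weightedSum, sum_weightedSum, RCLike.ofReal_inv, RCLike.ofReal_natCast]

end WeightedSum

variable {𝕜 : Type*} [RCLike 𝕜] {X : Type*} [NormedAddCommGroup X] [NormedSpace 𝕜 X]

theorem forces_Gamma_of_Gamma₁ {ξ : Ordinal.{u}}
    (h : ∀ P : X → Prop, Forces (nullFilter 𝕜 X) (Gamma₁ ξ)
      (fun l => P (weightedSum 𝕜 (weight₁ ξ) l)) ↔ ∀ᶠ z in blockFilter 𝕜 X ξ, P z) :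
    ∀ (n : ℕ) (P : (Fin (n + 1) → X) → Prop), Forces (nullFilter 𝕜 X) (Gamma ξ (n + 1))
      (fun l => P fun i => weightedSum 𝕜 (levelWeight ξ (n + 1) i) l) ↔
        ∀ᶠ w in iterFilter (blockFilter 𝕜 X ξ) (n + 1), P w
  | 0, P => by
      rw [Gamma_one, eventually_iterFilter_succ]
      simp only [eventually_iterFilter_zero]
      rw [← h]
      refine forces_congr fun l hl => iff_of_eq (congrArg P (funext fun i => ?_))
      rw [Fin.fin_one_eq_zero i]
      exact weightedSum_levelWeight_one hl.1
  | n + 1, P => by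
      have hnil : [] ∉ shift (ω ^ ξ * (n + 1 : ℕ)) '' Gamma₁ ξ := by
        rintro ⟨s, hs, h⟩
        exact (ne_nil_lt_of_Gamma₁ ξ s hs).1 (by simpa [shift] using h)
      rw [Gamma_add_one ξ (n + 1), forces_concat hnil (nil_notMem_Gamma ξ _)
        (Gamma_add_one_nonempty (Gamma₁_nonempty ξ) n)]
      refine (forces_image (add_right_injective (ω ^ ξ * (n + 1 : ℕ)))).trans ?_
      rw [eventually_iterFilter_succ, ← h]
      refine forces_congr fun l hl => ?_
      rw [← forces_Gamma_of_Gamma₁ h n]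
      exact forces_congr fun m hm =>
        iff_of_eq (congrArg P (weightedSum_levelWeight_append hl hm.1))

theorem forces_Gamma₁_add_one {ξ : Ordinal.{u}}
    (h : ∀ P : X → Prop, Forces (nullFilter 𝕜 X) (Gamma₁ ξ)
      (fun l => P (weightedSum 𝕜 (weight₁ ξ) l)) ↔ ∀ᶠ z in blockFilter 𝕜 X ξ, P z)
    (P : X → Prop) :
    Forces (nullFilter 𝕜 X) (Gamma₁ (ξ + 1))
      (fun l => P (weightedSum 𝕜 (weight₁ (ξ + 1)) l)) ↔
        ∀ᶠ z in blockFilter 𝕜 X (ξ + 1), P z := by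
  have hn : ∀ n : ℕ, Forces (nullFilter 𝕜 X) (Gamma ξ (n + 1))
      (fun l => P (weightedSum 𝕜 (weight₁ (ξ + 1)) l)) ↔
      ∀ᶠ z in avgFilter 𝕜 (blockFilter 𝕜 X ξ) (n + 1), P z := fun n => by
    rw [eventually_avgFilter, ← forces_Gamma_of_Gamma₁ h n]
    exact forces_congr fun l hl => iff_of_eq (congrArg P (weightedSum_weight₁_add_one hl.1))
  rw [Gamma₁_add_one, forces_union index_unique_of_cons_mem_Gamma]
  refine Iff.trans ⟨?_, ?_⟩ (mem_blockFilter_add_one 𝕜).symm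
  · rintro ⟨_ | n, hP⟩
    · rw [Gamma_zero] at hP
      exact absurd hP not_forces_empty
    · exact ⟨n, (hn n).1 hP⟩
  · exact fun ⟨n, hP⟩ => ⟨n + 1, (hn n).2 hP⟩

theorem forces_Gamma₁_limit {ξ : Ordinal.{u}} (hξ : Order.IsSuccLimit ξ)
    (h : ∀ ζ < ξ, ∀ P : X → Prop, Forces (nullFilter 𝕜 X) (Gamma₁ ζ)
      (fun l => P (weightedSum 𝕜 (weight₁ ζ) l)) ↔ ∀ᶠ z in blockFilter 𝕜 X ζ, P z)
    (P : X → Prop) :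
    Forces (nullFilter 𝕜 X) (Gamma₁ ξ) (fun l => P (weightedSum 𝕜 (weight₁ ξ) l)) ↔
      ∀ᶠ z in blockFilter 𝕜 X ξ, P z := by
  have hζ : ∀ ζ : Set.Iio ξ, Forces (nullFilter 𝕜 X) (shift (ω ^ ζ.1) '' Gamma₁ (ζ.1 + 1))
      (fun l => P (weightedSum 𝕜 (weight₁ ξ) l)) ↔
      ∀ᶠ z in blockFilter 𝕜 X (ζ.1 + 1), P z := fun ζ => by
    rw [← h _ (hξ.add_one_lt ζ.2)]
    refine (forces_image (add_right_injective (ω ^ ζ.1))).trans (forces_congr fun l hl => ?_)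
    rw [weightedSum_map]
    exact iff_of_eq <| congrArg P <| weightedSum_congr fun s hs hsl =>
      weight_limit hξ ζ.2 (prefixClosed_Gamma₁ _ _ hl.1 s hs hsl)
  have hunion : Gamma₁ ξ = {t | ∃ ζ : Set.Iio ξ, t ∈ shift (ω ^ ζ.1) '' Gamma₁ (ζ.1 + 1)} := by
    rw [Gamma₁_limit hξ]
    ext t
    simp
  rw [hunion, forces_union fun ζ η _ _ _ hs hr => Subtype.ext <|
    (log_eq_of_cons_mem_shift_Gamma₁ hs).symm.trans (log_eq_of_cons_mem_shift_Gamma₁ hr)]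
  refine Iff.trans ⟨?_, ?_⟩ (mem_blockFilter_limit 𝕜 hξ).symm
  · exact fun ⟨ζ, hP⟩ => ⟨ζ.1 + 1, hξ.add_one_lt ζ.2, (hζ ζ).1 hP⟩
  · exact fun ⟨ζ, hlt, hP⟩ => ⟨⟨ζ, hlt⟩, (hζ ⟨ζ, hlt⟩).2 (blockFilter_anti 𝕜 X le_self_add hP)⟩

theorem forces_Gamma₁ (ξ : Ordinal.{u}) (P : X → Prop) :
    Forces (nullFilter 𝕜 X) (Gamma₁ ξ) (fun l => P (weightedSum 𝕜 (weight₁ ξ) l)) ↔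
      ∀ᶠ z in blockFilter 𝕜 X ξ, P z := by
  induction ξ using Ordinal.limitRecOn generalizing P with
  | zero =>
      rw [Gamma₁_zero, forces_singleton, blockFilter_zero]
      simp [weightedSum, weight_zero]
  | add_one ξ ih => exact forces_Gamma₁_add_one ih P
  | limit ξ hξ ih => exact forces_Gamma₁_limit hξ ih P

theorem forces_Gamma (ξ : Ordinal.{u}) {n : ℕ} (hn : n ≠ 0) (P : (Fin n → X) → Prop) :
    Forces (nullFilter 𝕜 X) (Gamma ξ n)
      (fun l => P fun i => weightedSum 𝕜 (levelWeight ξ n i) l) ↔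
        ∀ᶠ w in iterFilter (blockFilter 𝕜 X ξ) n, P w := by
  obtain ⟨n, rfl⟩ := Nat.exists_eq_succ_of_ne_zero hn
  exact forces_Gamma_of_Gamma₁ (forces_Gamma₁ ξ) n P

end Gamma

section BlockSum

variable {𝕜 : Type} [RCLike 𝕜] {X : Type v} [NormedAddCommGroup X] [NormedSpace 𝕜 X]

theorem blockSum_eq_weightedSum {D : Type v} (ξ : Ordinal.{u}) (n i : ℕ)
    (x : List (Ordinal.{u} × D) → X) (t : List (Ordinal.{u} × D)) :
    blockSum 𝕜 ξ n i x t = weightedSum 𝕜 (levelWeight ξ n i) (record x t) := by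
  have hnil : [] ∉ decorate (Lambda ξ n i) D := fun h => (ne_nil_lt_of_Lambda h).1 rfl
  rw [weightedSum_record, blockSum, Finset.sum_filter, Finset.sum_range_succ']
  simp only [List.take_zero, hnil, if_false, add_zero]
  refine Finset.sum_congr rfl fun k _ => ?_
  unfold levelWeight
  by_cases hk : t.take (k + 1) ∈ decorate (Lambda ξ n i) D
  · rw [if_pos hk, if_pos (show (t.take (k + 1)).map Prod.fst ∈ Lambda ξ n i from hk)]
  · rw [if_neg hk, if_neg (show (t.take (k + 1)).map Prod.fst ∉ Lambda ξ n i from hk),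
      RCLike.ofReal_zero, zero_smul]

theorem eventually_iter_blockFilter_iff (ξ : Ordinal.{u}) {n : ℕ} (hn : n ≠ 0)
    (P : (Fin n → X) → Prop) :
    (∀ᶠ w in iterFilter (blockFilter 𝕜 X ξ) n, P w) ↔
      ∀ (D : Type v) [Preorder D] [IsDirectedOrder D] [Nonempty D]
        (x : List (Ordinal.{u} × D) → X), (∀ t ∈ decorate (Gamma ξ n) D, ‖x t‖ ≤ 1) →
        WeaklyNull 𝕜 (decorate (Gamma ξ n) D) x →
        ∃ t ∈ maxNodes (decorate (Gamma ξ n) D), P fun i => blockSum 𝕜 ξ n i x t := by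
  simp only [blockSum_eq_weightedSum]
  rw [← forces_Gamma ξ hn]
  constructor
  · intro h D _ _ _ x hx hw
    obtain ⟨t, ht, hP⟩ := h.exists_maxNodes hx hw
    exact ⟨t, mem_maxNodes_decorate_iff.2 ht, hP⟩
  · intro h
    by_contra hP
    obtain ⟨x, hx, hw, hrefute⟩ :=
      exists_weaklyNull_of_not_forces (prefixClosed_Gamma ξ n) (nil_notMem_Gamma ξ n) hP
    obtain ⟨t, ht, hPt⟩ := h (NullSets 𝕜 X) x (fun t _ => hx t) hw
    exact hrefute t (mem_maxNodes_decorate_iff.1 ht) hPt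

end BlockSum

/-! ### Szlenk derivations -/

section Derivation

variable {𝕜 : Type} [RCLike 𝕜] {X : Type v} [NormedAddCommGroup X] [NormedSpace 𝕜 X]
  {K L : Set (StrongDual 𝕜 X)}

theorem derive_subset (ε : ℝ) (K : Set (StrongDual 𝕜 X)) : derive ε K ⊆ K := fun _ h => h.1

theorem derive_mono (ε : ℝ) (h : K ⊆ L) : derive ε K ⊆ derive ε L :=
  fun _ hf => ⟨h hf.1, fun hε V hV => (hf.2 hε V hV).trans_le
    (Metric.ediam_mono (Set.inter_subset_inter_right _ h))⟩

theorem derive_zero (K : Set (StrongDual 𝕜 X)) : derive 0 K = K :=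
  (derive_subset 0 K).antisymm fun _ hf => ⟨hf, fun h => absurd h (lt_irrefl _)⟩

theorem deriveIter_zero (ε : ℝ) (K : Set (StrongDual 𝕜 X)) :
    deriveIter ε (0 : Ordinal.{u}) K = K := by
  simp [deriveIter]

theorem deriveIter_add_one (ε : ℝ) (ξ : Ordinal.{u}) (K : Set (StrongDual 𝕜 X)) :
    deriveIter ε (ξ + 1) K = derive ε (deriveIter ε ξ K) := by
  simp [deriveIter]

theorem deriveIter_limit (ε : ℝ) {ξ : Ordinal.{u}} (hξ : Order.IsSuccLimit ξ)
    (K : Set (StrongDual 𝕜 X)) :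
    deriveIter ε ξ K = ⋂ ζ : Set.Iio ξ, deriveIter ε ζ.1 K := by
  unfold deriveIter
  rw [Ordinal.limitRecOn_limit _ _ _ _ hξ]
  ext f
  simp

theorem deriveIter_anti (ε : ℝ) (K : Set (StrongDual 𝕜 X)) :
    Antitone fun ξ : Ordinal.{u} => deriveIter ε ξ K := by
  intro η ξ h
  dsimp only
  induction ξ using Ordinal.limitRecOn with
  | zero => rw [nonpos_iff_eq_zero.1 h]
  | add_one ξ ih =>
      rcases h.eq_or_lt with rfl | h
      · exact le_rfl
      · rw [deriveIter_add_one]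
        exact (derive_subset _ _).trans (ih (Order.lt_add_one_iff.1 h))
  | limit ξ hξ _ =>
      rcases h.eq_or_lt with rfl | h
      · exact le_rfl
      · rw [deriveIter_limit ε hξ]
        exact Set.iInter_subset (fun ζ : Set.Iio ξ => deriveIter ε ζ.1 K) ⟨η, h⟩

theorem deriveIter_subset (ε : ℝ) (ξ : Ordinal.{u}) (K : Set (StrongDual 𝕜 X)) :
    deriveIter ε ξ K ⊆ K :=
  (deriveIter_anti ε K bot_le).trans_eq (deriveIter_zero ε K)

theorem deriveIter_mono (ε : ℝ) (ξ : Ordinal.{u}) (h : K ⊆ L) :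
    deriveIter ε ξ K ⊆ deriveIter ε ξ L := by
  induction ξ using Ordinal.limitRecOn with
  | zero => simpa only [deriveIter_zero]
  | add_one ξ ih => simpa only [deriveIter_add_one] using derive_mono ε ih
  | limit ξ hξ ih =>
      simp only [deriveIter_limit ε hξ]
      exact Set.iInter_mono fun ζ => ih ζ.1 ζ.2

theorem deriveIter_zero_left (ξ : Ordinal.{u}) (K : Set (StrongDual 𝕜 X)) :
    deriveIter 0 ξ K = K := by
  refine (deriveIter_subset 0 ξ K).antisymm ?_
  induction ξ using Ordinal.limitRecOn with
  | zero => rw [deriveIter_zero]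
  | add_one ξ ih => rwa [deriveIter_add_one, derive_zero]
  | limit ξ hξ ih =>
      rw [deriveIter_limit 0 hξ]
      exact Set.subset_iInter fun ζ => ih ζ.1 ζ.2

theorem deriveIter_add (ε : ℝ) (a b : Ordinal.{u}) (K : Set (StrongDual 𝕜 X)) :
    deriveIter ε (a + b) K = deriveIter ε b (deriveIter ε a K) := by
  induction b using Ordinal.limitRecOn with
  | zero => rw [add_zero, deriveIter_zero]
  | add_one b ih => rw [← add_assoc, deriveIter_add_one, ih, deriveIter_add_one]
  | limit b hb ih =>
      rw [deriveIter_limit ε (Ordinal.isSuccLimit_add a hb), deriveIter_limit ε hb]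
      refine Set.Subset.antisymm (Set.subset_iInter fun ζ => ?_) (Set.subset_iInter fun ζ => ?_)
      · rw [← ih ζ.1 ζ.2]
        exact Set.iInter_subset (fun η : Set.Iio (a + b) => deriveIter ε η.1 K)
          ⟨a + ζ.1, (add_lt_add_iff_left a).2 ζ.2⟩
      · obtain ⟨c, hc, hζc⟩ := (Ordinal.lt_add_iff hb.bot_lt.ne').1 ζ.2
        refine (Set.iInter_subset _ (⟨c, hc⟩ : Set.Iio b)).trans ?_
        rw [← ih c hc]
        exact deriveIter_anti ε K hζc

/-- Closedness in the weak-star topology. -/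
def IsWeakStarClosed (K : Set (StrongDual 𝕜 X)) : Prop :=
  IsClosed (WeakDual.toStrongDual ⁻¹' K : Set (WeakDual 𝕜 X))

theorem IsWeakStarClosed.inter (hK : IsWeakStarClosed K) (hL : IsWeakStarClosed L) :
    IsWeakStarClosed (K ∩ L) :=
  IsClosed.inter hK hL

theorem isWeakStarClosed_le_norm_apply (b : ℝ) (z : X) :
    IsWeakStarClosed {f : StrongDual 𝕜 X | b ≤ ‖f z‖} :=
  isClosed_le continuous_const (WeakDual.eval_continuous z).norm

theorem IsWeakStarClosed.derive (hK : IsWeakStarClosed K) (ε : ℝ) :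
    IsWeakStarClosed (derive ε K) := by
  refine isClosed_of_closure_subset fun f hf => ⟨?_, fun hε V hV => ?_⟩
  · exact closure_minimal (fun g hg => hg.1) hK hf
  · obtain ⟨W, hWV, hW, hfW⟩ := mem_nhds_iff.1 hV
    obtain ⟨g, hgW, hg⟩ := mem_closure_iff.1 hf W hW hfW
    exact (hg.2 hε W (hW.mem_nhds hgW)).trans_le
      (Metric.ediam_mono (Set.inter_subset_inter_left _ (Set.preimage_mono hWV)))

theorem IsWeakStarClosed.deriveIter (hK : IsWeakStarClosed K) (ε : ℝ) (ξ : Ordinal.{u}) :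
    IsWeakStarClosed (deriveIter ε ξ K) := by
  induction ξ using Ordinal.limitRecOn with
  | zero => rwa [deriveIter_zero]
  | add_one ξ ih => rw [deriveIter_add_one]; exact ih.derive ε
  | limit ξ hξ ih =>
      rw [deriveIter_limit ε hξ, IsWeakStarClosed, Set.preimage_iInter]
      exact isClosed_iInter fun ζ => ih ζ.1 ζ.2

theorem IsWeakStarClosed.isCompact (hK : IsWeakStarClosed K) {R : ℝ} (hR : ∀ f ∈ K, ‖f‖ ≤ R) :
    IsCompact (WeakDual.toStrongDual ⁻¹' K : Set (WeakDual 𝕜 X)) :=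
  (WeakDual.isCompact_closedBall (0 : StrongDual 𝕜 X) R).of_isClosed_subset hK
    fun _ hf => mem_closedBall_zero_iff.2 (hR _ hf)

theorem deriveIter_limit_nonempty (hK : IsWeakStarClosed K) {R : ℝ} (hR : ∀ f ∈ K, ‖f‖ ≤ R)
    {ε : ℝ} {ξ : Ordinal.{u}} (hξ : Order.IsSuccLimit ξ)
    (h : ∀ ζ < ξ, (deriveIter ε ζ K).Nonempty) : (deriveIter ε ξ K).Nonempty := by
  have : Nonempty (Set.Iio ξ) := ⟨⟨0, hξ.bot_lt⟩⟩
  rw [deriveIter_limit ε hξ]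
  have hinter : (⋂ ζ : Set.Iio ξ,
      (WeakDual.toStrongDual ⁻¹' deriveIter ε ζ.1 K : Set (WeakDual 𝕜 X))).Nonempty :=
    IsCompact.nonempty_iInter_of_directed_nonempty_isCompact_isClosed _
      (fun a b => ⟨max a b, Set.preimage_mono (deriveIter_anti ε K (le_max_left a.1 b.1)),
        Set.preimage_mono (deriveIter_anti ε K (le_max_right a.1 b.1))⟩)
      (fun ζ => h ζ.1 ζ.2)
      (fun ζ => (hK.deriveIter ε ζ.1).isCompact fun f hf => hR f (deriveIter_subset _ _ _ hf))
      (fun ζ => hK.deriveIter ε ζ.1)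
  rwa [← Set.preimage_iInter] at hinter

/-- The iterated derivation `s_{ε₁}^{ω ^ ξ} ⋯ s_{εₙ}^{ω ^ ξ}(K)`. -/
def deriveFold (ξ : Ordinal.{u}) {n : ℕ} (ε : Fin n → ℝ) (K : Set (StrongDual 𝕜 X)) :
    Set (StrongDual 𝕜 X) :=
  (List.ofFn ε).foldr (fun ε L => deriveIter ε (ω ^ ξ) L) K

theorem deriveFold_zero (ξ : Ordinal.{u}) (ε : Fin 0 → ℝ) (K : Set (StrongDual 𝕜 X)) :
    deriveFold ξ ε K = K := by
  simp [deriveFold]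

theorem deriveFold_succ (ξ : Ordinal.{u}) {n : ℕ} (ε : Fin (n + 1) → ℝ)
    (K : Set (StrongDual 𝕜 X)) :
    deriveFold ξ ε K = deriveIter (ε 0) (ω ^ ξ) (deriveFold ξ (fun i => ε i.succ) K) := by
  simp [deriveFold, List.ofFn_succ]

theorem deriveFold_subset (ξ : Ordinal.{u}) :
    ∀ {n : ℕ} (ε : Fin n → ℝ) (K : Set (StrongDual 𝕜 X)), deriveFold ξ ε K ⊆ K
  | 0, ε, K => (deriveFold_zero ξ ε K).le
  | n + 1, ε, K => by
      rw [deriveFold_succ]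
      exact (deriveIter_subset _ _ _).trans (deriveFold_subset ξ _ K)

theorem deriveFold_mono (ξ : Ordinal.{u}) (h : K ⊆ L) :
    ∀ {n : ℕ} (ε : Fin n → ℝ), deriveFold ξ ε K ⊆ deriveFold ξ ε L
  | 0, ε => by simpa only [deriveFold_zero]
  | n + 1, ε => by
      rw [deriveFold_succ, deriveFold_succ]
      exact deriveIter_mono _ _ (deriveFold_mono ξ h _)

theorem IsWeakStarClosed.deriveFold (hK : IsWeakStarClosed K) (ξ : Ordinal.{u}) :
    ∀ {n : ℕ} (ε : Fin n → ℝ), IsWeakStarClosed (deriveFold ξ ε K)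
  | 0, ε => by rwa [deriveFold_zero]
  | n + 1, ε => by
      rw [deriveFold_succ]
      exact (hK.deriveFold ξ _).deriveIter _ _

theorem deriveFold_ite_zero (ξ : Ordinal.{u}) (ε : ℝ) (K : Set (StrongDual 𝕜 X)) :
    ∀ {n : ℕ} (p : Fin n → Prop) [DecidablePred p],
      deriveFold ξ (fun i => if p i then ε else 0) K =
        deriveIter ε (ω ^ ξ * (Finset.univ.filter p).card) K
  | 0, p, _ => by simp [deriveFold_zero, deriveIter_zero]
  | n + 1, p, _ => by
      rw [deriveFold_succ, deriveFold_ite_zero ξ ε K (fun i => p i.succ),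
        Fin.card_filter_univ_succ]
      by_cases h : p 0
      · simp only [h, if_true]
        rw [← deriveIter_add, Nat.cast_add, Nat.cast_one, mul_add_one]
      · simp only [h, if_false]
        rw [deriveIter_zero_left]

end Derivation

/-! ### Derivations and block filters -/

section Duality

theorem exists_ultrafilter_of_frequently_exists {α β : Type*} {F : Filter α} {P : α × β → Prop}
    (h : ∃ᶠ a in F, ∃ b, P (a, b)) :
    ∃ G : Ultrafilter (α × β), Tendsto Prod.fst (G : Filter (α × β)) F ∧
      ∀ᶠ p in (G : Filter (α × β)), P p := by
  have : (comap Prod.fst F ⊓ 𝓟 {p | P p}).NeBot := by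
    rw [← frequently_mem_iff_neBot, frequently_comap]
    exact h.mono fun a ⟨b, hb⟩ => ⟨(a, b), rfl, hb⟩
  have hG := Ultrafilter.of_le (comap Prod.fst F ⊓ 𝓟 {p | P p})
  exact ⟨_, tendsto_iff_comap.2 (hG.trans inf_le_left),
    le_principal_iff.1 (hG.trans inf_le_right)⟩

theorem norm_sum_le_card_mul_add {ι E : Type*} [SeminormedAddCommGroup E] (s : Finset ι)
    {R c : ℝ} (hc : 0 ≤ c) {w : ι → E} (hw : ∀ i ∈ s, ‖w i‖ ≤ R) :
    ‖∑ i ∈ s, w i‖ ≤ s.card * c + (s.filter fun i => c ≤ ‖w i‖).card * R :=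
  calc ‖∑ i ∈ s, w i‖ ≤ ∑ i ∈ s, ‖w i‖ := norm_sum_le s w
    _ ≤ ∑ i ∈ s, (c + if c ≤ ‖w i‖ then R else 0) := Finset.sum_le_sum fun i hi => by
        split_ifs with h
        · linarith [hw i hi]
        · linarith
    _ = s.card * c + (s.filter fun i => c ≤ ‖w i‖).card * R := by
        rw [Finset.sum_add_distrib, ← Finset.sum_filter]
        simp only [Finset.sum_const, nsmul_eq_mul]

section Generic

variable {𝕜 : Type*} [RCLike 𝕜] {X : Type*} [NormedAddCommGroup X] [NormedSpace 𝕜 X]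

theorem exists_lt_re_apply_of_lt_norm {f : StrongDual 𝕜 X} {r : ℝ} (h : r < ‖f‖) :
    ∃ z : X, ‖z‖ ≤ 1 ∧ r < RCLike.re (f z) := by
  obtain ⟨z, hz, hrz⟩ := f.exists_lt_apply_of_lt_opNorm h
  obtain ⟨c, hc, hcz⟩ := RCLike.exists_norm_eq_mul_self (f z)
  refine ⟨c • z, by rw [norm_smul, hc, one_mul]; exact hz.le, ?_⟩
  rwa [map_smul, smul_eq_mul, ← hcz, RCLike.ofReal_re]

theorem lt_norm_sub_of_norm_apply_lt {f g : StrongDual 𝕜 X} {z : X} {r ε : ℝ} (hz : ‖z‖ ≤ 1)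
    (hf : r ≤ ‖f z‖) (hg : ‖g z‖ < r - ε) : ε < ‖f - g‖ := by
  have hle : ‖f z - g z‖ ≤ ‖f - g‖ := (f - g).unit_le_opNorm z hz
  linarith [norm_sub_norm_le (f z) (g z)]

theorem lt_re_apply_half_sub {f g : StrongDual 𝕜 X} {z z' : X} {ε : ℝ}
    (hε : 0 < ε) (hz : ε / 2 < RCLike.re ((g - f) z)) (hz' : ‖g z' - f z'‖ < ε / 40)
    (hf : ‖f ((2 : 𝕜)⁻¹ • (z - z'))‖ < ε / 40) :
    ε / 5 < RCLike.re (g ((2 : 𝕜)⁻¹ • (z - z'))) := by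
  have hhalf : ∀ h : StrongDual 𝕜 X, RCLike.re (h ((2 : 𝕜)⁻¹ • (z - z'))) =
      2⁻¹ * (RCLike.re (h z) - RCLike.re (h z')) := fun h => by
    rw [map_smul, map_sub, smul_eq_mul, ← RCLike.ofReal_ofNat, ← RCLike.ofReal_inv,
      RCLike.re_ofReal_mul, map_sub]
  have hre' := (abs_le.1 (RCLike.abs_re_le_norm (g z' - f z'))).2
  have hre := (abs_le.1 (RCLike.abs_re_le_norm (f ((2 : 𝕜)⁻¹ • (z - z'))))).1
  rw [hhalf] at hre ⊢
  simp only [sub_apply, map_sub] at hz hre'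
  linarith

theorem exists_finset_le_norm_apply {n m : ℕ} {R r c : ℝ} (hR : 0 < R) (hc : 0 ≤ c)
    (hn : m * R < n * (r - c)) {f : StrongDual 𝕜 X} (hf : ‖f‖ ≤ R) {w : Fin n → X}
    (hw : ∀ i, ‖w i‖ ≤ 1) (hr : r ≤ ‖f ((n : 𝕜)⁻¹ • ∑ i, w i)‖) :
    ∃ I : Finset (Fin n), m ≤ I.card ∧ ∀ i, (if i ∈ I then c else 0) ≤ ‖f (w i)‖ := by
  refine ⟨Finset.univ.filter fun i => c ≤ ‖f (w i)‖, ?_, fun i => ?_⟩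
  · have hsum := norm_sum_le_card_mul_add Finset.univ hc (w := fun i => f (w i)) fun i _ =>
      (f.le_of_opNorm_le_of_le hf (hw i)).trans_eq (mul_one R)
    rw [Finset.card_univ, Fintype.card_fin] at hsum
    have hn_pos : (0 : ℝ) < n := by
      rcases n.eq_zero_or_pos with rfl | h
      · exact absurd hn (by simpa using by positivity)
      · exact_mod_cast h
    rw [map_smul, map_sum, norm_smul, norm_inv, RCLike.norm_natCast, le_inv_mul_iff₀ hn_pos] at hr
    have hm : (m : ℝ) * R ≤ (Finset.univ.filter fun i => c ≤ ‖f (w i)‖).card * R := by linarith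
    exact_mod_cast (mul_le_mul_iff_left₀ hR).1 hm
  · split_ifs with hi
    · exact (Finset.mem_filter.1 hi).2
    · exact norm_nonneg _

end Generic

variable {𝕜 : Type} [RCLike 𝕜] {X : Type v} [NormedAddCommGroup X] [NormedSpace 𝕜 X]
  {K L : Set (StrongDual 𝕜 X)} {f : StrongDual 𝕜 X} {ε R : ℝ} {ξ : Ordinal.{u}}

/-- Frequently along `F`, each weak-star neighbourhood of `f` contains some `g ∈ L` with
`Re g(z) > r`. For suitable `F` this is what membership of `f` in a derived set of `L` amounts
to. -/
def LargeNear (F : Filter X) (r : ℝ) (L : Set (StrongDual 𝕜 X)) (f : StrongDual 𝕜 X) : Prop :=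
  ∀ V ∈ 𝓝 (StrongDual.toWeakDual f), ∃ᶠ z in F, ∃ g ∈ L,
    StrongDual.toWeakDual g ∈ V ∧ r < RCLike.re (g z)

theorem exists_norm_sub_gt_of_mem_derive (hε : 0 < ε) (hf : f ∈ derive ε L)
    {V : Set (WeakDual 𝕜 X)} (hV : V ∈ 𝓝 (StrongDual.toWeakDual f)) :
    ∃ g ∈ L, StrongDual.toWeakDual g ∈ V ∧ ε / 2 < ‖g - f‖ := by
  by_contra! hfar
  refine (hf.2 hε V hV).not_ge (Metric.ediam_le fun g hg g' hg' => ?_)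
  rw [edist_dist]
  refine ENNReal.ofReal_le_ofReal ((dist_triangle_right g g' f).trans ?_)
  rw [dist_eq_norm, dist_eq_norm]
  linarith [hfar g hg.2 hg.1, hfar g' hg'.2 hg'.1]

theorem exists_ultrafilter_of_mem_derive (hε : 0 < ε) (hf : f ∈ derive ε L) :
    ∃ G : Ultrafilter (WeakDual 𝕜 X × X),
      Tendsto Prod.fst (G : Filter (WeakDual 𝕜 X × X)) (𝓝 (StrongDual.toWeakDual f)) ∧
      ∀ᶠ p in (G : Filter (WeakDual 𝕜 X × X)), WeakDual.toStrongDual p.1 ∈ L ∧ ‖p.2‖ ≤ 1 ∧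
        ε / 2 < RCLike.re ((WeakDual.toStrongDual p.1 - f) p.2) := by
  refine exists_ultrafilter_of_frequently_exists (frequently_iff.2 fun {V} hV => ?_)
  obtain ⟨g, hgL, hgV, hg⟩ := exists_norm_sub_gt_of_mem_derive hε hf hV
  obtain ⟨z, hz, hgz⟩ := exists_lt_re_apply_of_lt_norm hg
  exact ⟨_, hgV, z, hgL, hz, hgz⟩

theorem tendsto_half_sub_nullFilter {α : Type*} (G : Ultrafilter α) {z : α → X}
    (hz : ∀ᶠ a in (G : Filter α), ‖z a‖ ≤ 1) :
    Tendsto (fun p : α × α => (2 : 𝕜)⁻¹ • (z p.2 - z p.1)) ((G : Filter α) ×ˢ (G : Filter α))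
      (nullFilter 𝕜 X) := by
  refine (tendsto_nullFilter 𝕜).2 ⟨fun f => ?_, ?_⟩
  · have hball : ∀ᶠ a in (G : Filter α), f (z a) ∈ Metric.closedBall (0 : 𝕜) ‖f‖ :=
      hz.mono fun a ha => by simpa using f.le_of_opNorm_le_of_le le_rfl ha
    obtain ⟨c, -, hc⟩ := (isCompact_closedBall (0 : 𝕜) ‖f‖).ultrafilter_le_nhds
      (G.map fun a => f (z a)) (le_principal_iff.2 hball)
    have hlim : Tendsto (fun a => f (z a)) G (𝓝 c) := hc
    simpa using ((hlim.comp tendsto_snd).sub (hlim.comp tendsto_fst)).const_smul (2 : 𝕜)⁻¹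
  · filter_upwards [hz.prod_mk hz] with p hp
    rw [norm_smul, norm_inv, RCLike.norm_ofNat]
    linarith [norm_sub_le (z p.2) (z p.1), hp.1, hp.2]

/- Near `f` there are `g ∈ L` and `z ∈ B_X` with `Re (g - f)(z) > ε / 2`; the points `z` need not be
weakly null, but half the difference of two of them, taken along an ultrafilter, is. -/
theorem largeNear_nullFilter_of_mem_derive (hε : 0 < ε) (hf : f ∈ derive ε L) :
    LargeNear (nullFilter 𝕜 X) (ε / 5) L f := by
  intro V hV hsmall
  obtain ⟨G, hGf, hG⟩ := exists_ultrafilter_of_mem_derive hε hf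
  have hfz := eventually_norm_apply_lt_nullFilter 𝕜 f (show 0 < ε / 40 by positivity)
  have hnull := tendsto_half_sub_nullFilter (𝕜 := 𝕜) G (z := Prod.snd) (hG.mono fun p hp => hp.2.1)
  obtain ⟨⟨g', z'⟩, hz'⟩ := (hnull.eventually (hsmall.and hfz)).curry.exists
  have hclose : ∀ᶠ p in (G : Filter (WeakDual 𝕜 X × X)), ‖p.1 z' - f z'‖ < ε / 40 := by
    have := ((WeakDual.eval_continuous z').tendsto (StrongDual.toWeakDual f)).comp hGf
    simpa [dist_eq_norm] using Metric.tendsto_nhds.1 this (ε / 40) (by positivity)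
  obtain ⟨⟨g, z⟩, ⟨hnot, hfz⟩, hgz', ⟨hgL, -, hgz⟩, hgV⟩ :=
    (hz'.and (hclose.and (hG.and (hGf.eventually hV)))).exists
  exact hnot ⟨WeakDual.toStrongDual g, hgL, hgV, lt_re_apply_half_sub hε hgz hgz' hfz⟩

theorem frequently_iterFilter_of_mem_deriveFold
    (h : ∀ ε > 0, ∀ (L : Set (StrongDual 𝕜 X)), ∀ f ∈ deriveIter ε (ω ^ ξ) L,
      LargeNear (blockFilter 𝕜 X ξ) (ε / 5) L f) (K : Set (StrongDual 𝕜 X)) :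
    ∀ {n : ℕ} (ε : Fin n → ℝ), (∀ i, 0 < ε i) → ∀ f ∈ deriveFold ξ ε K,
      ∀ V ∈ 𝓝 (StrongDual.toWeakDual f), ∃ᶠ w in iterFilter (blockFilter 𝕜 X ξ) n,
        ∃ g ∈ K, StrongDual.toWeakDual g ∈ V ∧ ∀ i, ε i / 5 < RCLike.re (g (w i))
  | 0, ε, _, f, hf, V, hV => by
      rw [deriveFold_zero] at hf
      exact frequently_iterFilter_zero.2 ⟨f, hf, mem_of_mem_nhds hV, fun i => i.elim0⟩
  | n + 1, ε, hε, f, hf, V, hV => by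
      rw [deriveFold_succ] at hf
      refine frequently_iterFilter_succ.2 ((h _ (hε 0) _ f hf _ (interior_mem_nhds.2 hV)).mono ?_)
      rintro z ⟨g, hg, hgV, hgz⟩
      have hW : V ∩ {g : WeakDual 𝕜 X | ε 0 / 5 < RCLike.re (g z)} ∈
          𝓝 (StrongDual.toWeakDual g) :=
        inter_mem (mem_interior_iff_mem_nhds.1 hgV) <| IsOpen.mem_nhds
          (isOpen_lt continuous_const (RCLike.continuous_re.comp (WeakDual.eval_continuous z))) hgz
      refine (frequently_iterFilter_of_mem_deriveFold h K _ (fun i => hε i.succ) g hg _ hW).mono ?_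
      rintro w ⟨g', hg', hgV', hgw⟩
      exact ⟨g', hg', hgV'.1, Fin.cases hgV'.2 hgw⟩

theorem lt_re_apply_avg {f : StrongDual 𝕜 X} {n : ℕ} (hn : n ≠ 0) {r : ℝ} {w : Fin n → X}
    (h : ∀ i, r < RCLike.re (f (w i))) : r < RCLike.re (f ((n : 𝕜)⁻¹ • ∑ i, w i)) := by
  have : Nonempty (Fin n) := ⟨⟨0, Nat.pos_of_ne_zero hn⟩⟩
  have hn_pos : (0 : ℝ) < n := by positivity
  rw [map_smul, smul_eq_mul, ← RCLike.ofReal_natCast, ← RCLike.ofReal_inv, RCLike.re_ofReal_mul,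
    map_sum, map_sum, lt_inv_mul_iff₀ hn_pos]
  calc (n : ℝ) * r = ∑ _i : Fin n, r := by simp
    _ < ∑ i, RCLike.re (f (w i)) :=
      Finset.sum_lt_sum_of_nonempty Finset.univ_nonempty fun i _ => h i

theorem largeNear_blockFilter_of_mem_deriveIter (ξ : Ordinal.{u}) :
    ∀ ε > 0, ∀ (L : Set (StrongDual 𝕜 X)), ∀ f ∈ deriveIter ε (ω ^ ξ) L,
      LargeNear (blockFilter 𝕜 X ξ) (ε / 5) L f := by
  induction ξ using Ordinal.limitRecOn with
  | zero =>
      intro ε hε L f hf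
      rw [Ordinal.opow_zero, ← zero_add (1 : Ordinal.{u}), deriveIter_add_one,
        deriveIter_zero] at hf
      rw [blockFilter_zero]
      exact largeNear_nullFilter_of_mem_derive hε hf
  | add_one ξ ih =>
      intro ε hε L f hf V hV hsmall
      obtain ⟨n, hn⟩ := (mem_blockFilter_add_one 𝕜).1 hsmall
      have hf' : f ∈ deriveFold ξ (fun _ : Fin (n + 1) => ε) L := by
        have hfold := deriveFold_ite_zero ξ ε L fun _ : Fin (n + 1) => True
        simp only [if_true, Finset.filter_true, Finset.card_univ, Fintype.card_fin] at hfold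
        rw [hfold]
        refine deriveIter_anti ε L ?_ hf
        rw [Ordinal.opow_add, Ordinal.opow_one]
        exact mul_le_mul_right (Ordinal.natCast_lt_omega0 _).le _
      refine frequently_iterFilter_of_mem_deriveFold ih L (fun _ : Fin (n + 1) => ε) (fun _ => hε)
        f hf' V hV (((eventually_avgFilter 𝕜).1 hn).mono ?_)
      rintro w hw ⟨g, hg, hgV, hgw⟩
      exact hw ⟨g, hg, hgV, lt_re_apply_avg n.succ_ne_zero hgw⟩
  | limit ξ hξ ih =>
      intro ε hε L f hf V hV hsmall
      obtain ⟨ζ, hζ, h⟩ := (mem_blockFilter_limit 𝕜 hξ).1 hsmall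
      exact ih ζ hζ ε hε L f (deriveIter_anti ε L
        (Ordinal.opow_le_opow_right Ordinal.omega0_pos hζ.le) hf) V hV h

theorem frequently_iterFilter_of_deriveFold_nonempty (ξ : Ordinal.{u}) {n : ℕ} {ε : Fin n → ℝ}
    (hε : ∀ i, 0 < ε i) (h : (deriveFold ξ ε K).Nonempty) :
    ∃ᶠ w in iterFilter (blockFilter 𝕜 X ξ) n, ∃ f ∈ K, ∀ i, ε i / 5 < RCLike.re (f (w i)) := by
  obtain ⟨f, hf⟩ := h
  refine (frequently_iterFilter_of_mem_deriveFold (largeNear_blockFilter_of_mem_deriveIter ξ) K ε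
    hε f hf Set.univ univ_mem).mono ?_
  rintro w ⟨g, hg, -, hgw⟩
  exact ⟨g, hg, hgw⟩

theorem derive_nonempty_of_frequently (hK : IsWeakStarClosed K) (hR : ∀ f ∈ K, ‖f‖ ≤ R) {r : ℝ}
    (hεr : ε < r) (h : ∃ᶠ z in nullFilter 𝕜 X, ∃ f ∈ K, r ≤ ‖f z‖) : (derive ε K).Nonempty := by
  obtain ⟨G, hGnull, hG⟩ := exists_ultrafilter_of_frequently_exists
    (P := fun p : X × WeakDual 𝕜 X => WeakDual.toStrongDual p.2 ∈ K ∧ r ≤ ‖p.2 p.1‖) h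
  obtain ⟨f, hf, hGf⟩ := (hK.isCompact hR).ultrafilter_le_nhds (G.map Prod.snd)
    (le_principal_iff.2 (hG.mono fun p hp => hp.1))
  refine ⟨WeakDual.toStrongDual f, hf, fun hε V hV => ?_⟩
  have hmemV : ∀ᶠ p in (G : Filter (X × WeakDual 𝕜 X)), p.2 ∈ V := hGf hV
  have hfz := hGnull.eventually (eventually_norm_apply_lt_nullFilter 𝕜
    (WeakDual.toStrongDual f) (sub_pos.2 hεr))
  have hball := hGnull.eventually (eventually_norm_le_nullFilter 𝕜)
  obtain ⟨⟨z, g⟩, hgV, hfz, hz, hgK, hgz⟩ := (hmemV.and (hfz.and (hball.and hG))).exists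
  refine lt_of_lt_of_le ?_ (Metric.edist_le_ediam_of_mem (x := WeakDual.toStrongDual g)
    (y := WeakDual.toStrongDual f) ⟨hgV, hgK⟩ ⟨mem_of_mem_nhds (x := f) hV, hf⟩)
  rw [edist_dist, ENNReal.ofReal_lt_ofReal_iff_of_nonneg hε.le, dist_eq_norm]
  exact lt_norm_sub_of_norm_apply_lt hz hgz hfz

variable (𝕜 X) in
/-- A weak-star closed set of functionals of norm at most `R`, some of which take absolute values
at least `r` frequently along the `ξ`-blocks, survives `ω ^ ξ` derivations with a parameter
smaller than `r`. This is the induction hypothesis of `largeBlocksSurvive`. -/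
def LargeBlocksSurvive (R : ℝ) (ξ : Ordinal.{u}) : Prop :=
  ∀ K : Set (StrongDual 𝕜 X), IsWeakStarClosed K → (∀ f ∈ K, ‖f‖ ≤ R) → ∀ r ε : ℝ, 0 < ε →
    ε < r → (∃ᶠ z in blockFilter 𝕜 X ξ, ∃ f ∈ K, r ≤ ‖f z‖) → (deriveIter ε (ω ^ ξ) K).Nonempty

theorem LargeBlocksSurvive.deriveFold_nonempty (h : LargeBlocksSurvive 𝕜 X R ξ) :
    ∀ {n : ℕ} {K : Set (StrongDual 𝕜 X)}, IsWeakStarClosed K → (∀ f ∈ K, ‖f‖ ≤ R) →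
      ∀ {r ε : Fin n → ℝ}, (∀ i, ε i = 0 ∨ 0 < ε i ∧ ε i < r i) →
      (∃ᶠ w in iterFilter (blockFilter 𝕜 X ξ) n, ∃ f ∈ K, ∀ i, r i ≤ ‖f (w i)‖) →
      (deriveFold ξ ε K).Nonempty
  | 0, K, _, _, r, ε, _, hw => by
      obtain ⟨f, hf, -⟩ := frequently_iterFilter_zero.1 hw
      rw [deriveFold_zero]
      exact ⟨f, hf⟩
  | n + 1, K, hK, hR, r, ε, hε, hw => by
      have hfirst : ∃ᶠ z in blockFilter 𝕜 X ξ,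
          ∃ f ∈ deriveFold ξ (fun i => ε (Fin.succ i)) K, r 0 ≤ ‖f z‖ := by
        refine (frequently_iterFilter_succ.1 hw).mono fun z hz => ?_
        obtain ⟨f, hf⟩ := h.deriveFold_nonempty (K := K ∩ {f | r 0 ≤ ‖f z‖})
          (hK.inter (isWeakStarClosed_le_norm_apply _ _)) (fun f hf => hR f hf.1)
          (fun i => hε (Fin.succ i)) <| hz.mono fun w ⟨f, hf, hfw⟩ =>
            ⟨f, ⟨hf, by simpa using hfw 0⟩, fun i => by simpa using hfw i.succ⟩
        exact ⟨f, deriveFold_mono ξ Set.inter_subset_left _ hf, (deriveFold_subset ξ _ _ hf).2⟩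
      rw [deriveFold_succ]
      rcases hε 0 with h_zero | ⟨h_pos, h_lt⟩
      · rw [h_zero, deriveIter_zero_left]
        obtain ⟨z, f, hf, -⟩ := hfirst.exists
        exact ⟨f, hf⟩
      · exact h _ (hK.deriveFold ξ _) (fun f hf => hR f (deriveFold_subset ξ _ _ hf)) _ _
          h_pos h_lt hfirst

theorem LargeBlocksSurvive.deriveIter_mul_nonempty (hR0 : 0 < R) (h : LargeBlocksSurvive 𝕜 X R ξ)
    (hK : IsWeakStarClosed K) (hR : ∀ f ∈ K, ‖f‖ ≤ R) {r : ℝ} (hε : 0 < ε) (hεr : ε < r)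
    (hfreq : ∃ᶠ z in blockFilter 𝕜 X (ξ + 1), ∃ f ∈ K, r ≤ ‖f z‖) (m : ℕ) :
    (deriveIter ε (ω ^ ξ * m) K).Nonempty := by
  obtain ⟨c, hεc, hcr⟩ := exists_between hεr
  obtain ⟨n, hn⟩ := exists_nat_gt (m * R / (r - c))
  rw [div_lt_iff₀ (sub_pos.2 hcr)] at hn
  have hn' : m * R < (n + 1 : ℕ) * (r - c) := hn.trans (by push_cast; linarith)
  have havg : ∃ᶠ w in iterFilter (blockFilter 𝕜 X ξ) (n + 1), ∃ f ∈ K,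
      r ≤ ‖f (((n + 1 : ℕ) : 𝕜)⁻¹ • ∑ i, w i)‖ := by
    rw [← frequently_avgFilter 𝕜 (p := fun z => ∃ f ∈ K, r ≤ ‖f z‖)]
    refine hfreq.filter_mono ?_
    rw [blockFilter_add_one]
    exact iInf_le _ n
  have hI : ∃ᶠ w in iterFilter (blockFilter 𝕜 X ξ) (n + 1), ∃ I : Finset (Fin (n + 1)),
      m ≤ I.card ∧ ∃ f ∈ K, ∀ i, (if i ∈ I then c else 0) ≤ ‖f (w i)‖ := by
    refine (havg.and_eventually (eventually_iter_blockFilter_norm_le 𝕜 ξ (n + 1))).mono ?_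
    rintro w ⟨⟨f, hf, hfw⟩, hw⟩
    obtain ⟨I, hm, hI⟩ := exists_finset_le_norm_apply hR0 (hε.trans hεc).le hn' (hR f hf) hw hfw
    exact ⟨I, hm, f, hf, hI⟩
  obtain ⟨I, hI⟩ := frequently_exists.1 hI
  obtain ⟨-, hm, -⟩ := hI.exists
  have hfold := h.deriveFold_nonempty hK hR (ε := fun i => if i ∈ I then ε else 0)
    (fun i => by by_cases hi : i ∈ I <;> simp [hi, hε, hεc]) (hI.mono fun w hw => hw.2)
  rw [deriveFold_ite_zero, Finset.filter_mem_eq_inter, Finset.univ_inter] at hfold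
  exact hfold.mono (deriveIter_anti ε K (mul_le_mul_right (by exact_mod_cast hm) _))

theorem LargeBlocksSurvive.add_one (hR0 : 0 < R) (h : LargeBlocksSurvive 𝕜 X R ξ) :
    LargeBlocksSurvive 𝕜 X R (ξ + 1) := by
  intro K hK hR r ε hε hεr hfreq
  have hpos : (0 : Ordinal.{u}) < ω ^ ξ := Ordinal.opow_pos _ Ordinal.omega0_pos
  rw [Ordinal.opow_add, Ordinal.opow_one]
  refine deriveIter_limit_nonempty hK hR
    (Ordinal.isSuccLimit_mul_right hpos Ordinal.isSuccLimit_omega0) fun ζ hζ => ?_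
  obtain ⟨d, hd, hζd⟩ := (Ordinal.lt_mul_iff_of_isSuccLimit Ordinal.isSuccLimit_omega0).1 hζ
  obtain ⟨m, rfl⟩ := Ordinal.lt_omega0.1 hd
  exact (h.deriveIter_mul_nonempty hR0 hK hR hε hεr hfreq m).mono (deriveIter_anti ε K hζd.le)

theorem largeBlocksSurvive (hR0 : 0 < R) (ξ : Ordinal.{u}) : LargeBlocksSurvive 𝕜 X R ξ := by
  induction ξ using Ordinal.limitRecOn with
  | zero =>
      intro K hK hR r ε _ hεr hfreq
      rw [blockFilter_zero] at hfreq
      rw [Ordinal.opow_zero, ← zero_add (1 : Ordinal.{u}), deriveIter_add_one, deriveIter_zero]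
      exact derive_nonempty_of_frequently hK hR hεr hfreq
  | add_one ξ ih => exact ih.add_one hR0
  | limit ξ hξ ih =>
      intro K hK hR r ε hε hεr hfreq
      refine deriveIter_limit_nonempty hK hR
        (Ordinal.isSuccLimit_opow Ordinal.one_lt_omega0 hξ) fun η hη => ?_
      obtain ⟨ζ, hζ, hηζ⟩ := (Ordinal.lt_opow_of_isSuccLimit Ordinal.omega0_ne_zero hξ).1 hη
      exact (ih ζ hζ K hK hR r ε hε hεr
        (hfreq.filter_mono (blockFilter_anti 𝕜 X hζ.le))).mono (deriveIter_anti ε K hηζ.le)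

theorem deriveFold_nonempty_of_frequently (ξ : Ordinal.{u}) (hK : IsWeakStarClosed K)
    (hR : ∀ f ∈ K, ‖f‖ ≤ R) {n : ℕ} {r ε : Fin n → ℝ} (hε : ∀ i, ε i = 0 ∨ 0 < ε i ∧ ε i < r i)
    (h : ∃ᶠ w in iterFilter (blockFilter 𝕜 X ξ) n, ∃ f ∈ K, ∀ i, r i ≤ ‖f (w i)‖) :
    (deriveFold ξ ε K).Nonempty :=
  (largeBlocksSurvive (R := max R 1) (by positivity) ξ).deriveFold_nonempty hK
    (fun f hf => (hR f hf).trans (le_max_left _ _)) hε h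

end Duality

/-! ### Upper estimates along block filters -/

section Estimate

theorem mul_div_add_one_lt {C ε : ℝ} (hC : 0 ≤ C) (hε : 0 < ε) : C * (ε / (C + 1)) < ε := by
  rw [mul_div_assoc', div_lt_iff₀ (by positivity)]
  linarith

theorem norm_sum_smul_le {ι 𝕜 E : Type*} [NormedField 𝕜] [SeminormedAddCommGroup E]
    [NormedSpace 𝕜 E] (s : Finset ι) (a : ι → 𝕜) {w : ι → E} {r : ℝ} (hw : ∀ i ∈ s, ‖w i‖ ≤ r) :
    ‖∑ i ∈ s, a i • w i‖ ≤ (∑ i ∈ s, ‖a i‖) * r := by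
  rw [Finset.sum_mul]
  refine norm_sum_le_of_le s fun i hi => ?_
  rw [norm_smul]
  exact mul_le_mul_of_nonneg_left (hw i hi) (norm_nonneg _)

variable {𝕜 : Type} [RCLike 𝕜] {W X Y Z : Type v} [NormedAddCommGroup W] [NormedSpace 𝕜 W]
  [NormedAddCommGroup X] [NormedSpace 𝕜 X] [NormedAddCommGroup Y] [NormedSpace 𝕜 Y]
  [NormedAddCommGroup Z] [NormedSpace 𝕜 Z]

theorem support_adjointBall (A : X →L[𝕜] Y) (x : X) : support (adjointBall A) x = ‖A x‖ := by
  have hle : ∀ r ∈ (fun f : StrongDual 𝕜 X => RCLike.re (f x)) '' adjointBall A, r ≤ ‖A x‖ := by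
    rintro _ ⟨_, ⟨g, hg, rfl⟩, rfl⟩
    exact (RCLike.re_le_norm _).trans <|
      (g.le_of_opNorm_le (mem_closedBall_zero_iff.1 hg) (A x)).trans_eq (one_mul _)
  obtain ⟨g, hg, hgx⟩ := exists_dual_vector'' 𝕜 (A x)
  have hmem : ‖A x‖ ∈ (fun f : StrongDual 𝕜 X => RCLike.re (f x)) '' adjointBall A :=
    ⟨_, ⟨g, mem_closedBall_zero_iff.2 hg, rfl⟩, by simp [hgx]⟩
  exact le_antisymm (csSup_le ⟨_, hmem⟩ hle) (le_csSup ⟨_, hle⟩ hmem)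

theorem norm_le_of_mem_adjointBall {A : X →L[𝕜] Y} {f : StrongDual 𝕜 X} (hf : f ∈ adjointBall A) :
    ‖f‖ ≤ ‖A‖ := by
  obtain ⟨g, hg, rfl⟩ := hf
  exact (g.opNorm_comp_le A).trans
    (mul_le_of_le_one_left (norm_nonneg _) (mem_closedBall_zero_iff.1 hg))

theorem isWeakStarClosed_adjointBall (A : X →L[𝕜] Y) : IsWeakStarClosed (adjointBall A) := by
  let T : WeakDual 𝕜 Y → WeakDual 𝕜 X := fun g =>
    StrongDual.toWeakDual ((WeakDual.toStrongDual g).comp A)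
  have hT : Continuous T :=
    WeakDual.continuous_of_continuous_eval fun x => WeakDual.eval_continuous (A x)
  exact ((WeakDual.isCompact_closedBall (0 : StrongDual 𝕜 Y) 1).image hT).isClosed

/-- The upper `p`-estimate `‖A (∑ aᵢ wᵢ)‖ ≤ c ‖a‖_p`, up to arbitrarily small errors, for `w`
along the iterated block filter. For `n ≥ 1` it is equivalent to the estimate on trees that defines
`α_{ξ,p,n}(A)`. -/
def EventualBound (ξ : Ordinal.{u}) (p : ℝ≥0∞) (n : ℕ) (A : X →L[𝕜] Y) (c : ℝ) : Prop :=
  ∀ (a : Fin n → 𝕜) (ε : ℝ), 0 < ε → ∀ᶠ w in iterFilter (blockFilter 𝕜 X ξ) n,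
    ‖A (∑ i, a i • w i)‖ < c * ‖(WithLp.toLp p a : PiLp p fun _ : Fin n => 𝕜)‖ + ε

theorem upperEstimate_adjointBall_iff (ξ : Ordinal.{u}) (p : ℝ≥0∞) {n : ℕ} (hn : n ≠ 0)
    (A : X →L[𝕜] Y) (c : ℝ) :
    UpperEstimate ξ p n (adjointBall A) c ↔ EventualBound ξ p n A c := by
  simp only [UpperEstimate, support_adjointBall]
  constructor
  · intro h a ε hε
    rw [eventually_iter_blockFilter_iff ξ hn]
    intro D _ _ _ x hx hw
    obtain ⟨t, ht, -⟩ := (eventually_iter_blockFilter_iff ξ hn fun _ => True).1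
      (.of_forall fun _ => trivial) D x hx hw
    have : Nonempty (maxNodes (decorate (Gamma ξ n) D)) := ⟨⟨t, ht⟩⟩
    obtain ⟨⟨t, ht⟩, h⟩ :=
      exists_lt_of_ciInf_lt ((h D a x hx hw).trans_lt (lt_add_of_pos_right _ hε))
    exact ⟨t, ht, h⟩
  · intro h D _ _ _ a x hx hw
    refine le_of_forall_pos_le_add fun ε hε => ?_
    obtain ⟨t, ht, h⟩ := (eventually_iter_blockFilter_iff ξ hn _).1 (h a ε hε) D x hx hw
    refine (ciInf_le ⟨0, ?_⟩ (⟨t, ht⟩ : maxNodes (decorate (Gamma ξ n) D))).trans h.le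
    rintro _ ⟨s, rfl⟩
    exact norm_nonneg _

section Operations

variable {ξ : Ordinal.{u}} {p : ℝ≥0∞} {n : ℕ} {A : X →L[𝕜] Y} {c d : ℝ}

theorem EventualBound.add {B : X →L[𝕜] Y} (hA : EventualBound ξ p n A c)
    (hB : EventualBound ξ p n B d) : EventualBound ξ p n (A + B) (c + d) := by
  intro a ε hε
  filter_upwards [hA a (ε / 2) (half_pos hε), hB a (ε / 2) (half_pos hε)] with w hAw hBw
  rw [add_apply, add_mul]
  linarith [norm_add_le (A (∑ i, a i • w i)) (B (∑ i, a i • w i))]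

theorem EventualBound.comp_left (hA : EventualBound ξ p n A c) {B : Y →L[𝕜] Z} (hd : 0 ≤ d)
    (hB : ‖B‖ ≤ d) : EventualBound ξ p n (B.comp A) (d * c) := by
  intro a ε hε
  filter_upwards [hA a (ε / (d + 1)) (by positivity)] with w hw
  calc ‖B (A (∑ i, a i • w i))‖ ≤ d * ‖A (∑ i, a i • w i)‖ := B.le_of_opNorm_le hB _
    _ ≤ d * (c * ‖(WithLp.toLp p a : PiLp p fun _ : Fin n => 𝕜)‖ + ε / (d + 1)) := by gcongr
    _ < d * c * ‖(WithLp.toLp p a : PiLp p fun _ : Fin n => 𝕜)‖ + ε := by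
      rw [mul_add, mul_assoc]
      linarith [mul_div_add_one_lt hd hε]

theorem EventualBound.smul (hA : EventualBound ξ p n A c) (b : 𝕜) :
    EventualBound ξ p n (b • A) (‖b‖ * c) := by
  refine hA.comp_left (B := b • ContinuousLinearMap.id 𝕜 Y) (norm_nonneg b) ?_
  rw [norm_smul]
  exact mul_le_of_le_one_right (norm_nonneg b) ContinuousLinearMap.norm_id_le

theorem EventualBound.comp_contraction (hA : EventualBound ξ p n A c) {T : W →L[𝕜] X}
    (hT : ‖T‖ ≤ 1) : EventualBound ξ p n (A.comp T) c := by
  intro a ε hε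
  filter_upwards [(tendsto_iterFilter (tendsto_blockFilter 𝕜 hT ξ) n).eventually (hA a ε hε)]
    with w hw
  simpa only [ContinuousLinearMap.comp_apply, map_sum, map_smul, Function.comp_apply] using hw

theorem EventualBound.comp_right (hA : EventualBound ξ p n A c) (C : W →L[𝕜] X) :
    EventualBound ξ p n (A.comp C) (‖C‖ * c) := by
  have hT : ‖((‖C‖⁻¹ : ℝ) : 𝕜) • C‖ ≤ 1 := by
    rw [norm_smul, RCLike.norm_ofReal, abs_of_nonneg (by positivity)]
    exact inv_mul_le_one
  have hAC : A.comp C = (‖C‖ : 𝕜) • A.comp (((‖C‖⁻¹ : ℝ) : 𝕜) • C) := by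
    rcases eq_or_ne C 0 with rfl | hC
    · simp
    · rw [ContinuousLinearMap.comp_smul, smul_smul, ← RCLike.ofReal_mul,
        mul_inv_cancel₀ (norm_ne_zero_iff.2 hC), RCLike.ofReal_one, one_smul]
  rw [hAC]
  simpa using (hA.comp_contraction hT).smul (‖C‖ : 𝕜)

theorem eventualBound_smulRight (f : StrongDual 𝕜 X) (y : Y) :
    EventualBound ξ p n (ContinuousLinearMap.smulRight f y) 0 := by
  intro a ε hε
  set C := (∑ i, ‖a i‖) * ‖y‖
  have hC : 0 ≤ C := by positivity
  have hf : ∀ᶠ z in blockFilter 𝕜 X ξ, ‖f z‖ < ε / (C + 1) :=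
    (eventually_norm_apply_lt_nullFilter 𝕜 f (by positivity)).filter_mono
      (blockFilter_le_nullFilter 𝕜 ξ)
  filter_upwards [eventually_iterFilter_forall hf n] with w hw
  rw [ContinuousLinearMap.smulRight_apply, norm_smul, map_sum, zero_mul, zero_add]
  simp only [map_smul]
  calc ‖∑ i, a i • f (w i)‖ * ‖y‖ ≤ (∑ i, ‖a i‖) * (ε / (C + 1)) * ‖y‖ := by
        gcongr
        exact norm_sum_smul_le _ a fun i _ => (hw i).le
    _ = C * (ε / (C + 1)) := by ring
    _ < ε := mul_div_add_one_lt hC hε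

theorem EventualBound.of_tendsto {ι : Type*} {l : Filter ι} {B : ι → X →L[𝕜] Y}
    (hB : Tendsto B l (𝓝 A)) (h : ∃ᶠ k in l, EventualBound ξ p n (B k) c) :
    EventualBound ξ p n A c := by
  intro a ε hε
  set S := ∑ i, ‖a i‖
  have hS : 0 ≤ S := by positivity
  have hnear : ∀ᶠ k in l, ‖A - B k‖ < ε / 2 / (S + 1) := by
    simpa only [dist_eq_norm'] using Metric.tendsto_nhds.1 hB (ε / 2 / (S + 1)) (by positivity)
  obtain ⟨k, hBk, hAB⟩ := (h.and_eventually hnear).exists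
  filter_upwards [hBk a (ε / 2) (half_pos hε), eventually_iter_blockFilter_norm_le 𝕜 ξ n]
    with w hBw hw
  have hdiff : ‖(A - B k) (∑ i, a i • w i)‖ ≤ ε / 2 / (S + 1) * S :=
    (A - B k).le_of_opNorm_le_of_le hAB.le <|
      (norm_sum_smul_le _ a fun i _ => hw i).trans_eq (mul_one S)
  rw [sub_apply] at hdiff
  linarith [norm_sub_norm_le (A (∑ i, a i • w i)) (B k (∑ i, a i • w i)),
    mul_div_add_one_lt hS (half_pos hε)]

variable [Fact (1 ≤ p)]

theorem EventualBound.mono (h : EventualBound ξ p n A c) (hcd : c ≤ d) :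
    EventualBound ξ p n A d :=
  fun a ε hε => (h a ε hε).mono fun _ hw => hw.trans_le (by gcongr)

theorem EventualBound.of_forall_gt (h : ∀ d > c, EventualBound ξ p n A d) :
    EventualBound ξ p n A c := by
  intro a ε hε
  set N := ‖(WithLp.toLp p a : PiLp p fun _ : Fin n => 𝕜)‖
  have hN : 0 ≤ N := norm_nonneg _
  have hδ : 0 < ε / 2 / (N + 1) := by positivity
  refine (h _ (lt_add_of_pos_right c hδ) a (ε / 2) (half_pos hε)).mono fun w hw => hw.trans ?_
  rw [add_mul]
  linarith [mul_div_add_one_lt hN (half_pos hε)]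

theorem alphaN_adjointBall_le_iff (hn : n ≠ 0) {c : ℝ≥0} :
    alphaN ξ p n (adjointBall A) ≤ c ↔ EventualBound ξ p n A c := by
  constructor
  · refine fun h => .of_forall_gt fun d hd => ?_
    have hlt : alphaN ξ p n (adjointBall A) < ENNReal.ofReal d := by
      refine h.trans_lt ?_
      rwa [← ENNReal.ofReal_coe_nnreal, ENNReal.ofReal_lt_ofReal_iff_of_nonneg c.coe_nonneg]
    simp only [alphaN, iInf_lt_iff] at hlt
    obtain ⟨r, ⟨hr, hU⟩, hrd⟩ := hlt
    exact ((upperEstimate_adjointBall_iff ξ p hn A r).1 hU).mono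
      ((ENNReal.ofReal_lt_ofReal_iff_of_nonneg hr.le).1 hrd).le
  · refine fun h => ENNReal.le_of_forall_pos_le_add fun δ hδ _ => ?_
    refine (iInf₂_le ((c : ℝ) + δ) ⟨by positivity,
      (upperEstimate_adjointBall_iff ξ p hn A _).2 (h.mono (by simp))⟩).trans_eq ?_
    rw [← NNReal.coe_add, ENNReal.ofReal_coe_nnreal, ENNReal.coe_add]

end Operations

variable {ξ : Ordinal.{u}} {p : ℝ≥0∞} [Fact (1 ≤ p)]

theorem alpha_adjointBall_le_iff {A : X →L[𝕜] Y} {c : ℝ≥0} :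
    alpha ξ p (adjointBall A) ≤ c ↔ ∀ n ≠ 0, EventualBound ξ p n A c := by
  simp only [alpha, iSup_le_iff, Nat.one_le_iff_ne_zero]
  exact forall₂_congr fun n hn => alphaN_adjointBall_le_iff hn

theorem alpha_adjointBall_le_mul {A : X →L[𝕜] Y} {B : W →L[𝕜] Z} {d : ℝ≥0}
    (hA : alpha ξ p (adjointBall A) ≠ ∞)
    (h : ∀ n c, EventualBound ξ p n A c → EventualBound ξ p n B (d * c)) :
    alpha ξ p (adjointBall B) ≤ d * alpha ξ p (adjointBall A) := by
  lift alpha ξ p (adjointBall A) to ℝ≥0 using hA with c hc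
  rw [← ENNReal.coe_mul, alpha_adjointBall_le_iff]
  exact fun n hn => h n c (alpha_adjointBall_le_iff.1 hc.ge n hn)

theorem alpha_add_le (A B : X →L[𝕜] Y) :
    alpha ξ p (adjointBall (A + B)) ≤ alpha ξ p (adjointBall A) + alpha ξ p (adjointBall B) := by
  rcases eq_or_ne (alpha ξ p (adjointBall A)) ∞ with hA | hA
  · simp [hA]
  rcases eq_or_ne (alpha ξ p (adjointBall B)) ∞ with hB | hB
  · simp [hB]
  lift alpha ξ p (adjointBall A) to ℝ≥0 using hA with c hc
  lift alpha ξ p (adjointBall B) to ℝ≥0 using hB with d hd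
  rw [← ENNReal.coe_add, alpha_adjointBall_le_iff]
  exact fun n hn =>
    (alpha_adjointBall_le_iff.1 hc.ge n hn).add (alpha_adjointBall_le_iff.1 hd.ge n hn)

theorem alpha_comp_le (C : W →L[𝕜] X) (B : X →L[𝕜] Y) (A : Y →L[𝕜] Z)
    (hB : alpha ξ p (adjointBall B) ≠ ∞) :
    alpha ξ p (adjointBall (A.comp (B.comp C))) ≤
      ‖A‖ₑ * alpha ξ p (adjointBall B) * ‖C‖ₑ := by
  rw [mul_right_comm, enorm_eq_nnnorm, enorm_eq_nnnorm, ← ENNReal.coe_mul]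
  refine alpha_adjointBall_le_mul hB fun n c hc => ?_
  rw [NNReal.coe_mul, mul_assoc]
  exact (hc.comp_right C).comp_left (norm_nonneg A) le_rfl

theorem alpha_smul_le (c : 𝕜) (A : X →L[𝕜] Y) (hA : alpha ξ p (adjointBall A) ≠ ∞) :
    alpha ξ p (adjointBall (c • A)) ≤ ‖c‖ₑ * alpha ξ p (adjointBall A) :=
  alpha_adjointBall_le_mul hA fun _ _ h => h.smul c

theorem alpha_smulRight (f : StrongDual 𝕜 X) (y : Y) :
    alpha ξ p (adjointBall (ContinuousLinearMap.smulRight f y)) = 0 := by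
  rw [← nonpos_iff_eq_zero, ← ENNReal.coe_zero, alpha_adjointBall_le_iff]
  exact fun n _ => eventualBound_smulRight f y

theorem alpha_zero : alpha ξ p (adjointBall (0 : X →L[𝕜] Y)) = 0 := by
  simpa using alpha_smulRight (ξ := ξ) (p := p) (0 : StrongDual 𝕜 X) (0 : Y)

theorem alpha_smul (c : 𝕜) (A : X →L[𝕜] Y) (hA : alpha ξ p (adjointBall A) ≠ ∞) :
    alpha ξ p (adjointBall (c • A)) = ‖c‖ₑ * alpha ξ p (adjointBall A) := by
  refine le_antisymm (alpha_smul_le c A hA) ?_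
  rcases eq_or_ne c 0 with rfl | hc
  · simp
  have hcA : alpha ξ p (adjointBall (c • A)) ≠ ∞ :=
    ((alpha_smul_le c A hA).trans_lt (ENNReal.mul_lt_top enorm_lt_top hA.lt_top)).ne
  calc ‖c‖ₑ * alpha ξ p (adjointBall A)
      = ‖c‖ₑ * alpha ξ p (adjointBall (c⁻¹ • c • A)) := by rw [inv_smul_smul₀ hc]
    _ ≤ ‖c‖ₑ * (‖c⁻¹‖ₑ * alpha ξ p (adjointBall (c • A))) := by
        gcongr
        exact alpha_smul_le c⁻¹ (c • A) hcA
    _ = alpha ξ p (adjointBall (c • A)) := by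
        rw [← mul_assoc, ← enorm_mul, mul_inv_cancel₀ hc, enorm_one, one_mul]

theorem alpha_le_of_tendsto {ι : Type*} {l : Filter ι} {A : X →L[𝕜] Y} {B : ι → X →L[𝕜] Y}
    {c : ℝ≥0∞} (hB : Tendsto B l (𝓝 A)) (h : ∃ᶠ k in l, alpha ξ p (adjointBall (B k)) ≤ c) :
    alpha ξ p (adjointBall A) ≤ c := by
  induction c with
  | top => exact le_top
  | coe c =>
    exact alpha_adjointBall_le_iff.2 fun n hn =>
      .of_tendsto hB (h.mono fun _ hk => alpha_adjointBall_le_iff.1 hk n hn)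

end Estimate

/-! ### Conjugate exponents -/

section Exponent

theorem conjugate_exponent_cases (p : ℝ≥0∞) (q : ℝ) [ENNReal.HolderConjugate p (.ofReal q)] :
    p = ∞ ∧ q = 1 ∨ p.toReal.HolderConjugate q := by
  have hq : 1 ≤ q := ENNReal.one_le_ofReal.1 (ENNReal.HolderConjugate.one_le _ p)
  rcases eq_or_ne p ∞ with hp | hp
  · exact .inl ⟨hp, ENNReal.ofReal_eq_one.1
      ((ENNReal.HolderConjugate.eq_top_iff_eq_one p (.ofReal q)).1 hp)⟩
  · have h := ENNReal.HolderConjugate.toReal_of_ne_top hp (ENNReal.ofReal_ne_top (r := q))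
    rw [ENNReal.toReal_ofReal (by positivity)] at h
    exact .inr h

theorem le_rpow_of_le_mul_rpow {S M q : ℝ} (hq : 0 < q) (hS : 0 ≤ S) (hM : 0 ≤ M)
    (h : S ≤ M * S ^ (1 - 1 / q)) : S ≤ M ^ q := by
  rcases hS.eq_or_lt with rfl | hS'
  · exact Real.rpow_nonneg hM q
  have hS_eq : S = S ^ (1 / q) * S ^ (1 - 1 / q) := by
    rw [← Real.rpow_add hS', add_sub_cancel, Real.rpow_one]
  rw [← Real.rpow_inv_le_iff_of_pos hS hM (by positivity), ← one_div]
  exact le_of_mul_le_mul_right (hS_eq.symm.trans_le h) (Real.rpow_pos_of_pos hS' _)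

variable {𝕜 : Type*} [RCLike 𝕜] {p : ℝ≥0∞} {q : ℝ} [ENNReal.HolderConjugate p (.ofReal q)] {n : ℕ}

theorem sum_norm_mul_le (a : Fin n → 𝕜) {b : Fin n → ℝ} (hb : ∀ i, 0 ≤ b i) :
    ∑ i, ‖a i‖ * b i ≤
      ‖(WithLp.toLp p a : PiLp p fun _ : Fin n => 𝕜)‖ * (∑ i, b i ^ q) ^ (1 / q) := by
  rcases conjugate_exponent_cases p q with ⟨rfl, rfl⟩ | h
  · simp only [Real.rpow_one, div_one, Finset.mul_sum]
    gcongr with i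
    · exact hb i
    · exact PiLp.norm_apply_le (WithLp.toLp ∞ a : PiLp ∞ fun _ : Fin n => 𝕜) i
  · rw [PiLp.norm_eq_sum h.pos]
    exact Real.inner_le_Lp_mul_Lq_of_nonneg _ h (fun i _ => norm_nonneg _) fun i _ => hb i

/-- The vector `(εᵢ ^ (q - 1))ᵢ` is extremal in Hölder's inequality against `ε`. -/
theorem norm_toLp_rpow_sub_one_le (𝕜 : Type*) [RCLike 𝕜] {ε : Fin n → ℝ} (hε : ∀ i, 0 ≤ ε i) :
    ‖(WithLp.toLp p fun i => ((ε i ^ (q - 1) : ℝ) : 𝕜) : PiLp p fun _ : Fin n => 𝕜)‖ ≤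
      (∑ i, ε i ^ q) ^ (1 - 1 / q) := by
  rcases conjugate_exponent_cases p q with ⟨rfl, rfl⟩ | h
  · rw [PiLp.norm_eq_ciSup]
    exact Real.iSup_le (fun i => by simp) (by simp)
  · have hpow (i) : (ε i ^ (q - 1)) ^ p.toReal = ε i ^ q := by
      rw [← Real.rpow_mul (hε i), h.symm.sub_one_mul_conj]
    have hexp : 1 - 1 / q = 1 / p.toReal := by
      rw [one_div, one_div, ← h.inv_add_inv_eq_one, add_sub_cancel_right]
    rw [PiLp.norm_eq_sum h.pos, hexp]
    simp only [RCLike.norm_ofReal, abs_of_nonneg (Real.rpow_nonneg (hε _) _), hpow, le_refl]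

theorem sum_rpow_le_of_forall (𝕜 : Type*) [RCLike 𝕜] (p : ℝ≥0∞)
    [ENNReal.HolderConjugate p (.ofReal q)] {ε : Fin n → ℝ} (hε : ∀ i, 0 ≤ ε i) {M : ℝ}
    (hM : 0 ≤ M) (h : ∀ a : Fin n → ℝ, (∀ i, 0 ≤ a i) →
      ∑ i, a i * ε i ≤ M * ‖(WithLp.toLp p fun i => (a i : 𝕜) : PiLp p fun _ : Fin n => 𝕜)‖) :
    ∑ i, ε i ^ q ≤ M ^ q := by
  have hq : 1 ≤ q := ENNReal.one_le_ofReal.1 (ENNReal.HolderConjugate.one_le _ p)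
  have hpow (i) : ε i ^ (q - 1) * ε i = ε i ^ q := by
    rw [← Real.rpow_add_one' (hε i) (by linarith), sub_add_cancel]
  have hsum : 0 ≤ ∑ i, ε i ^ q := Finset.sum_nonneg fun i _ => Real.rpow_nonneg (hε i) q
  refine le_rpow_of_le_mul_rpow (by positivity) hsum hM ?_
  calc ∑ i, ε i ^ q = ∑ i, ε i ^ (q - 1) * ε i := by simp only [hpow]
    _ ≤ M * ‖(WithLp.toLp p fun i => ((ε i ^ (q - 1) : ℝ) : 𝕜) : PiLp p fun _ : Fin n => 𝕜)‖ :=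
      h _ fun i => Real.rpow_nonneg (hε i) _
    _ ≤ M * (∑ i, ε i ^ q) ^ (1 - 1 / q) := by
      gcongr
      exact norm_toLp_rpow_sub_one_le 𝕜 hε

end Exponent

/-! ### Summable Szlenk index and upper estimates -/

section Equivalence

variable {𝕜 : Type} [RCLike 𝕜] {X Y : Type v} [NormedAddCommGroup X] [NormedSpace 𝕜 X]
  [NormedAddCommGroup Y] [NormedSpace 𝕜 Y]

theorem foldr_deriveIter_filter_pos (ξ : Ordinal.{u}) (K : Set (StrongDual 𝕜 X)) {l : List ℝ}
    (hl : ∀ ε ∈ l, 0 ≤ ε) :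
    (l.filter (0 < ·)).foldr (fun ε L => deriveIter ε (ω ^ ξ) L) K =
      l.foldr (fun ε L => deriveIter ε (ω ^ ξ) L) K := by
  rw [List.foldr_filter]
  refine List.foldr_ext _ _ _ fun ε hε L => ?_
  rcases (hl ε hε).eq_or_lt with rfl | hpos
  · simp [deriveIter_zero_left]
  · simp [hpos]

theorem sum_rpow_filter_pos {q : ℝ} (hq : q ≠ 0) {l : List ℝ} (hl : ∀ ε ∈ l, 0 ≤ ε) :
    ((l.filter (0 < ·)).map (· ^ q)).sum = (l.map (· ^ q)).sum := by
  rw [List.sum_eq_foldr, List.sum_eq_foldr, List.foldr_map, List.foldr_map, List.foldr_filter]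
  refine List.foldr_ext _ _ _ fun ε hε s => ?_
  rcases (hl ε hε).eq_or_lt with rfl | hpos
  · simp [Real.zero_rpow hq]
  · simp [hpos]

theorem sum_mul_le_norm_apply_sum {A : X →L[𝕜] Y} {f : StrongDual 𝕜 X} (hf : f ∈ adjointBall A)
    {n : ℕ} {a r : Fin n → ℝ} {w : Fin n → X} (ha : ∀ i, 0 ≤ a i)
    (hr : ∀ i, r i ≤ RCLike.re (f (w i))) :
    ∑ i, a i * r i ≤ ‖A (∑ i, (a i : 𝕜) • w i)‖ := by
  obtain ⟨g, hg, rfl⟩ := hf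
  calc ∑ i, a i * r i ≤ ∑ i, a i * RCLike.re (g (A (w i))) := by
        gcongr with i
        · exact ha i
        · exact hr i
    _ = RCLike.re (g (A (∑ i, (a i : 𝕜) • w i))) := by simp [map_sum]
    _ ≤ ‖g (A (∑ i, (a i : 𝕜) • w i))‖ := RCLike.re_le_norm _
    _ ≤ 1 * ‖A (∑ i, (a i : 𝕜) • w i)‖ := g.le_of_opNorm_le (mem_closedBall_zero_iff.1 hg) _
    _ = ‖A (∑ i, (a i : 𝕜) • w i)‖ := one_mul _

theorem exists_mem_adjointBall_norm_apply_sum_le (A : X →L[𝕜] Y) {n : ℕ} (a : Fin n → 𝕜)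
    (w : Fin n → X) :
    ∃ f ∈ adjointBall A, ‖A (∑ i, a i • w i)‖ ≤ ∑ i, ‖a i‖ * ‖f (w i)‖ := by
  obtain ⟨g, hg, hgA⟩ := exists_dual_vector'' 𝕜 (A (∑ i, a i • w i))
  refine ⟨g.comp A, ⟨g, mem_closedBall_zero_iff.2 hg, rfl⟩, ?_⟩
  calc ‖A (∑ i, a i • w i)‖ = ‖g (A (∑ i, a i • w i))‖ := by
        rw [hgA, RCLike.norm_ofReal, abs_norm]
    _ = ‖∑ i, a i • g (A (w i))‖ := by simp only [map_sum, map_smul]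
    _ ≤ ∑ i, ‖a i‖ * ‖g (A (w i))‖ := norm_sum_le_of_le _ fun i _ => norm_smul_le _ _

theorem exists_natCast_mul_le_le {δ R v : ℝ} (hδ : 0 < δ) (hv : 0 ≤ v) (hvR : v ≤ R) :
    ∃ k : Fin (⌊R / δ⌋₊ + 1), δ * (k : ℕ) ≤ v ∧ v ≤ δ * (k : ℕ) + δ := by
  refine ⟨⟨⌊v / δ⌋₊, Nat.lt_succ_of_le (by gcongr)⟩, ?_, ?_⟩
  · exact (le_div_iff₀' hδ).1 (Nat.floor_le (by positivity))
  · linarith [(div_lt_iff₀' hδ).1 (Nat.lt_floor_add_one (v / δ))]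

variable {ξ : Ordinal.{u}} {p : ℝ≥0∞} {q : ℝ} {n : ℕ} {A : X →L[𝕜] Y}

/-- Discretising the values `‖f (wᵢ)‖` leaves finitely many profiles, and one of them occurs
frequently. -/
theorem exists_frequently_le_norm_apply {a : Fin n → 𝕜} {r δ : ℝ} (hδ : 0 < δ)
    (h : ∃ᶠ w in iterFilter (blockFilter 𝕜 X ξ) n, r ≤ ‖A (∑ i, a i • w i)‖) :
    ∃ b : Fin n → ℝ, (∀ i, 0 ≤ b i) ∧ r ≤ ∑ i, ‖a i‖ * (b i + δ) ∧
      ∃ᶠ w in iterFilter (blockFilter 𝕜 X ξ) n, ∃ f ∈ adjointBall A, ∀ i, b i ≤ ‖f (w i)‖ := by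
  have hprofile : ∃ᶠ w in iterFilter (blockFilter 𝕜 X ξ) n,
      ∃ k : Fin n → Fin (⌊‖A‖ / δ⌋₊ + 1), r ≤ ∑ i, ‖a i‖ * (δ * (k i : ℕ) + δ) ∧
        ∃ f ∈ adjointBall A, ∀ i, δ * (k i : ℕ) ≤ ‖f (w i)‖ := by
    refine (h.and_eventually (eventually_iter_blockFilter_norm_le 𝕜 ξ n)).mono ?_
    rintro w ⟨hrw, hw⟩
    obtain ⟨f, hf, hfw⟩ := exists_mem_adjointBall_norm_apply_sum_le A a w
    have hbound (i) : ‖f (w i)‖ ≤ ‖A‖ := by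
      simpa using f.le_of_opNorm_le_of_le (norm_le_of_mem_adjointBall hf) (hw i)
    choose k hk_le hk_ge using fun i => exists_natCast_mul_le_le hδ (norm_nonneg _) (hbound i)
    refine ⟨k, hrw.trans (hfw.trans ?_), f, hf, hk_le⟩
    gcongr with i
    exact hk_ge i
  obtain ⟨k, hk⟩ := frequently_exists.1 hprofile
  obtain ⟨-, hr, -⟩ := hk.exists
  exact ⟨fun i => δ * (k i : ℕ), fun i => by positivity, hr, hk.mono fun _ => And.right⟩

variable [ENNReal.HolderConjugate p (.ofReal q)]

theorem EventualBound.sum_rpow_le_of_deriveFold_nonempty {c : ℝ} (hc : 0 ≤ c)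
    (h : EventualBound ξ p n A c) {ε : Fin n → ℝ} (hε : ∀ i, 0 < ε i)
    (hne : (deriveFold ξ ε (adjointBall A)).Nonempty) : ∑ i, ε i ^ q ≤ (5 * c) ^ q := by
  refine sum_rpow_le_of_forall 𝕜 p (fun i => (hε i).le) (by positivity) fun a ha => ?_
  refine le_of_forall_pos_le_add fun δ hδ => ?_
  obtain ⟨w, ⟨f, hf, hfw⟩, hw⟩ :=
    ((frequently_iterFilter_of_deriveFold_nonempty ξ hε hne).and_eventually
      (h (fun i => (a i : 𝕜)) (δ / 5) (by positivity))).exists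
  have hsum : ∑ i, a i * (ε i / 5) = (∑ i, a i * ε i) / 5 := by
    simp only [Finset.sum_div, mul_div_assoc]
  linarith [sum_mul_le_norm_apply_sum hf ha fun i => (hfw i).le]

theorem hasSummableSzlenkIndex_of_eventualBound {c : ℝ} (hc : 0 ≤ c)
    (h : ∀ n ≠ 0, EventualBound ξ p n A c) : HasSummableSzlenkIndex ξ q (adjointBall A) := by
  have hq : 1 ≤ q := ENNReal.one_le_ofReal.1 (ENNReal.HolderConjugate.one_le _ p)
  refine ⟨5 * c, by positivity, fun l hl hne => ?_⟩
  rw [← foldr_deriveIter_filter_pos ξ _ hl] at hne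
  rw [← sum_rpow_filter_pos (by positivity) hl]
  have hpos : ∀ ε ∈ l.filter (0 < ·), 0 < ε := fun ε hε => by simpa using (List.mem_filter.1 hε).2
  generalize l.filter (0 < ·) = m at hne hpos
  obtain ⟨n, ε, rfl⟩ : ∃ n, ∃ ε : Fin n → ℝ, m = List.ofFn ε := ⟨_, m.get, (List.ofFn_get m).symm⟩
  rcases eq_or_ne n 0 with rfl | hn
  · simpa using Real.rpow_nonneg (by positivity : 0 ≤ 5 * c) q
  rw [List.map_ofFn, List.sum_ofFn]
  exact (h n hn).sum_rpow_le_of_deriveFold_nonempty hc (fun i => hpos _ (by simp)) hne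

theorem eventualBound_of_sum_rpow_le {M : ℝ} (hM : 0 ≤ M)
    (h : ∀ ε : Fin n → ℝ, (∀ i, 0 ≤ ε i) → (deriveFold ξ ε (adjointBall A)).Nonempty →
      ∑ i, ε i ^ q ≤ M ^ q) : EventualBound ξ p n A (2 * M) := by
  have hq : 1 ≤ q := ENNReal.one_le_ofReal.1 (ENNReal.HolderConjugate.one_le _ p)
  have : Fact (1 ≤ p) := ⟨ENNReal.HolderConjugate.one_le p (.ofReal q)⟩
  intro a ε hε
  by_contra hnot
  simp only [not_eventually, not_lt] at hnot
  set N := ‖(WithLp.toLp p a : PiLp p fun _ : Fin n => 𝕜)‖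
  have hN : 0 ≤ N := norm_nonneg _
  set S := ∑ i, ‖a i‖ with hS_def
  have hS : 0 ≤ S := by positivity
  obtain ⟨b, hb, hr, hfreq⟩ :=
    exists_frequently_le_norm_apply (δ := ε / (S + 1)) (by positivity) hnot
  have hne : (deriveFold ξ (fun i => b i / 2) (adjointBall A)).Nonempty := by
    refine deriveFold_nonempty_of_frequently ξ (isWeakStarClosed_adjointBall A)
      (fun f hf => norm_le_of_mem_adjointBall hf) (fun i => ?_) hfreq
    rcases (hb i).eq_or_lt with hi | hi
    · exact .inl (by simp [← hi])
    · exact .inr ⟨half_pos hi, half_lt_self hi⟩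
  have hb2 (i) : 0 ≤ b i / 2 := div_nonneg (hb i) zero_le_two
  have hsumq : (∑ i, (b i / 2) ^ q) ^ (1 / q) ≤ M := by
    rw [one_div, Real.rpow_inv_le_iff_of_pos _ hM (by positivity)]
    · exact h _ hb2 hne
    · exact Finset.sum_nonneg fun i _ => Real.rpow_nonneg (hb2 i) q
  have hHolder : ∑ i, ‖a i‖ * (b i / 2) ≤ N * M :=
    (sum_norm_mul_le a hb2).trans (mul_le_mul_of_nonneg_left hsumq hN)
  have hsplit : ∑ i, ‖a i‖ * (b i + ε / (S + 1)) =
      2 * ∑ i, ‖a i‖ * (b i / 2) + S * (ε / (S + 1)) := by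
    rw [hS_def, Finset.mul_sum, Finset.sum_mul, ← Finset.sum_add_distrib]
    exact Finset.sum_congr rfl fun i _ => by ring
  linarith [mul_div_add_one_lt hS hε]

theorem hasSummableSzlenkIndex_iff :
    HasSummableSzlenkIndex ξ q (adjointBall A) ↔ alpha ξ p (adjointBall A) ≠ ∞ := by
  have : Fact (1 ≤ p) := ⟨ENNReal.HolderConjugate.one_le p (.ofReal q)⟩
  constructor
  · rintro ⟨M, hM, h⟩
    lift M to ℝ≥0 using hM
    have hle : alpha ξ p (adjointBall A) ≤ (2 * M : ℝ≥0) := by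
      refine alpha_adjointBall_le_iff.2 fun n _ =>
        eventualBound_of_sum_rpow_le (q := q) M.coe_nonneg fun ε hε hne => ?_
      rw [← List.sum_ofFn, ← Function.comp_def (· ^ q) ε, ← List.map_ofFn]
      exact h _ (by simpa [List.mem_ofFn] using hε) hne
    exact ne_top_of_le_ne_top ENNReal.coe_ne_top hle
  · intro h
    lift alpha ξ p (adjointBall A) to ℝ≥0 using h with c hc
    exact hasSummableSzlenkIndex_of_eventualBound c.coe_nonneg (alpha_adjointBall_le_iff.1 hc.ge)

end Equivalence

/-! ### The Banach ideal -/

section Ideal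

variable {𝕜 : Type} [RCLike 𝕜] {ξ : Ordinal.{u}} {p : ℝ≥0∞}

section Norm

variable [Fact (1 ≤ p)] {X Y : Type v}
  [NormedAddCommGroup X] [NormedSpace 𝕜 X] [NormedAddCommGroup Y] [NormedSpace 𝕜 Y]

variable (ξ p) in
/-- The operators with `α_{ξ,p}(A) < ∞`, as a subspace of the space of operators. -/
def alphaFiniteSubmodule (𝕜 : Type) [RCLike 𝕜] (X Y : Type v) [NormedAddCommGroup X]
    [NormedSpace 𝕜 X] [NormedAddCommGroup Y] [NormedSpace 𝕜 Y] : Submodule 𝕜 (X →L[𝕜] Y) where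
  carrier := {A | alpha ξ p (adjointBall A) ≠ ∞}
  add_mem' hA hB := ne_top_of_le_ne_top (ENNReal.add_ne_top.2 ⟨hA, hB⟩) (alpha_add_le _ _)
  zero_mem' := by simp [alpha_zero]
  smul_mem' c A hA :=
    ne_top_of_le_ne_top (ENNReal.mul_ne_top enorm_ne_top hA) (alpha_smul_le c A hA)

theorem tendsto_alpha_sub {A : ℕ → X →L[𝕜] Y} {B : X →L[𝕜] Y} (hB : Tendsto A atTop (𝓝 B))
    (hA : ∀ ε : ℝ≥0∞, 0 < ε → ∃ N, ∀ k ≥ N, ∀ l ≥ N, alpha ξ p (adjointBall (A k - A l)) ≤ ε) :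
    Tendsto (fun k => alpha ξ p (adjointBall (A k - B))) atTop (𝓝 0) := by
  refine ENNReal.tendsto_atTop_zero.2 fun ε hε => ?_
  obtain ⟨N, hN⟩ := hA ε hε
  exact ⟨N, fun k hk => alpha_le_of_tendsto (hB.const_sub (A k))
    ((eventually_ge_atTop N).mono (hN k hk)).frequently⟩

variable [CompleteSpace X] [CompleteSpace Y]

theorem szlenkNorm_eq_zero_iff {A : X →L[𝕜] Y} : szlenkNorm 𝕜 ξ p X Y A = 0 ↔ A = 0 := by
  rw [szlenkNorm, add_eq_zero, enorm_eq_nnnorm, ENNReal.coe_eq_zero, nnnorm_eq_zero]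
  exact ⟨And.left, by rintro rfl; exact ⟨rfl, alpha_zero⟩⟩

theorem szlenkNorm_smul (c : 𝕜) {A : X →L[𝕜] Y} (hA : alpha ξ p (adjointBall A) ≠ ∞) :
    szlenkNorm 𝕜 ξ p X Y (c • A) = ‖c‖ₑ * szlenkNorm 𝕜 ξ p X Y A := by
  rw [szlenkNorm, szlenkNorm, alpha_smul c A hA, enorm_smul, mul_add]

theorem szlenkNorm_add_le (A B : X →L[𝕜] Y) :
    szlenkNorm 𝕜 ξ p X Y (A + B) ≤ szlenkNorm 𝕜 ξ p X Y A + szlenkNorm 𝕜 ξ p X Y B :=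
  (add_le_add (enorm_add_le A B) (alpha_add_le A B)).trans_eq (add_add_add_comm _ _ _ _)

theorem szlenkNorm_comp_le {W Z : Type v} [NormedAddCommGroup W] [NormedSpace 𝕜 W]
    [CompleteSpace W] [NormedAddCommGroup Z] [NormedSpace 𝕜 Z] [CompleteSpace Z] (C : W →L[𝕜] X)
    {B : X →L[𝕜] Y} (A : Y →L[𝕜] Z) (hB : alpha ξ p (adjointBall B) ≠ ∞) :
    szlenkNorm 𝕜 ξ p W Z (A.comp (B.comp C)) ≤ ‖A‖ₑ * szlenkNorm 𝕜 ξ p X Y B * ‖C‖ₑ := by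
  have hnorm : ‖A.comp (B.comp C)‖ₑ ≤ ‖A‖ₑ * ‖B‖ₑ * ‖C‖ₑ := by
    rw [mul_assoc]
    exact (A.opENorm_comp_le _).trans (by gcongr; exact B.opENorm_comp_le C)
  rw [szlenkNorm, szlenkNorm, mul_add, add_mul]
  exact add_le_add hnorm (alpha_comp_le C B A hB)

theorem szlenkNorm_smulRight (f : StrongDual 𝕜 X) (y : Y) :
    szlenkNorm 𝕜 ξ p X Y (ContinuousLinearMap.smulRight f y) = ‖f‖ₑ * ‖y‖ₑ := by
  rw [szlenkNorm, alpha_smulRight, add_zero]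
  simp only [enorm_eq_nnnorm, ContinuousLinearMap.nnnorm_smulRight_apply, ENNReal.coe_mul]

theorem exists_tendsto_szlenkNorm_sub {A : ℕ → X →L[𝕜] Y}
    (hfin : ∀ k, alpha ξ p (adjointBall (A k)) ≠ ∞)
    (hA : ∀ ε : ℝ≥0∞, 0 < ε → ∃ N, ∀ k ≥ N, ∀ l ≥ N, szlenkNorm 𝕜 ξ p X Y (A k - A l) < ε) :
    ∃ B : X →L[𝕜] Y, alpha ξ p (adjointBall B) ≠ ∞ ∧
      Tendsto (fun k => szlenkNorm 𝕜 ξ p X Y (A k - B)) atTop (𝓝 0) := by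
  have hcauchy : CauchySeq A := EMetric.cauchySeq_iff.2 fun ε hε => by
    obtain ⟨N, hN⟩ := hA ε hε
    refine ⟨N, fun k hk l hl => ?_⟩
    rw [edist_eq_enorm_sub]
    exact le_self_add.trans_lt (hN k hk l hl)
  obtain ⟨B, hB⟩ := cauchySeq_tendsto_of_complete hcauchy
  have hnorm : Tendsto (fun k => ‖A k - B‖ₑ) atTop (𝓝 0) := by
    simpa only [edist_eq_enorm_sub] using tendsto_iff_edist_tendsto_0.1 hB
  have halpha : Tendsto (fun k => alpha ξ p (adjointBall (A k - B))) atTop (𝓝 0) :=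
    tendsto_alpha_sub hB fun ε hε => (hA ε hε).imp fun N hN k hk l hl =>
      le_add_self.trans (hN k hk l hl).le
  refine ⟨B, ?_, by simpa only [add_zero, szlenkNorm] using hnorm.add halpha⟩
  obtain ⟨k, hk⟩ := (halpha.eventually_lt_const zero_lt_one).exists
  have hmem : A k - (A k - B) ∈ alphaFiniteSubmodule ξ p 𝕜 X Y :=
    Submodule.sub_mem _ (hfin k) (hk.trans ENNReal.one_lt_top).ne
  rwa [sub_sub_cancel] at hmem

end Norm

theorem id_ulift_eq_smulRight (𝕜 : Type) [RCLike 𝕜] : ContinuousLinearMap.id 𝕜 (ULift.{v} 𝕜) =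
    ContinuousLinearMap.smulRight
      ((ContinuousLinearEquiv.ulift : ULift.{v} 𝕜 ≃L[𝕜] 𝕜) : ULift.{v} 𝕜 →L[𝕜] 𝕜) (ULift.up 1) := by
  ext z
  exact (mul_one z.down).symm

variable (𝕜 ξ)

theorem isOperatorIdeal_summableSzlenkClass (p : ℝ≥0∞) (q : ℝ)
    [ENNReal.HolderConjugate p (.ofReal q)] :
    IsOperatorIdeal.{v} 𝕜 (summableSzlenkClass.{u, v} 𝕜 ξ q) := by
  have : Fact (1 ≤ p) := ⟨ENNReal.HolderConjugate.one_le p (.ofReal q)⟩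
  refine ⟨?_, ?_, ?_⟩
  · intro W X Y Z _ _ _ _ _ _ _ _ _ _ _ _ C B A hB
    replace hB := (hasSummableSzlenkIndex_iff (p := p)).1 hB
    refine (hasSummableSzlenkIndex_iff (p := p)).2 (ne_top_of_le_ne_top ?_ (alpha_comp_le C B A hB))
    finiteness
  · refine (hasSummableSzlenkIndex_iff (p := p)).2 ?_
    rw [id_ulift_eq_smulRight, alpha_smulRight]
    exact ENNReal.zero_ne_top
  · intro X Y _ _ _ _ _ _
    exact ⟨alphaFiniteSubmodule ξ p 𝕜 X Y, Set.ext fun A => hasSummableSzlenkIndex_iff.symm⟩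

theorem isIdealNorm_szlenkNorm (p : ℝ≥0∞) (q : ℝ) [ENNReal.HolderConjugate p (.ofReal q)] :
    IsIdealNorm.{v} 𝕜 (summableSzlenkClass.{u, v} 𝕜 ξ q) (szlenkNorm.{u, v} 𝕜 ξ p) := by
  have : Fact (1 ≤ p) := ⟨ENNReal.HolderConjugate.one_le p (.ofReal q)⟩
  exact
    { lt_top := fun _ _ _ _ _ _ _ _ _ hA =>
        ENNReal.add_lt_top.2 ⟨enorm_lt_top, (hasSummableSzlenkIndex_iff.1 hA).lt_top⟩
      eq_zero_iff := fun _ _ _ _ _ _ _ _ _ _ => szlenkNorm_eq_zero_iff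
      smul := fun _ _ _ _ _ _ _ _ c _ hA => szlenkNorm_smul c (hasSummableSzlenkIndex_iff.1 hA)
      add_le := fun _ _ _ _ _ _ _ _ A _ B _ => szlenkNorm_add_le A B
      comp_le := fun _ _ _ _ _ _ _ _ _ _ _ _ _ _ _ _ C _ A hB =>
        szlenkNorm_comp_le C A (hasSummableSzlenkIndex_iff.1 hB)
      rank_one := fun _ _ _ _ _ _ _ _ f y => szlenkNorm_smulRight f y }

end Ideal

end Szlenk

end

theorem mainTheorem4 {𝕜 : Type} [RCLike 𝕜] (ξ : Ordinal.{u}) (p : ℝ≥0∞) (q : ℝ)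
    (hp : 1 < p) (hq : 1 ≤ q) (hpq : p⁻¹ + (ENNReal.ofReal q)⁻¹ = 1) :
    Szlenk.IsBanachIdeal.{v} 𝕜 (Szlenk.summableSzlenkClass.{u, v} 𝕜 ξ q)
      (Szlenk.szlenkNorm.{u, v} 𝕜 ξ p) := by
  have : ENNReal.HolderConjugate p (.ofReal q) := ENNReal.holderConjugate_iff.2 hpq
  have : Fact (1 ≤ p) := ⟨hp.le⟩
  refine ⟨Szlenk.isOperatorIdeal_summableSzlenkClass 𝕜 ξ p q,
    Szlenk.isIdealNorm_szlenkNorm 𝕜 ξ p q, ?_⟩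
  intro X Y _ _ _ _ _ _ A hA hcauchy
  obtain ⟨B, hB, hlim⟩ := Szlenk.exists_tendsto_szlenkNorm_sub
    (fun k => Szlenk.hasSummableSzlenkIndex_iff.1 (hA k)) hcauchy
  exact ⟨B, Szlenk.hasSummableSzlenkIndex_iff.2 hB, hlim⟩
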